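/- **Notation.** Let $\mathbb{C}^+=\{z=x+is: x\in\mathbb{R},\ s>0\}$ with the measure $d\mu^+(z)=s^{-2}\,dx\,ds$. Put $\varrho(z,w)=\left|\frac{z-w}{z-\overline w}\right|$, $\mathcal{D}_R(z)=\{w\in\mathbb{C}^+:\varrho(z,w)<R\}$ and $\mathcal{D}_R=\mathcal{D}_R(i)$. With $\widehat f(\xi)=\int_{\mathbb{R}} f(t)e^{-i\xi t}\,dt$ (extended to $L^2(\mathbb{R})$), let $H^2(\mathbb{C}^+)$ be the space of all $f\in L^2(\mathbb{R})$ with $\widehat f=0$ a.e. on $(-\infty,0)$, with the inner product of $L^2(\mathbb{R})$, linear in the first argument. For $z=x+is$ let $\pi(z)\psi(t)=s^{-1/2}\psi((t-x)/s)$ and, for $f,\psi\in H^2(\mathbb{C}^+)$, $W_\psi f(z)=\langle f,\pi(z)\psi\rangle$. Let $C_\psi=\int_0^\infty|\widehat\psi(t)|^2\,\frac{dt}{t}$; $\psi$ is admissible if $0<C_\psi<\infty$. Let $K_\psi(z,w)=C_\psi^{-1}\langle\pi(w)\psi,\pi(z)\psi\rangle$. For $n\in\mathbb{N}_0$ and $\alpha>0$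 let $\psi_n^\alpha\in H^2(\mathbb{C}^+)$ be given by $$\widehat{\psi_n^\alpha}(t)=\sqrt{\frac{2^{\alpha+2}\pi\, n!}{\Gamma(n+\alpha+1)}}\;t^{\alpha/2}e^{-t}L_n^\alpha(2t),\quad t>0,\qquad L_n^\alpha(t)=\sum_{k=0}^n\frac{(-1)^k}{k!}\binom{n+\alpha}{n-k}t^k,$$ and let $$C_n^\alpha(R)=4\pi\int_0^{R^2}(1-r)^{\alpha-1}P_n^{(0,\alpha)}(1-2r)^2\,dr,$$ where $P_n^{(0,\alpha)}$ is the Jacobi polynomial. Let $\varphi\in H^2(\mathbb{C}^+)$ be admissible with $W_\varphi\varphi\in L^1(\mathbb{C}^+,\mu^+)$. Put $\mathcal{H}_1=\{h\in H^2(\mathbb{C}^+):W_\varphi h\in L^1(\mathbb{C}^+,\mu^+)\}$, normed by $\|W_\varphi h\|_{L^1}$, and let $\mathcal{H}_1'$ be the space of continuous antilinear functionals on $\mathcal{H}_1$. For $f\in\mathcal{H}_1'$ and $\psi\in\mathcal{H}_1$ put $W_\psi f(z)=f(\pi(z)\psi)$, and let $\mathcal{C}o\,L^\infty(\mathbb{C}^+)=\{f\in\mathcal{H}_1':W_\varphi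 f\in L^\infty(\mathbb{C}^+)\}$. **Theorem.** Let $n\in\mathbb{N}_0$, $\alpha>1$ and $0<R<1$. 1. In the weak sense, $$\int_{\mathcal{D}_R}W_{\psi_n^\alpha}\psi_n^\alpha(z)\,\pi(z)\psi_n^\alpha\,d\mu^+(z)=C_n^\alpha(R)\,\psi_n^\alpha,$$ that is, for every $h\in H^2(\mathbb{C}^+)$ the function $W_{\psi_n^\alpha}\psi_n^\alpha(z)\langle\pi(z)\psi_n^\alpha,h\rangle$ is integrable over $\mathcal{D}_R$ and $$\int_{\mathcal{D}_R}W_{\psi_n^\alpha}\psi_n^\alpha(z)\,\langle\pi(z)\psi_n^\alpha,h\rangle\,d\mu^+(z)=C_n^\alpha(R)\,\langle\psi_n^\alpha,h\rangle .$$ 2. For every $\varphi$ as above, $\psi_n^\alpha\in\mathcal{H}_1$, and for every $f\in\mathcal{C}o\,L^\infty(\mathbb{C}^+)$ and every $z\in\mathbb{C}^+$, $$W_{\psi_n^\alpha}f(z)=\frac{4\pi}{\alpha\,C_n^\alpha(R)}\int_{\mathcal{D}_R(z)}W_{\psi_n^\alpha}f(w)\,K_{\psi_n^\alpha}(z,w)\,d\mu^+(w),$$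 where the integrand is integrable over $\mathcal{D}_R(z)$. -/

import Mathlib

open MeasureTheory FourierTransform
open UpperHalfPlane hiding I

noncomputable section

namespace HardyWavelet

/-! ### `L²(ℝ)`, the Fourier transform and the Hardy space -/

/-- The Hilbert space `L²(ℝ)`. -/
abbrev L2R : Type := Lp ℂ 2 (volume : Measure ℝ)

/-- The Fourier transform `f ↦ ∫ f(t) e^{-iξt} dt`, extended to `L²(ℝ)`. Mathlib's `𝓕` uses the
kernel `e^{-2πiξt}`, whence the rescaling of the frequency variable. -/
def fourierL2 (f : L2R) : ℝ → ℂ := fun ξ => (𝓕 f : L2R) (ξ / (2 * Real.pi))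

theorem quasi_div : Measure.QuasiMeasurePreserving (fun ξ : ℝ => ξ / (2 * Real.pi)) := by
  refine ⟨by fun_prop, ?_⟩
  have h : (2 * Real.pi)⁻¹ ≠ 0 := by positivity
  have := Real.map_volume_mul_right h
  simp only [div_eq_mul_inv]
  rw [this]
  exact Measure.smul_absolutelyContinuous

/-- The Hardy space `H²(ℂ⁺)`, identified through boundary values with the subspace of all
`f ∈ L²(ℝ)` whose Fourier transform vanishes almost everywhere on the negative half-line. -/
def H2 : Submodule ℂ L2R where
  carrier := {f | ∀ᵐ ξ : ℝ, ξ < 0 → fourierL2 f ξ = 0}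
  zero_mem' := by
    have h0 : (𝓕 (0 : L2R) : L2R) = 0 := map_zero (Lp.fourierTransformₗᵢ ℝ ℂ)
    have h1 : (((0 : L2R) : ℝ → ℂ)) =ᵐ[volume] 0 := Lp.coeFn_zero ℂ 2 volume
    filter_upwards [quasi_div.ae h1] with ξ hξ _
    have h2 : ((𝓕 (0 : L2R) : L2R) : ℝ → ℂ) (ξ / (2 * Real.pi)) = 0 := by rw [h0]; exact hξ
    exact h2
  add_mem' := by
    intro f g hf hg
    have h0 : (𝓕 (f + g) : L2R) = 𝓕 f + 𝓕 g := FourierTransform.fourier_add f g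
    filter_upwards [hf, hg, quasi_div.ae (Lp.coeFn_add (𝓕 f : L2R) (𝓕 g : L2R))]
      with ξ h1 h2 h3 hξ
    have h1 := h1 hξ
    have h2 := h2 hξ
    simp only [fourierL2] at *
    rw [h0, h3, Pi.add_apply, h1, h2, add_zero]
  smul_mem' := by
    intro c f hf
    have h0 : (𝓕 (c • f) : L2R) = c • 𝓕 f := FourierTransform.fourier_smul c f
    filter_upwards [hf, quasi_div.ae (Lp.coeFn_smul c (𝓕 f : L2R))] with ξ h1 h3 hξ
    have h1 := h1 hξ
    simp only [fourierL2] at *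
    rw [h0, h3, Pi.smul_apply, h1, smul_zero]

/-! ### The representation of the affine group -/

theorem memLp_weightedComp {c : ℝ} (hc : 0 < c) {e : ℝ → ℂ} {A : ℝ → ℝ}
    (he : Measurable e) (hnorm : ∀ t, ‖e t‖ = (Real.sqrt c)⁻¹) (hA : Measurable A)
    (hmap : Measure.map A volume = ENNReal.ofReal c • volume) (f : ℝ → ℂ)
    (hf : MemLp f 2 volume) :
    MemLp (fun t => e t * f (A t)) 2 volume ∧
      eLpNorm (fun t => e t * f (A t)) 2 volume = eLpNorm f 2 volume := by
  have hf' : AEStronglyMeasurable f (Measure.map A volume) := by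
    rw [hmap]; exact hf.1.smul_measure _
  have hm : AEStronglyMeasurable (fun t => e t * f (A t)) volume :=
    he.aestronglyMeasurable.mul (hf'.comp_measurable hA)
  have hE : eLpNorm (fun t => e t * f (A t)) 2 volume = eLpNorm f 2 volume := by
    have h1 : eLpNorm (fun t => e t * f (A t)) 2 volume
        = eLpNorm (((Real.sqrt c)⁻¹ : ℝ) • (f ∘ A)) 2 volume := by
      refine eLpNorm_congr_norm_ae (Filter.Eventually.of_forall fun t => ?_)
      simp [hnorm, abs_of_nonneg (Real.sqrt_nonneg c)]
    have hsq : 0 < Real.sqrt c := Real.sqrt_pos.2 hc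
    rw [h1, eLpNorm_const_smul, ← eLpNorm_map_measure hf' hA.aemeasurable, hmap,
      eLpNorm_smul_measure_of_ne_top (by simp)]
    simp only [smul_eq_mul]
    rw [← mul_assoc]
    have : ‖(Real.sqrt c)⁻¹‖ₑ * ENNReal.ofReal c ^ ((1 / 2 : ENNReal).toReal) = 1 := by
      rw [Real.enorm_eq_ofReal (by positivity), ENNReal.ofReal_rpow_of_pos hc,
        ← ENNReal.ofReal_mul (by positivity)]
      have h2 : ((1 / 2 : ENNReal).toReal) = 1 / 2 := by simp
      rw [h2, ← Real.sqrt_eq_rpow, inv_mul_cancel₀ hsq.ne', ENNReal.ofReal_one]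
    rw [this, one_mul]
  exact ⟨⟨hm, hE ▸ hf.2⟩, hE⟩

/-- The isometry `f ↦ e · (f ∘ A)` of `L²(ℝ)`, where `A` scales Lebesgue measure by `c` and
`|e| = c^{-1/2}`. -/
def weightedComp {c : ℝ} (hc : 0 < c) {e : ℝ → ℂ} {A : ℝ → ℝ}
    (he : Measurable e) (hnorm : ∀ t, ‖e t‖ = (Real.sqrt c)⁻¹) (hA : Measurable A)
    (hmap : Measure.map A volume = ENNReal.ofReal c • volume) : L2R →ₗᵢ[ℂ] L2R where
  toFun f := (memLp_weightedComp hc he hnorm hA hmap f (Lp.memLp f)).1.toLp _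
  map_add' f g := by
    have hq : Measure.QuasiMeasurePreserving A :=
      ⟨hA, by rw [hmap]; exact Measure.smul_absolutelyContinuous⟩
    rw [← MemLp.toLp_add]
    refine MemLp.toLp_congr _ _ ?_
    filter_upwards [hq.ae (Lp.coeFn_add f g)] with t ht
    rw [Pi.add_apply] at ht
    simp only [ht, mul_add, Pi.add_apply]
  map_smul' a f := by
    have hq : Measure.QuasiMeasurePreserving A :=
      ⟨hA, by rw [hmap]; exact Measure.smul_absolutelyContinuous⟩
    rw [RingHom.id_apply, ← MemLp.toLp_const_smul]
    refine MemLp.toLp_congr _ _ ?_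
    filter_upwards [hq.ae (Lp.coeFn_smul a f)] with t ht
    rw [Pi.smul_apply] at ht
    simp only [ht, Pi.smul_apply, smul_eq_mul, mul_left_comm]
  norm_map' f := by
    simp only [LinearMap.coe_mk, AddHom.coe_mk, Lp.norm_toLp,
      (memLp_weightedComp hc he hnorm hA hmap f (Lp.memLp f)).2]
    rw [Lp.norm_def]

theorem weightedComp_coeFn {c : ℝ} (hc : 0 < c) {e : ℝ → ℂ} {A : ℝ → ℝ}
    (he : Measurable e) (hnorm : ∀ t, ‖e t‖ = (Real.sqrt c)⁻¹) (hA : Measurable A)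
    (hmap : Measure.map A volume = ENNReal.ofReal c • volume) (f : L2R) :
    weightedComp hc he hnorm hA hmap f =ᵐ[volume] fun t => e t * f (A t) :=
  MemLp.coeFn_toLp (memLp_weightedComp hc he hnorm hA hmap f (Lp.memLp f)).1

theorem map_affine {x s : ℝ} (hs : 0 < s) :
    Measure.map (fun t : ℝ => (t - x) / s) volume = ENNReal.ofReal s • volume := by
  have h1 : (fun t : ℝ => (t - x) / s) = (fun t => t * s⁻¹) ∘ (fun t => t - x) := by
    ext t; simp [div_eq_mul_inv]
  rw [h1, ← Measure.map_map (by fun_prop) (by fun_prop),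
    (measurePreserving_sub_right volume x).map_eq,
    Real.map_volume_mul_right (inv_ne_zero hs.ne')]
  simp [abs_of_pos hs]

theorem map_scale {s : ℝ} (hs : 0 < s) :
    Measure.map (fun t : ℝ => s * t) volume = ENNReal.ofReal s⁻¹ • volume := by
  have := Real.map_volume_mul_left hs.ne'
  rw [this, abs_of_pos (inv_pos.2 hs)]

/-- The representation `π(z) f (t) = s^{-1/2} f (s⁻¹ (t - x))`, `z = x + i s`, on `L²(ℝ)`. -/
def repL2 (z : ℍ) : L2R →ₗᵢ[ℂ] L2R :=
  weightedComp (c := z.im) (e := fun _ => (((Real.sqrt z.im)⁻¹ : ℝ) : ℂ))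
    (A := fun t => (t - z.re) / z.im) z.im_pos measurable_const
    (fun _ => by simp [abs_of_nonneg (Real.sqrt_nonneg _)])
    (by fun_prop) (map_affine z.im_pos)

theorem repL2_coeFn (z : ℍ) (f : L2R) :
    repL2 z f =ᵐ[volume] fun t => (((Real.sqrt z.im)⁻¹ : ℝ) : ℂ) * f ((t - z.re) / z.im) :=
  weightedComp_coeFn _ _ _ _ _ f

/-- The action of `π(z)` on the Fourier side. -/
def repFourier (z : ℍ) : L2R →ₗᵢ[ℂ] L2R :=
  weightedComp (c := z.im⁻¹)
    (e := fun ξ => ((Real.sqrt z.im : ℝ) : ℂ) *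
      Complex.exp (((-(2 * Real.pi * z.re * ξ) : ℝ) : ℂ) * Complex.I))
    (A := fun ξ => z.im * ξ) (inv_pos.2 z.im_pos) (by fun_prop)
    (fun _ => by
      rw [norm_mul, Complex.norm_exp_ofReal_mul_I]
      simp [abs_of_nonneg (Real.sqrt_nonneg _)])
    (by fun_prop) (map_scale z.im_pos)

/-- The affine change of variables on Schwartz functions. -/
def schwartzAffine (z : ℍ) (g : SchwartzMap ℝ ℂ) : SchwartzMap ℝ ℂ :=
  (((Real.sqrt z.im)⁻¹ : ℝ) : ℂ) •
    SchwartzMap.compCLMOfAntilipschitz (g := fun t : ℝ => (t - z.re) / z.im)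
      (K := Real.toNNReal z.im) ℂ
      (by simp only [div_eq_mul_inv]; fun_prop)
      (AntilipschitzWith.of_le_mul_dist fun a b => by
        have := z.im_pos
        rw [Real.coe_toNNReal _ this.le, Real.dist_eq, Real.dist_eq, ← sub_div, abs_div,
          abs_of_pos this, mul_div_cancel₀ _ this.ne']
        simp) g

theorem fourier_repL2 (z : ℍ) (f : L2R) : (𝓕 (repL2 z f) : L2R) = repFourier z (𝓕 f) := by
  refine DenseRange.induction_on
    (p := fun f : L2R => (𝓕 (repL2 z f) : L2R) = repFourier z (𝓕 f))
    (SchwartzMap.denseRange_toLpCLM (E := ℝ) (F := ℂ) (μ := volume) (p := 2)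
      ENNReal.ofNat_ne_top) f ?_ ?_
  · exact isClosed_eq
      ((Lp.fourierTransformₗᵢ ℝ ℂ).continuous.comp (repL2 z).continuous)
      ((repFourier z).continuous.comp (Lp.fourierTransformₗᵢ ℝ ℂ).continuous)
  · intro g
    have hs := z.im_pos
    have e1 : repL2 z (SchwartzMap.toLpCLM ℂ ℂ 2 volume g) = (schwartzAffine z g).toLp 2 := by
      refine Lp.ext ?_
      have hq : Measure.QuasiMeasurePreserving (fun t : ℝ => (t - z.re) / z.im) :=
        ⟨by fun_prop, by rw [map_affine hs]; exact Measure.smul_absolutelyContinuous⟩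
      filter_upwards [repL2_coeFn z (SchwartzMap.toLpCLM ℂ ℂ 2 volume g),
        SchwartzMap.coeFn_toLp (schwartzAffine z g) 2 volume,
        hq.ae (SchwartzMap.coeFn_toLp g 2 volume)] with t h1 h2 h3
      rw [h1, h2]
      change _ * (g.toLp 2 : L2R) ((t - z.re) / z.im) = _
      rw [h3]
      rfl
    change (𝓕 (repL2 z (SchwartzMap.toLpCLM ℂ ℂ 2 volume g)) : L2R) =
      repFourier z (𝓕 (g.toLp 2 : L2R))
    rw [e1, SchwartzMap.toLp_fourier_eq, SchwartzMap.toLp_fourier_eq]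
    refine Lp.ext ?_
    have hq : Measure.QuasiMeasurePreserving (fun t : ℝ => z.im * t) :=
      ⟨by fun_prop, by rw [map_scale hs]; exact Measure.smul_absolutelyContinuous⟩
    filter_upwards [weightedComp_coeFn (c := z.im⁻¹) (inv_pos.2 hs) _ _ _ (map_scale hs)
        ((𝓕 g : SchwartzMap ℝ ℂ).toLp 2 : L2R),
      SchwartzMap.coeFn_toLp (𝓕 (schwartzAffine z g)) 2 volume,
      hq.ae (SchwartzMap.coeFn_toLp (𝓕 g) 2 volume)] with ξ h1 h2 h3
    rw [h2]
    refine Eq.trans ?_ h1.symm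
    rw [h3, SchwartzMap.fourier_coe, SchwartzMap.fourier_coe,
      Real.fourier_real_eq_integral_exp_smul, Real.fourier_real_eq_integral_exp_smul]
    let G : ℝ → ℂ := fun u =>
      Complex.exp (((-2 * Real.pi * (z.im * u + z.re) * ξ : ℝ) : ℂ) * Complex.I) •
        ((((Real.sqrt z.im)⁻¹ : ℝ) : ℂ) * g u)
    have hG : ∀ t : ℝ, Complex.exp (((-2 * Real.pi * t * ξ : ℝ) : ℂ) * Complex.I) •
        schwartzAffine z g t = G ((t - z.re) / z.im) := by
      intro t
      simp only [G]
      rw [mul_div_cancel₀ _ hs.ne', sub_add_cancel]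
      rfl
    simp_rw [hG]
    rw [integral_sub_right_eq_self (fun t => G (t / z.im)) z.re, Measure.integral_comp_div,
      abs_of_pos hs, ← integral_smul, ← integral_const_mul]
    congr 1
    ext u
    have hsq : ((z.im : ℝ) : ℂ) * (((Real.sqrt z.im)⁻¹ : ℝ) : ℂ) = ((Real.sqrt z.im : ℝ) : ℂ) := by
      rw [← Complex.ofReal_mul]
      congr 1
      rw [← div_eq_mul_inv, Real.div_sqrt]
    have hexp : Complex.exp (((-2 * Real.pi * (z.im * u + z.re) * ξ : ℝ) : ℂ) * Complex.I) =
        Complex.exp (((-(2 * Real.pi * z.re * ξ) : ℝ) : ℂ) * Complex.I) *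
          Complex.exp (((-2 * Real.pi * u * (z.im * ξ) : ℝ) : ℂ) * Complex.I) := by
      rw [← Complex.exp_add]
      congr 1
      push_cast
      ring
    simp only [G, smul_eq_mul, Complex.real_smul]
    rw [hexp, ← hsq]
    ring

theorem repL2_mem_H2 (z : ℍ) {f : L2R} (hf : f ∈ H2) : repL2 z f ∈ H2 := by
  have hs := z.im_pos
  have hf' : ∀ᵐ ξ : ℝ, ξ < 0 → fourierL2 f ξ = 0 := hf
  change ∀ᵐ ξ : ℝ, ξ < 0 → fourierL2 (repL2 z f) ξ = 0
  have hq : Measure.QuasiMeasurePreserving (fun t : ℝ => z.im * t) :=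
    ⟨by fun_prop, by rw [map_scale hs]; exact Measure.smul_absolutelyContinuous⟩
  filter_upwards [hq.ae hf', quasi_div.ae (weightedComp_coeFn (c := z.im⁻¹) (inv_pos.2 hs) _ _ _
    (map_scale hs) (𝓕 f : L2R))] with ξ h1 h2 hξ
  have h3 := h1 (mul_neg_of_pos_of_neg hs hξ)
  simp only [fourierL2, fourier_repL2] at *
  refine h2.trans ?_
  have h4 : z.im * (ξ / (2 * Real.pi)) = z.im * ξ / (2 * Real.pi) := by ring
  rw [h4, h3, mul_zero]

/-- The unitary representation `π` of the affine group on `H²(ℂ⁺)`. -/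
def rep (z : ℍ) : H2 →ₗ[ℂ] H2 :=
  (repL2 z).toLinearMap.restrict fun _ hf => repL2_mem_H2 z hf

/-! ### The affine group structure on the upper half-plane -/

/-- The group law `(x, s) · (x', s') = (x + s x', s s')` of the affine group, on `ℍ`. -/
def affMul (z w : ℍ) : ℍ :=
  ⟨⟨z.re + z.im * w.re, z.im * w.im⟩, mul_pos z.im_pos w.im_pos⟩

/-- The inverse `(x, s)⁻¹ = (-x / s, 1 / s)` in the affine group, on `ℍ`. -/
def affInv (z : ℍ) : ℍ := ⟨⟨-z.re / z.im, 1 / z.im⟩, one_div_pos.2 z.im_pos⟩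

theorem affMul_affInv_cancel (z w : ℍ) : affMul z (affMul (affInv z) w) = w := by
  have := z.im_ne_zero
  refine UpperHalfPlane.ext_re_im ?_ ?_
  · change z.re + z.im * (-z.re / z.im + 1 / z.im * w.re) = w.re
    field_simp
    ring
  · change z.im * (1 / z.im * w.im) = w.im
    field_simp

/-- The measure `dx ds / s²` (Mathlib's `volume` on `ℍ`) is left invariant. -/
theorem measurePreserving_affMul (z : ℍ) :
    MeasurePreserving (affMul z) (volume : Measure ℍ) volume := by
  have hdet : (!![z.im, z.re; 0, 1] : Matrix (Fin 2) (Fin 2) ℝ).det ≠ 0 := by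
    simp [Matrix.det_fin_two, z.im_ne_zero]
  have hg : ∀ w : ℍ, affMul z w =
      Matrix.GeneralLinearGroup.mkOfDetNeZero !![z.im, z.re; 0, 1] hdet • w := by
    intro w
    apply UpperHalfPlane.ext
    rw [UpperHalfPlane.coe_smul_of_det_pos]
    · apply Complex.ext <;>
        simp [affMul, UpperHalfPlane.num, UpperHalfPlane.denom,
          Matrix.GeneralLinearGroup.mkOfDetNeZero] <;> ring
    · simp [Matrix.GeneralLinearGroup.mkOfDetNeZero, Matrix.det_fin_two, z.im_pos]
  have := measurePreserving_smul
    (Matrix.GeneralLinearGroup.mkOfDetNeZero !![z.im, z.re; 0, 1] hdet) (volume : Measure ℍ)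
  convert this using 1
  ext1 w
  exact hg w

theorem repL2_affMul (z w : ℍ) (f : L2R) : repL2 (affMul z w) f = repL2 z (repL2 w f) := by
  have hq : Measure.QuasiMeasurePreserving (fun t : ℝ => (t - z.re) / z.im) :=
    ⟨by fun_prop, by rw [map_affine z.im_pos]; exact Measure.smul_absolutelyContinuous⟩
  refine Lp.ext ?_
  filter_upwards [repL2_coeFn (affMul z w) f, repL2_coeFn z (repL2 w f),
    hq.ae (repL2_coeFn w f)] with t h1 h2 h3
  have hz := z.im_ne_zero
  have hw := w.im_ne_zero
  rw [h1, h2, h3]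
  have e1 : (affMul z w).im = z.im * w.im := rfl
  have e2 : (affMul z w).re = z.re + z.im * w.re := rfl
  rw [e1, e2, Real.sqrt_mul z.im_pos.le, mul_inv, ← mul_assoc, ← Complex.ofReal_mul]
  congr 2
  field_simp
  ring

/-! ### The wavelet transform, the reproducing kernel and coorbit spaces -/

/-- The continuous wavelet transform `W_ψ f(z) = ⟨f, π(z)ψ⟩`. (Mathlib's inner product is
antilinear in its first argument.) -/
def waveletTransform (ψ f : H2) (z : ℍ) : ℂ := inner ℂ (rep z ψ) f

/-- The admissibility constant `C_ψ = ∫₀^∞ |ψ̂(t)|² dt / t`. -/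
def admissibilityConst (ψ : H2) : ENNReal :=
  ∫⁻ t in Set.Ioi (0 : ℝ), ‖fourierL2 ψ t‖ₑ ^ 2 / ENNReal.ofReal t

/-- Admissible wavelets: `0 < C_ψ < ∞`. -/
def IsAdmissible (ψ : H2) : Prop := 0 < admissibilityConst ψ ∧ admissibilityConst ψ < ⊤

/-- The reproducing kernel `K_ψ(z, w) = C_ψ⁻¹ ⟨π(w)ψ, π(z)ψ⟩`. -/
def reproducingKernel (ψ : H2) (z w : ℍ) : ℂ :=
  (((admissibilityConst ψ).toReal)⁻¹ : ℝ) * inner ℂ (rep z ψ) (rep w ψ)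

/-- The space `𝓗₁ = {f ∈ H² : W_φ f ∈ L¹(ℂ⁺)}` of test functions for the window `φ`. -/
def testSpace (φ : H2) : Submodule ℂ H2 where
  carrier := {f | Integrable (waveletTransform φ f) volume}
  zero_mem' := by
    have : waveletTransform φ 0 = 0 := by ext z; simp [waveletTransform]
    simp [this]
  add_mem' := by
    intro f g hf hg
    have : waveletTransform φ (f + g) = waveletTransform φ f + waveletTransform φ g := by
      ext z; simp [waveletTransform]
    simp only [Set.mem_ofPred_eq, this] at *
    exact hf.add hg
  smul_mem' := by
    intro c f hf
    have : waveletTransform φ (c • f) = c • waveletTransform φ f := by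
      ext z; simp [waveletTransform]
    simp only [Set.mem_ofPred_eq, this] at *
    exact hf.smul c

theorem waveletTransform_rep (φ f : H2) (z w : ℍ) :
    waveletTransform φ (rep z f) w = waveletTransform φ f (affMul (affInv z) w) := by
  have h : (inner ℂ (repL2 w (φ : L2R)) (repL2 z (f : L2R)) : ℂ) =
      inner ℂ (repL2 (affMul (affInv z) w) (φ : L2R)) (f : L2R) := by
    rw [← (repL2 z).inner_map_map (repL2 (affMul (affInv z) w) (φ : L2R)), ← repL2_affMul,
      affMul_affInv_cancel]
  exact h

theorem rep_mem_testSpace (φ : H2) (z : ℍ) {f : H2} (hf : f ∈ testSpace φ) :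
    rep z f ∈ testSpace φ := by
  change Integrable (waveletTransform φ (rep z f)) volume
  have : waveletTransform φ (rep z f) = waveletTransform φ f ∘ affMul (affInv z) := by
    ext w; exact waveletTransform_rep φ f z w
  rw [this]
  exact (measurePreserving_affMul (affInv z)).integrable_comp_of_integrable hf

/-- `π(z)` acting on the space of test functions. -/
def testRep (φ : H2) (z : ℍ) (f : testSpace φ) : testSpace φ :=
  ⟨rep z f, rep_mem_testSpace φ z f.2⟩

/-- The anti-dual `𝓗₁'`: antilinear functionals on `𝓗₁` that are continuous for the norm
`‖h‖ = ‖W_φ h‖_{L¹(ℂ⁺)}`. -/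
def antiDual (φ : H2) : Set (testSpace φ →ₗ⋆[ℂ] ℂ) :=
  {f | ∃ C : ℝ, ∀ h : testSpace φ, ‖f h‖ ≤ C * ∫ z : ℍ, ‖waveletTransform φ (h : H2) z‖}

/-- The wavelet transform `W_ψ f(z) = f(π(z)ψ)` of a functional `f` on `𝓗₁`, for `ψ ∈ 𝓗₁`. -/
def functionalTransform {φ : H2} (ψ : testSpace φ) (f : testSpace φ →ₗ⋆[ℂ] ℂ) (z : ℍ) : ℂ :=
  f (testRep φ z ψ)

/-- The coorbit space `Co L^∞(ℂ⁺) = {f ∈ 𝓗₁' : W_φ f ∈ L^∞(ℂ⁺)}` for an integrable window `φ`. -/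
def coorbitLinfty (φ : H2) (hφ : φ ∈ testSpace φ) : Set (testSpace φ →ₗ⋆[ℂ] ℂ) :=
  {f | f ∈ antiDual φ ∧ MemLp (functionalTransform ⟨φ, hφ⟩ f) ⊤ (volume : Measure ℍ)}

/-- The pseudohyperbolic disk of radius `R` and centre `z`. -/
def pseudoDisk (R : ℝ) (z : ℍ) : Set ℍ :=
  {w | ‖((z : ℂ) - w) / ((z : ℂ) - (starRingEnd ℂ) (w : ℂ))‖ < R}

/-! ### The wavelets `ψ_n^α` -/

/-- The generalized Laguerre polynomial
`L_n^α(t) = ∑_{k ≤ n} (-1)^k / k! * binom(n + α, n - k) t^k`, the binomial coefficient being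
`Γ(n + α + 1) / ((n - k)! Γ(α + k + 1))`. -/
def laguerre (n : ℕ) (α t : ℝ) : ℝ :=
  ∑ k ∈ Finset.range (n + 1), (-1) ^ k / (k.factorial : ℝ) *
    (Real.Gamma (n + α + 1) / (((n - k).factorial : ℝ) * Real.Gamma (α + k + 1))) * t ^ k

/-- The Jacobi polynomial `P_n^{(α, β)}`. -/
def jacobi (n : ℕ) (α β x : ℝ) : ℝ :=
  Real.Gamma (n + α + 1) / ((n.factorial : ℝ) * Real.Gamma (n + α + β + 1)) *
    ∑ k ∈ Finset.range (n + 1), (n.choose k : ℝ) *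
      (Real.Gamma (n + k + α + β + 1) / Real.Gamma (k + α + 1)) * ((x - 1) / 2) ^ k

/-- The Fourier transform of `ψ_n^α`. -/
def waveletHat (n : ℕ) (α t : ℝ) : ℝ :=
  if 0 < t then
    Real.sqrt (2 ^ (α + 2) * Real.pi * (n.factorial : ℝ) / Real.Gamma (n + α + 1)) *
      t ^ (α / 2) * Real.exp (-t) * laguerre n α (2 * t)
  else 0

theorem memLp_monomial {β : ℝ} (hβ : 0 < β) :
    MemLp (Set.indicator (Set.Ioi (0 : ℝ)) fun t => t ^ β * Real.exp (-t)) 2 volume := by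
  have hm : Measurable (Set.indicator (Set.Ioi (0 : ℝ)) fun t : ℝ => t ^ β * Real.exp (-t)) :=
    Measurable.indicator (by fun_prop) measurableSet_Ioi
  rw [memLp_two_iff_integrable_sq hm.aestronglyMeasurable]
  have h1 : (fun t => (Set.indicator (Set.Ioi (0 : ℝ)) (fun t : ℝ => t ^ β * Real.exp (-t)) t) ^ 2)
      = Set.indicator (Set.Ioi (0 : ℝ)) fun t : ℝ => t ^ (2 * β) * Real.exp (-2 * t) := by
    ext t
    by_cases ht : t ∈ Set.Ioi (0 : ℝ)
    · rw [Set.indicator_of_mem ht, Set.indicator_of_mem ht, mul_pow, ← Real.exp_nat_mul,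
        ← Real.rpow_natCast, ← Real.rpow_mul (le_of_lt ht)]
      congr 2
      · push_cast; ring
      · push_cast; ring
    · simp [Set.indicator_of_notMem ht]
  rw [h1, integrable_indicator_iff measurableSet_Ioi]
  have := integrableOn_rpow_mul_exp_neg_mul_rpow (s := 2 * β) (p := 1) (b := 2)
    (by linarith) one_pos (by norm_num)
  simpa using this

theorem memLp_waveletHat (n : ℕ) {α : ℝ} (hα : 0 < α) :
    MemLp (fun t => (waveletHat n α t : ℂ)) 2 volume := by
  have h : MemLp (waveletHat n α) 2 volume := by
    have h1 : waveletHat n α = fun t => ∑ k ∈ Finset.range (n + 1),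
        (Real.sqrt (2 ^ (α + 2) * Real.pi * (n.factorial : ℝ) / Real.Gamma (n + α + 1)) *
          ((-1) ^ k / (k.factorial : ℝ) *
          (Real.Gamma (n + α + 1) / (((n - k).factorial : ℝ) * Real.Gamma (α + k + 1))) * 2 ^ k)) *
          Set.indicator (Set.Ioi (0 : ℝ)) (fun t => t ^ (α / 2 + k) * Real.exp (-t)) t := by
      ext t
      by_cases ht : 0 < t
      · simp only [waveletHat, if_pos ht, laguerre, Finset.mul_sum]
        refine Finset.sum_congr rfl fun k _ => ?_
        rw [Set.indicator_of_mem (show t ∈ Set.Ioi (0 : ℝ) from ht), Real.rpow_add ht,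
          Real.rpow_natCast, mul_pow]
        ring
      · simp [waveletHat, if_neg ht, Set.indicator_of_notMem (show t ∉ Set.Ioi (0 : ℝ) from ht)]
    rw [h1]
    exact memLp_finsetSum _ fun k _ => (memLp_monomial (by positivity)).const_mul _
  exact h.ofReal

theorem memLp_waveletHat_scaled (n : ℕ) {α : ℝ} (hα : 0 < α) :
    MemLp (fun η => (waveletHat n α (2 * Real.pi * η) : ℂ)) 2 volume := by
  have h2 : (0 : ℝ) < 2 * Real.pi := by positivity
  have h3 : MemLp (fun t => (waveletHat n α t : ℂ)) 2
      (Measure.map (fun t : ℝ => 2 * Real.pi * t) volume) := by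
    rw [map_scale h2]
    exact (memLp_waveletHat n hα).smul_measure ENNReal.ofReal_ne_top
  exact h3.comp_of_map (by fun_prop)

/-- `ψ_n^α` as an element of `L²(ℝ)`: the function with Fourier transform `waveletHat n α`. -/
def waveletL2 (n : ℕ) (α : ℝ) (hα : 0 < α) : L2R :=
  𝓕⁻ ((memLp_waveletHat_scaled n hα).toLp _ : L2R)

theorem fourierL2_waveletL2 (n : ℕ) (α : ℝ) (hα : 0 < α) :
    fourierL2 (waveletL2 n α hα) =ᵐ[volume] fun ξ => (waveletHat n α ξ : ℂ) := by
  filter_upwards [quasi_div.ae (MemLp.coeFn_toLp (memLp_waveletHat_scaled n hα))] with ξ hξ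
  simp only [fourierL2, waveletL2]
  rw [FourierTransform.fourier_fourierInv_eq, hξ, mul_div_cancel₀ _ (by positivity)]

/-- The wavelet `ψ_n^α ∈ H²(ℂ⁺)`. -/
def wavelet (n : ℕ) (α : ℝ) (hα : 0 < α) : H2 :=
  ⟨waveletL2 n α hα, by
    change ∀ᵐ ξ : ℝ, ξ < 0 → fourierL2 (waveletL2 n α hα) ξ = 0
    filter_upwards [fourierL2_waveletL2 n α hα] with ξ hξ hneg
    rw [hξ, waveletHat, if_neg (not_lt.2 hneg.le), Complex.ofReal_zero]⟩

/-- The constant `C_n^α(R) = 4π ∫₀^{R²} (1 - r)^{α - 1} P_n^{(0, α)}(1 - 2r)² dr`. -/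
def localConst (n : ℕ) (α R : ℝ) : ℝ :=
  4 * Real.pi * ∫ r in (0 : ℝ)..R ^ 2, (1 - r) ^ (α - 1) * jacobi n 0 α (1 - 2 * r) ^ 2

end HardyWavelet

end

open HardyWavelet

/-!
The wavelets `ψ_n^α` reproduce themselves from a single pseudohyperbolic disk because in disk
coordinates `W_ψ ψ` is radial up to a phase, so that integrating against it only involves averages
over circles, and these averages can be computed.

*The weak identity.* Transport `ℂ⁺` to the unit disk by the Cayley transform `ζ = (z - i) / (z +
i)`, under which `𝒟_R` becomes the disk `|ζ| < R`. A Laguerre computation shows that `W_ψ ψ` is,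
up to an explicit weight and a phase, the Jacobi polynomial `P_n^{(0,α)}(1 - 2|ζ|²)`
(`waveletTransform_wavelet`). The vectors `powerExp β`, with Fourier transform `t^β e^{-t}`, have
orbits of dense span, so it suffices to test against `h = π(w) (powerExp (α / 2))`. For such `h`
the coefficient `⟨h, π(z) ψ⟩` is, up to a weight, the conjugate phase and a constant, the kernel
`(ω - ζ)^n (1 - ω ζ̄)^{-(n+α+1)}` with `ω` the image of `w`
(`inner_rep_powerExp_rep_wavelet_disk`). The phases cancel and leave a radial weight times this
kernel. Its average over a circle `|ζ| = r` is `ω^n P_n^{(0,α)}(1 - 2r²)`, since only the terms of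
equal degree in `ζ` and `ζ̄` survive (`integral_circle_eq_jacobi`). The remaining radial integral
is `C_n^α(R)`, and `ω^n` is proportional to `⟨h, ψ⟩`; the limiting argument is
`setIntegral_waveletTransform_mul_inner`.

*Membership in the test space.* `ψ` is a finite combination of vectors `powerExp a`. The transform
`k` of `powerExp a` with window `powerExp 2` is explicit and integrable over `ℂ⁺`. Averaging an
orbit against it produces a multiple of `powerExp a`: `∫ k(w) ⟨f, π(w) g⟩ dμ(w) = 2π ⟨powerExp 1,
g⟩ ⟨f, powerExp a⟩` (`integral_waveletTransform_powerExp_mul_inner`, by Fourier inversion in `x`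
and a dilation in `s`). Taking for `g` a vector in the orbit of the window `φ` with a nonzero
scalar on the right exhibits `W_φ (powerExp a)` as a convolution of integrable functions on the
affine group.

*The local formula.* The map `h ↦ W_φ h` carries the test space into `L¹(ℂ⁺)` and its norm to the
`L¹` norm, so by Hahn–Banach a functional in the anti-dual is the conjugate of a continuous linear
functional on `L¹` (`exists_dual_L1`). Since translations act continuously on `L¹`, the orbit of
`ψ` is continuous there, and the weak identity, translated to `z`, upgrades to an identity between
Bochner integrals in `L¹` (`setIntegral_smul_testToL1`). Applying the functional and translating
`𝒟_R(i)` to `𝒟_R(z)` gives the formula with constant `C_n^α(R)`; the prefactor comes from `C_ψ =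
4π / α` (`admissibilityConst_wavelet`). Division by `C_n^α(R)` is legitimate by `localConst_pos`.
-/

namespace HardyWavelet

/-! ### Finite sums of Gamma quotients -/

/-- Newton's forward difference formula for the rising factorial `x ↦ Γ(x + j) / Γ(x)`. -/
theorem Gamma_quotient_shift (j k : ℕ) {β : ℝ} (hβ : 0 < β) :
    Real.Gamma (β + k + j) / Real.Gamma (β + k) =
      ∑ i ∈ Finset.range (k + 1), (k.choose i : ℝ) *
        ((j.descFactorial i : ℝ) * Real.Gamma (β + j) / Real.Gamma (β + i)) := by
  induction k generalizing β with
  | zero => simp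
  | succ k ih =>
    have step : ∀ i : ℕ, (j.descFactorial i : ℝ) * Real.Gamma (β + 1 + j) / Real.Gamma (β + 1 + i)
        = (j.descFactorial i : ℝ) * Real.Gamma (β + j) / Real.Gamma (β + i)
          + (j.descFactorial (i + 1) : ℝ) * Real.Gamma (β + j) / Real.Gamma (β + (i + 1 : ℕ)) := by
      intro i
      have e1 : Real.Gamma (β + 1 + j) = (β + j) * Real.Gamma (β + j) := by
        rw [← Real.Gamma_add_one (by positivity)]; congr 1; ring
      have e2 : Real.Gamma (β + 1 + i) = (β + i) * Real.Gamma (β + i) := by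
        rw [← Real.Gamma_add_one (by positivity)]; congr 1; ring
      have e3 : Real.Gamma (β + (i + 1 : ℕ)) = (β + i) * Real.Gamma (β + i) := by
        rw [← Real.Gamma_add_one (by positivity)]; congr 1; push_cast; ring
      have e4 : (j.descFactorial (i + 1) : ℝ) = ((j : ℝ) - i) * j.descFactorial i := by
        rw [Nat.descFactorial_succ]
        rcases le_or_gt i j with h | h
        · push_cast [Nat.cast_sub h]; ring
        · rw [Nat.descFactorial_of_lt h]; simp
      have p1 : 0 < Real.Gamma (β + i) := Real.Gamma_pos_of_pos (by positivity)
      have p2 : 0 < β + i := by positivity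
      rw [e1, e2, e3, e4]
      field_simp
      ring
    have h := ih (β := β + 1) (by positivity)
    have hl : β + (k + 1 : ℕ) = β + 1 + k := by push_cast; ring
    rw [hl, h]
    simp_rw [step]
    rw [Finset.sum_range_succ' _ (k + 1)]
    simp only [Nat.choose_succ_succ, mul_add, Nat.cast_add, add_mul, Finset.sum_add_distrib]
    rw [Finset.sum_range_succ' (fun i => (k.choose i : ℝ) *
      ((j.descFactorial i : ℝ) * Real.Gamma (β + j) / Real.Gamma (β + i))) k]
    rw [Finset.sum_range_succ (fun i => (k.choose (i + 1) : ℝ) * _) k]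
    simp
    ring

/-- The coefficients of the generalized Laguerre polynomial. -/
noncomputable def laguerreCoeff (n : ℕ) (α : ℝ) (k : ℕ) : ℝ :=
  (-1) ^ k / (k.factorial : ℝ) *
    (Real.Gamma (n + α + 1) / (((n - k).factorial : ℝ) * Real.Gamma (α + k + 1)))

theorem laguerreCoeff_mul_Gamma {n k : ℕ} (hk : k ≤ n) {α : ℝ} (hα : -1 < α) :
    laguerreCoeff n α k * Real.Gamma (α + k + 1) =
      Real.Gamma (n + α + 1) / n.factorial * ((-1) ^ k * n.choose k) := by
  have p1 : Real.Gamma (α + k + 1) ≠ 0 :=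
    (Real.Gamma_pos_of_pos (by have := Nat.cast_nonneg (α := ℝ) k; linarith)).ne'
  rw [laguerreCoeff, Nat.cast_choose ℝ hk]
  have := Nat.factorial_ne_zero
  field_simp

/-- The `i`-th divided derivative of the binomial theorem, multiplied by `Y ^ i`. -/
theorem sum_choose_mul_choose_mul_pow {R : Type*} [CommRing R] (n i : ℕ) (Y : R) :
    ∑ k ∈ Finset.range (n + 1), (n.choose k : R) * (k.choose i : R) * Y ^ k =
      (n.choose i : R) * Y ^ i * (1 + Y) ^ (n - i) := by
  rcases lt_or_ge n i with h | h
  · rw [Nat.choose_eq_zero_of_lt h]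
    simp only [Nat.cast_zero, zero_mul]
    refine Finset.sum_eq_zero fun k hk => ?_
    rw [Nat.choose_eq_zero_of_lt (by simp at hk; omega : k < i)]; simp
  · obtain ⟨m, rfl⟩ := Nat.exists_eq_add_of_le h
    rw [add_assoc, Finset.sum_range_add, Finset.sum_eq_zero, zero_add, Nat.add_sub_cancel_left,
      add_comm (1 : R), add_pow, Finset.mul_sum]
    · refine Finset.sum_congr rfl fun l hl => ?_
      have := Nat.choose_mul (n := i + m) (k := i + l) (s := i) (by omega)
      rw [Nat.add_sub_cancel_left, Nat.add_sub_cancel_left] at this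
      have h2 : ((i + m).choose (i + l) : R) * ((i + l).choose i : R) =
          ((i + m).choose i : R) * (m.choose l : R) := by
        exact_mod_cast congrArg (Nat.cast : ℕ → R) this
      rw [h2, pow_add]; simp; ring
    · intro k hk
      rw [Nat.choose_eq_zero_of_lt (by simpa using hk : k < i)]; simp

/-- The moments `∫ t^{α + j} e^{-t} L_n^α(Y t) dt` in closed form. -/
theorem sum_laguerreCoeff_mul_Gamma_mul_pow (n j : ℕ) {α : ℝ} (hα : -1 < α) (Y : ℂ) :
    ∑ k ∈ Finset.range (n + 1),
        (laguerreCoeff n α k : ℂ) * (Real.Gamma (α + 1 + k + j) : ℂ) * Y ^ k =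
      (Real.Gamma (n + α + 1) / n.factorial : ℝ) * ∑ i ∈ Finset.range (n + 1),
        (n.choose i : ℂ) * ((j.descFactorial i : ℝ) * Real.Gamma (α + 1 + j) /
          Real.Gamma (α + 1 + i) : ℝ) * (-Y) ^ i * (1 - Y) ^ (n - i) := by
  have h1 : ∀ k ∈ Finset.range (n + 1),
      (laguerreCoeff n α k : ℂ) * (Real.Gamma (α + 1 + k + j) : ℂ) * Y ^ k =
      ∑ i ∈ Finset.range (n + 1), (Real.Gamma (n + α + 1) / n.factorial : ℝ) *
        ((j.descFactorial i : ℝ) * Real.Gamma (α + 1 + j) / Real.Gamma (α + 1 + i) : ℝ) *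
        ((n.choose k : ℂ) * (k.choose i : ℂ) * (-Y) ^ k) := by
    intro k hk
    have hk' : k ≤ n := by simp at hk; omega
    have p1 : Real.Gamma (α + 1 + k) ≠ 0 :=
      (Real.Gamma_pos_of_pos (by have := Nat.cast_nonneg (α := ℝ) k; linarith)).ne'
    have h2 : laguerreCoeff n α k * Real.Gamma (α + 1 + k + j) =
        Real.Gamma (n + α + 1) / n.factorial * ((-1) ^ k * n.choose k) *
        ∑ i ∈ Finset.range (n + 1), (k.choose i : ℝ) *
        ((j.descFactorial i : ℝ) * Real.Gamma (α + 1 + j) / Real.Gamma (α + 1 + i)) := by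
      have h3 : ∑ i ∈ Finset.range (n + 1), (k.choose i : ℝ) *
        ((j.descFactorial i : ℝ) * Real.Gamma (α + 1 + j) / Real.Gamma (α + 1 + i)) =
          ∑ i ∈ Finset.range (k + 1), (k.choose i : ℝ) *
        ((j.descFactorial i : ℝ) * Real.Gamma (α + 1 + j) / Real.Gamma (α + 1 + i)) := by
        refine (Finset.sum_subset (by simpa using hk') fun i _ hi => ?_).symm
        rw [Nat.choose_eq_zero_of_lt (by simpa using hi)]; simp
      rw [h3, ← Gamma_quotient_shift j k (by linarith : (0 : ℝ) < α + 1),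
        ← laguerreCoeff_mul_Gamma hk' hα]
      have : α + k + 1 = α + 1 + k := by ring
      rw [this]
      field_simp
    rw [← Complex.ofReal_mul, h2]
    push_cast
    rw [Finset.mul_sum, Finset.sum_mul]
    refine Finset.sum_congr rfl fun i _ => ?_
    rw [neg_pow Y k]; ring
  rw [Finset.sum_congr rfl h1, Finset.sum_comm, Finset.mul_sum]
  refine Finset.sum_congr rfl fun i _ => ?_
  rw [← Finset.mul_sum, sum_choose_mul_choose_mul_pow]
  ring

/-- The case `j = 0` of the moment formula: all but one term vanish. -/
theorem sum_laguerreCoeff_zero (n : ℕ) {α : ℝ} (hα : -1 < α) (Y : ℂ) :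
    ∑ k ∈ Finset.range (n + 1),
        (laguerreCoeff n α k : ℂ) * (Real.Gamma (α + k + 1) : ℂ) * Y ^ k =
      (Real.Gamma (n + α + 1) / n.factorial : ℝ) * (1 - Y) ^ n := by
  have h := sum_laguerreCoeff_mul_Gamma_mul_pow n 0 hα Y
  have p1 : Real.Gamma (α + 1) ≠ 0 := (Real.Gamma_pos_of_pos (by linarith)).ne'
  rw [Finset.sum_range_succ' _ n] at h
  rw [Finset.sum_range_succ' _ n]
  rw [Finset.sum_range_succ' (fun i => (n.choose i : ℂ) * _ * _ * _) n] at h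
  simp at h
  simp [p1] at h ⊢
  rw [← h]
  congr 1
  refine Finset.sum_congr rfl fun k _ => ?_
  congr 4; ring

/-- Orthogonality of `L_n^α` to polynomials of smaller degree. -/
theorem sum_laguerreCoeff_orthogonal {n j : ℕ} (hj : j < n) {α : ℝ} (hα : -1 < α) :
    ∑ k ∈ Finset.range (n + 1), laguerreCoeff n α k * Real.Gamma (α + 1 + k + j) = 0 := by
  have h := sum_laguerreCoeff_mul_Gamma_mul_pow n j hα 1
  rw [Finset.sum_eq_zero (s := Finset.range (n + 1)) (f := fun i => (n.choose i : ℂ) * _ * _ * _),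
    mul_zero] at h
  · simp only [one_pow, mul_one] at h
    exact_mod_cast h
  · intro i hi
    rcases lt_or_ge j i with h | h
    · rw [Nat.descFactorial_of_lt h]; simp
    · rw [sub_self, zero_pow (by omega), mul_zero]

/-- The Beta integral `∫ x^{α - 1} (1 - x)^n dx` over `[0, 1]`, with the power of
`1 - x` expanded. -/
theorem sum_choose_div_add (n : ℕ) {α : ℝ} (hα : 0 < α) :
    ∑ k ∈ Finset.range (n + 1), (-1 : ℝ) ^ k * n.choose k / (α + k) =
      n.factorial * Real.Gamma α / Real.Gamma (α + n + 1) := by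
  induction n generalizing α with
  | zero =>
    have := (Real.Gamma_pos_of_pos hα).ne'
    simp [Real.Gamma_add_one hα.ne']; field_simp
  | succ n ih =>
    have h1 := ih hα
    have h2 := ih (α := α + 1) (by positivity)
    have key : ∑ k ∈ Finset.range (n + 1 + 1), (-1 : ℝ) ^ k * (n + 1).choose k / (α + k) =
        ∑ k ∈ Finset.range (n + 1), (-1 : ℝ) ^ k * n.choose k / (α + k) -
        ∑ k ∈ Finset.range (n + 1), (-1 : ℝ) ^ k * n.choose k / (α + 1 + k) := by
      rw [Finset.sum_range_succ' _ (n + 1)]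
      simp only [Nat.choose_succ_succ, Nat.cast_add, mul_add, add_div, Finset.sum_add_distrib]
      rw [Finset.sum_range_succ' (fun k => (-1 : ℝ) ^ k * n.choose k / (α + k)) n]
      rw [Finset.sum_range_succ (fun k => (-1 : ℝ) ^ (k + 1) * n.choose (k + 1) / _) n]
      simp only [Nat.choose_succ_self, Nat.choose_zero_right, pow_succ, Nat.cast_zero]
      have : ∑ k ∈ Finset.range (n + 1), (-1 : ℝ) ^ k * -1 * n.choose k / (α + (k + (1 : ℕ))) =
        - ∑ k ∈ Finset.range (n + 1), (-1 : ℝ) ^ k * n.choose k / (α + 1 + k) := by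
        rw [← Finset.sum_neg_distrib]
        refine Finset.sum_congr rfl fun k _ => ?_
        push_cast; rw [show α + ((k : ℝ) + 1) = α + 1 + k by ring]; ring
      rw [this]; simp; ring
    rw [key, h1, h2, Real.Gamma_add_one hα.ne']
    have e1 : Real.Gamma (α + (n + 1 : ℕ) + 1) = (α + n + 1) * Real.Gamma (α + n + 1) := by
      rw [← Real.Gamma_add_one (by positivity)]; congr 1; push_cast; ring
    have e2 : α + 1 + n + 1 = α + (n + 1 : ℕ) + 1 := by push_cast; ring
    have p1 : Real.Gamma (α + n + 1) ≠ 0 := (Real.Gamma_pos_of_pos (by positivity)).ne'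
    have p2 : α + n + 1 ≠ 0 := by positivity
    rw [e2, e1, Nat.factorial_succ]
    push_cast
    field_simp
    ring

/-- The value of `∫ t^{α - 1} e^{-t} L_n^α(t)^2 dt`. -/
theorem sum_sum_laguerreCoeff_mul_Gamma (n : ℕ) {α : ℝ} (hα : 0 < α) :
    ∑ j ∈ Finset.range (n + 1), ∑ k ∈ Finset.range (n + 1),
      laguerreCoeff n α j * laguerreCoeff n α k * Real.Gamma (α + j + k) =
      Real.Gamma (n + α + 1) / (n.factorial * α) := by
  rw [Finset.sum_range_succ' _ n, Finset.sum_eq_zero, zero_add]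
  · have h : ∀ k ∈ Finset.range (n + 1),
        laguerreCoeff n α 0 * laguerreCoeff n α k * Real.Gamma (α + (0 : ℕ) + k) =
        laguerreCoeff n α 0 * (Real.Gamma (n + α + 1) / n.factorial) *
          ((-1 : ℝ) ^ k * n.choose k / (α + k)) := by
      intro k hk
      have h := laguerreCoeff_mul_Gamma (n := n) (k := k) (α := α) (by simp at hk; omega)
        (by linarith)
      have p : (0 : ℝ) < α + k := by positivity
      rw [mul_assoc, mul_assoc, mul_div_assoc', ← h, Real.Gamma_add_one p.ne']
      simp only [Nat.cast_zero, add_zero]; field_simp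
    rw [Finset.sum_congr rfl h, ← Finset.mul_sum, sum_choose_div_add n hα, laguerreCoeff]
    have p1 : Real.Gamma (α + n + 1) ≠ 0 := (Real.Gamma_pos_of_pos (by positivity)).ne'
    have p2 := (Real.Gamma_pos_of_pos hα).ne'
    rw [show (n : ℝ) + α + 1 = α + n + 1 by ring]
    simp [Real.Gamma_add_one hα.ne']
    field_simp
  · intro j hj
    have h := sum_laguerreCoeff_orthogonal (n := n) (j := j) (α := α) (by simpa using hj)
      (by linarith)
    simp_rw [mul_assoc]
    rw [← Finset.mul_sum]
    rw [show ∑ k ∈ Finset.range (n + 1), laguerreCoeff n α k * Real.Gamma (α + (j + 1 : ℕ) + k)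
      = 0 from by
        rw [← h]
        refine Finset.sum_congr rfl fun k _ => ?_
        congr 2; push_cast; ring]
    simp

/-- The expansion of `P_n^{(0, α)}` in powers of `r = (1 - x) / 2`, with the factorials cleared. -/
theorem jacobi_zero_left (n : ℕ) {α : ℝ} (hα : -1 < α) (r : ℝ) :
    jacobi n 0 α (1 - 2 * r) = ∑ k ∈ Finset.range (n + 1), (n.choose k : ℝ) *
      (Real.Gamma (n + α + k + 1) / (Real.Gamma (n + α + 1) * k.factorial)) * (-r) ^ k := by
  rw [jacobi, Finset.mul_sum]
  refine Finset.sum_congr rfl fun k _ => ?_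
  have p : Real.Gamma (n + α + 1) ≠ 0 :=
    (Real.Gamma_pos_of_pos (by have := Nat.cast_nonneg (α := ℝ) n; linarith)).ne'
  simp only [add_zero, Real.Gamma_nat_eq_factorial]
  rw [show (1 - 2 * r - 1) / 2 = -r by ring, show (n : ℝ) + k + α + 1 = n + α + k + 1 by ring]
  have := Nat.factorial_ne_zero
  field_simp

/-- The Vandermonde convolution behind the change of basis in
`sum_sum_laguerreCoeff_eq_jacobi`. -/
theorem sum_choose_div_Gamma (l j : ℕ) {α : ℝ} (hα : -1 < α) :
    ∑ m ∈ Finset.range (j + 1), (j.choose m : ℝ) /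
        ((j - m).factorial * Real.Gamma (α + 1 + l + m)) =
      Real.Gamma (α + 1 + l + j + j) / (Real.Gamma (α + 1 + l + j) ^ 2 * j.factorial) := by
  have hβ : (0 : ℝ) < α + 1 + l := by have := Nat.cast_nonneg (α := ℝ) l; linarith
  have h := Gamma_quotient_shift j j hβ
  have p : Real.Gamma (α + 1 + l + j) ≠ 0 := (Real.Gamma_pos_of_pos (by positivity)).ne'
  have e : Real.Gamma (α + 1 + l + j + j) / (Real.Gamma (α + 1 + l + j) ^ 2 * j.factorial) =
    Real.Gamma (α + 1 + l + j + j) / Real.Gamma (α + 1 + l + j) /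
      (Real.Gamma (α + 1 + l + j) * j.factorial) := by field_simp
  rw [e, h, Finset.sum_div]
  refine Finset.sum_congr rfl fun m hm => ?_
  have p2 : Real.Gamma (α + 1 + l + m) ≠ 0 := (Real.Gamma_pos_of_pos (by positivity)).ne'
  have hmj : m ≤ j := by simp at hm; omega
  have h3 : (j.factorial : ℝ) = (j - m).factorial * j.descFactorial m := by
    exact_mod_cast (Nat.factorial_mul_descFactorial hmj).symm
  have h4 : (j.descFactorial m : ℝ) ≠ 0 := by
    exact_mod_cast (Nat.descFactorial_eq_zero_iff_lt.not.2 (by omega))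
  have := Nat.factorial_ne_zero (j - m)
  rw [h3]
  field_simp

/-- The integral `∫ t^α e^{-t} L_n^α(X t) L_n^α(Y t) dt` as a polynomial in `X` and `Y`. -/
theorem sum_sum_laguerreCoeff_mul_pow (n : ℕ) {α : ℝ} (hα : -1 < α) (X Y : ℂ) :
    ∑ j ∈ Finset.range (n + 1), ∑ k ∈ Finset.range (n + 1),
      (laguerreCoeff n α j : ℂ) * laguerreCoeff n α k * Real.Gamma (α + j + k + 1) *
        X ^ j * Y ^ k =
      (Real.Gamma (n + α + 1) / n.factorial : ℝ) ^ 2 * ∑ i ∈ Finset.range (n + 1),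
        ((n.choose i : ℝ) ^ 2 * i.factorial / Real.Gamma (α + 1 + i) : ℝ) *
        (X * Y) ^ i * ((1 - X) * (1 - Y)) ^ (n - i) := by
  have h1 : ∀ j ∈ Finset.range (n + 1), ∑ k ∈ Finset.range (n + 1),
      (laguerreCoeff n α j : ℂ) * laguerreCoeff n α k * Real.Gamma (α + j + k + 1) *
        X ^ j * Y ^ k = ∑ i ∈ Finset.range (n + 1),
        (Real.Gamma (n + α + 1) / n.factorial : ℝ) ^ 2 *
        ((n.choose i : ℝ) * i.factorial / Real.Gamma (α + 1 + i) : ℝ) *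
        (-Y) ^ i * (1 - Y) ^ (n - i) *
        ((n.choose j : ℂ) * (j.choose i : ℂ) * (-X) ^ j) := by
    intro j hj
    have h2 := sum_laguerreCoeff_mul_Gamma_mul_pow n j hα Y
    have h3 := laguerreCoeff_mul_Gamma (n := n) (k := j) (by simp at hj; omega) hα
    calc _ = (laguerreCoeff n α j : ℂ) * X ^ j * ∑ k ∈ Finset.range (n + 1),
        (laguerreCoeff n α k : ℂ) * (Real.Gamma (α + 1 + k + j) : ℂ) * Y ^ k := by
          rw [Finset.mul_sum]
          refine Finset.sum_congr rfl fun k _ => ?_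
          rw [show α + j + k + 1 = α + 1 + k + j by ring]; ring
      _ = _ := by
          rw [h2, Finset.mul_sum, Finset.mul_sum]
          refine Finset.sum_congr rfl fun i _ => ?_
          have h4 : (laguerreCoeff n α j * Real.Gamma (α + j + 1) : ℂ) =
            (Real.Gamma (n + α + 1) / n.factorial : ℝ) * ((-1) ^ j * n.choose j) := by
              exact_mod_cast congrArg (Complex.ofReal) h3
          have h5 : (j.descFactorial i : ℂ) = i.factorial * j.choose i := by
            exact_mod_cast congrArg (Nat.cast : ℕ → ℂ)
              (Nat.descFactorial_eq_factorial_mul_choose j i)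
          rw [show α + 1 + (j : ℝ) = α + j + 1 by ring, neg_pow X j]
          push_cast at h4 ⊢
          rw [h5]
          linear_combination (X ^ j * (Real.Gamma (n + α + 1) / n.factorial) * n.choose i *
            i.factorial * j.choose i / Real.Gamma (α + 1 + i) * (-Y) ^ i *
            (1 - Y) ^ (n - i)) * h4
  rw [Finset.sum_congr rfl h1, Finset.sum_comm, Finset.mul_sum]
  refine Finset.sum_congr rfl fun i _ => ?_
  rw [← Finset.mul_sum, sum_choose_mul_choose_mul_pow, neg_pow X, neg_pow Y, mul_pow, mul_pow]
  have : ((-1 : ℂ) ^ i) * (-1) ^ i = 1 := by rw [← mul_pow]; simp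
  push_cast
  linear_combination ((Real.Gamma (n + α + 1) / n.factorial) ^ 2 * (n.choose i : ℂ) ^ 2 *
    i.factorial / Real.Gamma (α + 1 + i) * X ^ i * Y ^ i * (1 - X) ^ (n - i) *
    (1 - Y) ^ (n - i)) * this

/-- The matrix coefficient `∫ t^α e^{-t} L_n^α(X t) L_n^α(Y t) dt` is, up to the power
`(X + Y - 1)^n`, a Jacobi polynomial in the variable `r = (1 - X) (1 - Y) / (1 - X - Y)`. -/
theorem sum_sum_laguerreCoeff_eq_jacobi (n : ℕ) {α : ℝ} (hα : -1 < α) (X Y : ℂ) (r : ℝ)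
    (hr : (1 - X) * (1 - Y) = r * (1 - X - Y)) :
    ∑ j ∈ Finset.range (n + 1), ∑ k ∈ Finset.range (n + 1),
      (laguerreCoeff n α j : ℂ) * laguerreCoeff n α k * Real.Gamma (α + j + k + 1) *
        X ^ j * Y ^ k =
      (Real.Gamma (n + α + 1) / n.factorial : ℝ) * (X + Y - 1) ^ n *
        (jacobi n 0 α (1 - 2 * r) : ℂ) := by
  rw [sum_sum_laguerreCoeff_mul_pow n hα, jacobi_zero_left n hα]
  set A := (1 - X) * (1 - Y) with hA
  set D := 1 - X - Y with hD
  have hXY : X * Y = A + -D := by rw [hA, hD]; ring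
  -- expand `(X Y)^i = (A - D)^i` and compare the coefficients of `A^j D^(n - j)`
  have h1 : ∀ i ∈ Finset.range (n + 1),
      (((n.choose i : ℝ) ^ 2 * i.factorial / Real.Gamma (α + 1 + i) : ℝ) : ℂ) *
        (X * Y) ^ i * A ^ (n - i) = ∑ l ∈ Finset.range (n + 1),
        (((n.choose i : ℝ) ^ 2 * i.factorial / Real.Gamma (α + 1 + i) * i.choose l : ℝ) : ℂ) *
        ((-D) ^ l * A ^ (n - l)) := by
    intro i hi
    have hi' : i ≤ n := by simp at hi; omega
    rw [hXY, add_comm A, add_pow]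
    rw [← Finset.sum_subset (s₁ := Finset.range (i + 1)) (s₂ := Finset.range (n + 1))
      (Finset.range_subset_range.2 (by omega))]
    · rw [Finset.mul_sum, Finset.sum_mul]
      refine Finset.sum_congr rfl fun l hl => ?_
      have : n - l = (i - l) + (n - i) := by simp at hl; omega
      rw [this, pow_add]; push_cast; ring
    · intro l _ hl
      rw [Nat.choose_eq_zero_of_lt (by simpa using hl : i < l)]; simp
  rw [Finset.sum_congr rfl h1, Finset.sum_comm, ← Finset.sum_range_reflect, Finset.mul_sum]
  rw [Complex.ofReal_sum, Finset.mul_sum]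
  refine Finset.sum_congr rfl fun j hj => ?_
  have hj' : j ≤ n := by simp at hj; omega
  obtain ⟨l, rfl⟩ := Nat.exists_eq_add_of_le hj'
  rw [show j + l + 1 - 1 - j = l by omega]
  rw [← Finset.sum_mul, show j + l - l = j by omega]
  have key : ∑ i ∈ Finset.range (j + l + 1), (((j + l).choose i : ℝ) ^ 2 * i.factorial /
      Real.Gamma (α + 1 + i) * i.choose l) = (j + l).factorial * (j + l).choose j *
      (Real.Gamma (j + l + α + j + 1) / (Real.Gamma (j + l + α + 1) ^ 2 * j.factorial)) := by
    have hV := sum_choose_div_Gamma l j hα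
    rw [show α + 1 + l + j + j = j + l + α + j + 1 by ring,
      show α + 1 + l + j = j + l + α + 1 by ring] at hV
    rw [← hV, Finset.mul_sum, add_comm j l, add_assoc, Finset.sum_range_add, Finset.sum_eq_zero,
      zero_add]
    · refine Finset.sum_congr rfl fun m hm => ?_
      have hm' : m ≤ j := by simp at hm; omega
      have c1 : ((l + j).choose (l + m) : ℝ) * (l + m).choose l =
          (l + j).choose j * j.choose m := by
        have := Nat.choose_mul (n := l + j) (k := l + m) (s := l) (by omega)
        rw [Nat.add_sub_cancel_left, Nat.add_sub_cancel_left,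
          (Nat.choose_symm_add : (l + j).choose l = (l + j).choose j)] at this
        exact_mod_cast this
      have c2 : ((l + j).choose (l + m) : ℝ) * (l + m).factorial * (j - m).factorial =
          (l + j).factorial := by
        have := Nat.choose_mul_factorial_mul_factorial (n := l + j) (k := l + m) (by omega)
        rw [show l + j - (l + m) = j - m by omega] at this
        exact_mod_cast this
      have p : Real.Gamma (α + 1 + l + m) ≠ 0 :=
        (Real.Gamma_pos_of_pos (by
          have := Nat.cast_nonneg (α := ℝ) l
          have := Nat.cast_nonneg (α := ℝ) m; linarith)).ne'
      have p' := Nat.factorial_ne_zero (j - m)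
      rw [show α + 1 + ((l + m : ℕ) : ℝ) = α + 1 + l + m by push_cast; ring]
      field_simp
      rw [← c2]
      linear_combination ((l + m).factorial * (l + j).choose (l + m) * (j - m).factorial : ℝ) * c1
    · intro i hi
      rw [Nat.choose_eq_zero_of_lt (by simpa using hi : i < l)]; simp
  have key' := congrArg (Complex.ofReal) key
  push_cast at key'
  push_cast
  rw [key']
  have p : (Real.Gamma (j + l + α + 1) : ℂ) ≠ 0 := by
    exact_mod_cast (Real.Gamma_pos_of_pos (by
          have := Nat.cast_nonneg (α := ℝ) l
          have := Nat.cast_nonneg (α := ℝ) j; linarith)).ne'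
  have pf : ((j + l).factorial : ℂ) ≠ 0 := by exact_mod_cast Nat.factorial_ne_zero _
  have pj : (j.factorial : ℂ) ≠ 0 := by exact_mod_cast Nat.factorial_ne_zero _
  have hXYD : X + Y - 1 = -D := by rw [hD]; ring
  rw [hr, hXYD, pow_add (-D) j l, mul_pow, neg_pow D j, neg_pow (r : ℂ) j]
  have : ((-1 : ℂ) ^ j) * (-1) ^ j = 1 := by rw [← mul_pow]; simp
  field_simp
  linear_combination (-((j + l).choose j * Real.Gamma (j + l + α + j + 1) * r ^ j * D ^ j *
    (-D) ^ l : ℂ)) * this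

/-! ### The Laplace integral of a power -/

/-- In the right half-plane the arguments add without leaving `(-π, π)`, so complex powers are
multiplicative there. -/
theorem mul_cpow_of_re_pos {a b : ℂ} (ha : 0 < a.re) (hb : 0 < b.re) (c : ℂ) :
    (a * b) ^ c = a ^ c * b ^ c := by
  have ha' := abs_lt.1 (Complex.abs_arg_lt_pi_div_two_iff.2 (Or.inl ha))
  have hb' := abs_lt.1 (Complex.abs_arg_lt_pi_div_two_iff.2 (Or.inl hb))
  have a0 : a ≠ 0 := by rintro rfl; simp at ha
  have b0 : b ≠ 0 := by rintro rfl; simp at hb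
  rw [Complex.cpow_def_of_ne_zero (mul_ne_zero a0 b0), Complex.cpow_def_of_ne_zero a0,
    Complex.cpow_def_of_ne_zero b0, Complex.log_mul a0 b0 ⟨by linarith, by linarith⟩,
    ← Complex.exp_add]
  ring_nf

theorem integrableOn_rpow_mul_exp {a r : ℝ} (ha : -1 < a) (hr : 0 < r) :
    IntegrableOn (fun t : ℝ => t ^ a * Real.exp (-(r * t))) (Set.Ioi 0) := by
  simpa using integrableOn_rpow_mul_exp_neg_mul_rpow (s := a) (p := 1) (b := r) ha one_pos hr

theorem norm_rpow_mul_cexp {t : ℝ} (ht : 0 < t) (a : ℝ) (p : ℂ) :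
    ‖((t ^ a : ℝ) : ℂ) * Complex.exp (-(p * t))‖ = t ^ a * Real.exp (-(p.re * t)) := by
  rw [norm_mul, Complex.norm_exp, Complex.norm_real, Real.norm_of_nonneg (by positivity)]
  simp

theorem integrableOn_rpow_mul_cexp {a : ℝ} {p : ℂ} (ha : -1 < a) (hp : 0 < p.re) :
    IntegrableOn (fun t : ℝ => ((t ^ a : ℝ) : ℂ) * Complex.exp (-(p * t))) (Set.Ioi 0) := by
  refine (integrableOn_rpow_mul_exp ha hp).mono' ?_ ?_
  · exact (by fun_prop : Measurable fun t : ℝ =>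
      ((t ^ a : ℝ) : ℂ) * Complex.exp (-(p * t))).aestronglyMeasurable
  · exact (ae_restrict_iff' measurableSet_Ioi).2
      (.of_forall fun t ht => (norm_rpow_mul_cexp ht a p).le)

/-- The Gamma integral with a complex scale, by analytic continuation in `p` from the positive
half-line. -/
theorem integral_rpow_mul_cexp {a : ℝ} {p : ℂ} (ha : -1 < a) (hp : 0 < p.re) :
    ∫ t in Set.Ioi (0 : ℝ), ((t ^ a : ℝ) : ℂ) * Complex.exp (-(p * t)) =
      (Real.Gamma (a + 1) : ℂ) * p ^ (-(a + 1) : ℂ) := by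
  set μ : Measure ℝ := (volume.restrict (Set.Ioi (0 : ℝ))).withDensity
    fun t => ((Real.toNNReal (t ^ a) : NNReal) : ENNReal) with hμ
  have hmeas : Measurable fun t : ℝ => Real.toNNReal (t ^ a) := by fun_prop
  have hF : ∀ z : ℂ, ProbabilityTheory.complexMGF id μ z =
      ∫ t in Set.Ioi (0 : ℝ), ((t ^ a : ℝ) : ℂ) * Complex.exp (z * t) := by
    intro z
    rw [ProbabilityTheory.complexMGF, hμ, integral_withDensity_eq_integral_smul hmeas]
    refine setIntegral_congr_fun measurableSet_Ioi fun t ht => ?_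
    have : (0 : ℝ) ≤ t ^ a := Real.rpow_nonneg (le_of_lt ht) a
    simp [NNReal.smul_def, this]
  have hset : Set.Iio (0 : ℝ) ⊆ interior (ProbabilityTheory.integrableExpSet id μ) := by
    refine interior_maximal (fun x hx => ?_) isOpen_Iio
    change Integrable (fun t => Real.exp (x * id t)) μ
    rw [hμ, integrable_withDensity_iff_integrable_smul hmeas]
    refine (integrableOn_rpow_mul_exp ha (r := -x) (by simpa using hx)).congr ?_
    refine (ae_restrict_iff' measurableSet_Ioi).2 (.of_forall fun t ht => ?_)
    have : (0 : ℝ) ≤ t ^ a := Real.rpow_nonneg (le_of_lt ht) a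
    simp [NNReal.smul_def, this]
  let U : Set ℂ := {z | 0 < z.re}
  have hf : AnalyticOnNhd ℂ (fun z => ProbabilityTheory.complexMGF id μ (-z)) U := by
    have := (ProbabilityTheory.analyticOnNhd_complexMGF (X := id) (μ := μ))
    refine this.comp (analyticOnNhd_id.neg) fun z hz => hset ?_
    have hz' : 0 < z.re := hz
    simpa using hz'
  have hg : AnalyticOnNhd ℂ (fun z : ℂ => (Real.Gamma (a + 1) : ℂ) * z ^ (-(a + 1) : ℂ)) U := by
    refine analyticOnNhd_const.mul (AnalyticOnNhd.cpow analyticOnNhd_id analyticOnNhd_const ?_)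
    intro z hz
    exact Or.inl hz
  have hU : IsPreconnected U := (convex_halfSpace_re_gt 0).isPreconnected
  have heq := hf.eqOn_of_preconnected_of_frequently_eq hg hU (z₀ := 1) (by simp [U]) ?_
  · have := heq (x := p) hp
    simp only [hF] at this
    rw [← this]
    simp
  · have hreal : ∀ r : ℝ, 0 < r → ProbabilityTheory.complexMGF id μ (-(r : ℂ)) =
        (Real.Gamma (a + 1) : ℂ) * (r : ℂ) ^ (-(a + 1) : ℂ) := by
      intro r hr
      rw [hF]
      have h := Real.integral_rpow_mul_exp_neg_mul_Ioi (a := a + 1) (r := r) (by linarith) hr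
      have h2 : ((r : ℂ) ^ (-(a + 1) : ℂ)) = (((1 / r) ^ (a + 1) : ℝ) : ℂ) := by
        rw [one_div, Real.inv_rpow hr.le, ← Real.rpow_neg hr.le, Complex.ofReal_cpow hr.le]
        push_cast; rfl
      rw [h2, mul_comm, ← Complex.ofReal_mul, ← h, ← integral_complex_ofReal]
      refine integral_congr_ae (.of_forall fun t => ?_)
      simp
    have hseq : Filter.Tendsto (fun k : ℕ => (((1 + 1 / ((k : ℝ) + 1) : ℝ)) : ℂ)) Filter.atTop
        (nhdsWithin 1 {1}ᶜ) := by
      refine tendsto_nhdsWithin_iff.2 ⟨?_, .of_forall fun k => ?_⟩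
      · have := (tendsto_one_div_add_atTop_nhds_zero_nat (𝕜 := ℝ)).const_add 1
        have h2 := (Complex.continuous_ofReal.tendsto (1 + 0 : ℝ)).comp this
        simpa [Function.comp_def] using h2
      · simp only [Set.mem_compl_iff, Set.mem_singleton_iff]
        intro h
        have h2 : (1 + 1 / ((k : ℝ) + 1) : ℝ) = 1 := by exact_mod_cast h
        have : 0 < 1 / ((k : ℝ) + 1) := by positivity
        linarith
    refine hseq.frequently (Filter.Frequently.of_forall fun k => ?_)
    exact hreal _ (by positivity)

/-- Injectivity of the Fourier transform on `L¹(ℝ)`: every test function is the Fourier transform of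
a Schwartz function, so `G` integrates to `0` against it. -/
theorem ae_eq_zero_of_fourier_eq_zero {G : ℝ → ℂ} (hG : Integrable G) (h : 𝓕 G = 0) :
    G =ᵐ[volume] 0 := by
  refine ae_eq_zero_of_integral_contDiff_smul_eq_zero hG.locallyIntegrable fun g hg hc => ?_
  have hg' : ContDiff ℝ (⊤ : ℕ∞) fun x => (g x : ℂ) := Complex.ofRealCLM.contDiff.comp hg
  let g' : SchwartzMap ℝ ℂ := HasCompactSupport.toSchwartzMap
    (hc.comp_left (g := Complex.ofReal) Complex.ofReal_zero) hg'
  have h1 := VectorFourier.integral_fourierIntegral_smul_eq_flip (e := Real.fourierChar)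
    (μ := (volume : Measure ℝ)) (ν := (volume : Measure ℝ)) (L := innerₗ ℝ)
    (f := (𝓕⁻ g' : SchwartzMap ℝ ℂ)) (g := G) Real.continuous_fourierChar
    (by exact continuous_inner) (𝓕⁻ g' : SchwartzMap ℝ ℂ).integrable hG
  rw [flip_innerₗ] at h1
  have h2 : VectorFourier.fourierIntegral Real.fourierChar volume (innerₗ ℝ) G = 0 := h
  have h3 : VectorFourier.fourierIntegral Real.fourierChar volume (innerₗ ℝ)
      (𝓕⁻ g' : SchwartzMap ℝ ℂ) = g' := by
    have : (𝓕 (𝓕⁻ g' : SchwartzMap ℝ ℂ) : SchwartzMap ℝ ℂ) = g' :=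
      FourierTransform.fourier_fourierInv_eq g'
    conv_rhs => rw [← this]
    rw [SchwartzMap.fourier_coe]; rfl
  rw [h2, h3] at h1
  simp at h1
  rw [← h1]
  rfl

/-! ### The Hardy space on the Fourier side -/

theorem stronglyMeasurable_fourierL2 (f : L2R) : StronglyMeasurable (fourierL2 f) :=
  (Lp.stronglyMeasurable (𝓕 f : L2R)).comp_measurable (by fun_prop)

theorem memLp_fourierL2 (f : L2R) : MemLp (fourierL2 f) 2 volume := by
  have h2 : (0 : ℝ) < (2 * Real.pi)⁻¹ := by positivity
  have h3 : MemLp (𝓕 f : L2R) 2 (Measure.map (fun t : ℝ => (2 * Real.pi)⁻¹ * t) volume) := by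
    rw [map_scale h2]
    exact (Lp.memLp (𝓕 f : L2R)).smul_measure ENNReal.ofReal_ne_top
  have := h3.comp_of_map (by fun_prop)
  refine this.ae_eq (.of_forall fun t => ?_)
  simp [fourierL2, div_eq_inv_mul]

theorem fourierL2_add (f g : L2R) : fourierL2 (f + g) =ᵐ[volume] fourierL2 f + fourierL2 g := by
  have h0 : (𝓕 (f + g) : L2R) = 𝓕 f + 𝓕 g := FourierTransform.fourier_add f g
  filter_upwards [quasi_div.ae (Lp.coeFn_add (𝓕 f : L2R) (𝓕 g : L2R))] with ξ h
  simp only [fourierL2, h0, h, Pi.add_apply]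

theorem fourierL2_smul (c : ℂ) (f : L2R) : fourierL2 (c • f) =ᵐ[volume] c • fourierL2 f := by
  have h0 : (𝓕 (c • f) : L2R) = c • 𝓕 f := FourierTransform.fourier_smul c f
  filter_upwards [quasi_div.ae (Lp.coeFn_smul c (𝓕 f : L2R))] with ξ h
  simp only [fourierL2, h0, h, Pi.smul_apply]

theorem fourierL2_zero : fourierL2 (0 : L2R) =ᵐ[volume] 0 := by
  have := fourierL2_smul 0 (0 : L2R)
  simpa using this

theorem fourierL2_sum {ι : Type*} (s : Finset ι) (f : ι → L2R) :
    fourierL2 (∑ i ∈ s, f i) =ᵐ[volume] fun t => ∑ i ∈ s, fourierL2 (f i) t := by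
  classical
  induction s using Finset.induction_on with
  | empty => exact fourierL2_zero
  | insert a s ha ih =>
    rw [Finset.sum_insert ha]
    filter_upwards [fourierL2_add (f a) (∑ i ∈ s, f i), ih] with t h1 h2
    rw [h1, Pi.add_apply, h2, Finset.sum_insert ha]

theorem fourierL2_of_neg (f : H2) : ∀ᵐ ξ : ℝ, ξ < 0 → fourierL2 (f : L2R) ξ = 0 := f.2

theorem fourierL2_injective {f g : L2R} (h : fourierL2 f =ᵐ[volume] fourierL2 g) : f = g := by
  have hq : Measure.QuasiMeasurePreserving (fun t : ℝ => 2 * Real.pi * t) :=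
    ⟨by fun_prop, by
      rw [map_scale (by positivity)]; exact Measure.smul_absolutelyContinuous⟩
  have h1 : (𝓕 f : L2R) = 𝓕 g := by
    refine Lp.ext ?_
    filter_upwards [hq.ae h] with t ht
    simpa [fourierL2] using ht
  exact (Lp.fourierTransformₗᵢ ℝ ℂ).injective h1

theorem H2_ext {f g : H2}
    (h : ∀ᵐ t : ℝ, 0 < t → fourierL2 (f : L2R) t = fourierL2 (g : L2R) t) : f = g := by
  refine Subtype.ext (fourierL2_injective ?_)
  filter_upwards [h, fourierL2_of_neg f, fourierL2_of_neg g,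
    Measure.ae_ne volume (0 : ℝ)] with t h1 h2 h3 h4
  rcases lt_or_gt_of_ne h4 with h | h
  · rw [h2 h, h3 h]
  · exact h1 h

/-- Every square integrable function on the half-line is the Fourier transform of an element of
the Hardy space. -/
theorem exists_fourierL2_eq {g : ℝ → ℂ} (hg : MemLp g 2 volume) (h0 : ∀ t < 0, g t = 0) :
    ∃ f : H2, fourierL2 (f : L2R) =ᵐ[volume] g := by
  have h2 : (0 : ℝ) < 2 * Real.pi := by positivity
  have h3 : MemLp (fun t => g (2 * Real.pi * t)) 2 volume := by
    have : MemLp g 2 (Measure.map (fun t : ℝ => 2 * Real.pi * t) volume) := by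
      rw [map_scale h2]
      exact hg.smul_measure ENNReal.ofReal_ne_top
    exact this.comp_of_map (by fun_prop)
  have h4 : fourierL2 (𝓕⁻ (h3.toLp _ : L2R)) =ᵐ[volume] g := by
    filter_upwards [quasi_div.ae (MemLp.coeFn_toLp h3)] with ξ hξ
    simp only [fourierL2]
    rw [FourierTransform.fourier_fourierInv_eq, hξ, mul_div_cancel₀ _ (by positivity)]
  refine ⟨⟨𝓕⁻ (h3.toLp _ : L2R), ?_⟩, h4⟩
  change ∀ᵐ ξ : ℝ, ξ < 0 → fourierL2 _ ξ = 0
  filter_upwards [h4] with ξ hξ hneg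
  rw [hξ, h0 ξ hneg]

/-- Plancherel's formula for the unnormalized Fourier transform. -/
theorem inner_eq_integral (f g : H2) : inner ℂ f g = (2 * Real.pi : ℂ)⁻¹ *
    ∫ t in Set.Ioi (0 : ℝ), (starRingEnd ℂ) (fourierL2 (f : L2R) t) * fourierL2 (g : L2R) t := by
  have h1 : inner ℂ f g = inner ℂ (𝓕 (f : L2R) : L2R) (𝓕 (g : L2R)) :=
    (Lp.inner_fourier_eq (f : L2R) (g : L2R)).symm
  have h2 := Measure.integral_comp_div
    (fun ξ => (starRingEnd ℂ) ((𝓕 (f : L2R) : L2R) ξ) * (𝓕 (g : L2R) : L2R) ξ) (2 * Real.pi)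
  have h3 : ∫ t, (starRingEnd ℂ) (fourierL2 (f : L2R) t) * fourierL2 (g : L2R) t =
      ∫ t in Set.Ioi (0 : ℝ), (starRingEnd ℂ) (fourierL2 (f : L2R) t) * fourierL2 (g : L2R) t := by
    rw [← integral_indicator measurableSet_Ioi]
    refine integral_congr_ae ?_
    filter_upwards [fourierL2_of_neg f, Measure.ae_ne volume (0 : ℝ)] with t h2 h4
    rcases lt_or_gt_of_ne h4 with h | h
    · simp [h2 h, Set.indicator, not_lt.2 h.le]
    · rw [Set.indicator_of_mem (show t ∈ Set.Ioi (0 : ℝ) from h)]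
  rw [h1, L2.inner_def, ← h3]
  simp only [fourierL2]
  rw [h2, abs_of_pos (by positivity)]
  simp only [Complex.real_smul, RCLike.inner_apply]
  push_cast
  rw [← mul_assoc, inv_mul_cancel₀ (by simp [Real.pi_ne_zero]), one_mul]
  congr 1; ext t; ring

theorem fourierL2_rep (z : ℍ) (f : H2) :
    fourierL2 (rep z f : H2) =ᵐ[volume] fun t =>
      (Real.sqrt z.im : ℂ) * Complex.exp (-(z.re * t : ℝ) * Complex.I) *
        fourierL2 (f : L2R) (z.im * t) := by
  have h : (rep z f : L2R) = repL2 z f := rfl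
  filter_upwards [quasi_div.ae (weightedComp_coeFn (c := z.im⁻¹) (inv_pos.2 z.im_pos) _ _ _
    (map_scale z.im_pos) (𝓕 (f : L2R) : L2R))] with ξ h2
  simp only [fourierL2, h, fourier_repL2] at *
  refine h2.trans ?_
  have h4 : z.im * (ξ / (2 * Real.pi)) = z.im * ξ / (2 * Real.pi) := by ring
  have h5 : 2 * Real.pi * z.re * (ξ / (2 * Real.pi)) = z.re * ξ := by field_simp
  rw [h4, h5]; push_cast; rfl

theorem rep_affMul (z w : ℍ) (f : H2) : rep (affMul z w) f = rep z (rep w f) :=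
  Subtype.ext (repL2_affMul z w f)

theorem inner_rep_rep (z : ℍ) (f g : H2) : inner ℂ (rep z f) (rep z g) = inner ℂ f g :=
  (repL2 z).inner_map_map (f : L2R) (g : L2R)

theorem norm_rep (z : ℍ) (f : H2) : ‖rep z f‖ = ‖f‖ := (repL2 z).norm_map (f : L2R)

theorem inner_rep_right (z : ℍ) (f g : H2) :
    inner ℂ f (rep z g) = (2 * Real.pi : ℂ)⁻¹ * ∫ t in Set.Ioi (0 : ℝ),
      (starRingEnd ℂ) (fourierL2 (f : L2R) t) * ((Real.sqrt z.im : ℂ) *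
        Complex.exp (-(z.re * t : ℝ) * Complex.I) * fourierL2 (g : L2R) (z.im * t)) := by
  rw [inner_eq_integral]
  congr 1
  refine setIntegral_congr_ae measurableSet_Ioi ?_
  filter_upwards [fourierL2_rep z g] with t h _
  rw [h]

theorem measurable_re : Measurable fun z : ℍ => z.re := UpperHalfPlane.continuous_re.measurable
theorem measurable_im : Measurable fun z : ℍ => z.im := UpperHalfPlane.continuous_im.measurable

theorem stronglyMeasurable_inner_rep (f g : H2) :
    StronglyMeasurable fun z : ℍ => inner ℂ f (rep z g) := by
  simp_rw [inner_rep_right]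
  refine StronglyMeasurable.const_mul ?_ _
  refine StronglyMeasurable.integral_prod_right (f := fun (z : ℍ) (t : ℝ) =>
    (starRingEnd ℂ) (fourierL2 (f : L2R) t) * ((Real.sqrt z.im : ℂ) *
        Complex.exp (-(z.re * t : ℝ) * Complex.I) * fourierL2 (g : L2R) (z.im * t))) ?_
  have m1 := measurable_re
  have m2 := measurable_im
  have m3 := (stronglyMeasurable_fourierL2 f).measurable
  have m4 := (stronglyMeasurable_fourierL2 g).measurable
  refine Measurable.stronglyMeasurable ?_
  simp only [Function.uncurry_def]
  have m5 : Measurable fun p : ℍ × ℝ => fourierL2 (g : L2R) (p.1.im * p.2) :=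
    m4.comp (by fun_prop)
  have m6 : Measurable fun p : ℍ × ℝ => (starRingEnd ℂ) (fourierL2 (f : L2R) p.2) :=
    Complex.continuous_conj.measurable.comp (m3.comp measurable_snd)
  fun_prop

theorem stronglyMeasurable_waveletTransform (ψ f : H2) :
    StronglyMeasurable (waveletTransform ψ f) := by
  have := (Complex.continuous_conj.comp_stronglyMeasurable (stronglyMeasurable_inner_rep f ψ))
  have h : (fun z => (starRingEnd ℂ) (inner ℂ f (rep z ψ))) = waveletTransform ψ f :=
    funext fun z => inner_conj_symm (rep z ψ) f
  rwa [h] at this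

theorem norm_inner_rep_le (z : ℍ) (f g : H2) : ‖inner ℂ f (rep z g)‖ ≤ ‖f‖ * ‖g‖ := by
  rw [← norm_rep z g]; exact norm_inner_le_norm (𝕜 := ℂ) f (rep z g)

theorem norm_waveletTransform_le (z : ℍ) (ψ f : H2) : ‖waveletTransform ψ f z‖ ≤ ‖ψ‖ * ‖f‖ := by
  rw [← norm_rep z ψ]; exact norm_inner_le_norm (𝕜 := ℂ) (rep z ψ) f

theorem affInv_affMul_cancel (z w : ℍ) : affMul (affInv z) (affMul z w) = w := by
  have := z.im_ne_zero
  refine UpperHalfPlane.ext_re_im ?_ ?_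
  · change -z.re / z.im + 1 / z.im * (z.re + z.im * w.re) = w.re
    field_simp
    ring
  · change 1 / z.im * (z.im * w.im) = w.im
    field_simp

theorem affInv_affInv (z : ℍ) : affInv (affInv z) = z := by
  have := z.im_ne_zero
  refine UpperHalfPlane.ext_re_im ?_ ?_
  · change -(-z.re / z.im) / (1 / z.im) = z.re
    field_simp
  · change 1 / (1 / z.im) = z.im
    field_simp

theorem affMul_affInv (z : ℍ) : affMul z (affInv z) = UpperHalfPlane.I := by
  have := z.im_ne_zero
  refine UpperHalfPlane.ext_re_im ?_ ?_
  · change z.re + z.im * (-z.re / z.im) = UpperHalfPlane.I.re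
    simp; field_simp; ring
  · change z.im * (1 / z.im) = UpperHalfPlane.I.im
    simp; field_simp

theorem rep_I (f : H2) : rep UpperHalfPlane.I f = f := by
  refine H2_ext ?_
  filter_upwards [fourierL2_rep UpperHalfPlane.I f] with t h _
  simp [h]

theorem inner_rep_left (z : ℍ) (f g : H2) : inner ℂ (rep z f) g = inner ℂ f (rep (affInv z) g) := by
  have h : rep z (rep (affInv z) g) = g := by
    rw [← rep_affMul, affMul_affInv, rep_I]
  conv_lhs => rw [← h]
  rw [inner_rep_rep]

theorem continuous_affMul : Continuous fun p : ℍ × ℍ => affMul p.1 p.2 := by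
  refine UpperHalfPlane.isEmbedding_coe.continuous_iff.2 ?_
  have m1 := UpperHalfPlane.continuous_re
  have m2 := UpperHalfPlane.continuous_im
  have : (UpperHalfPlane.coe ∘ fun p : ℍ × ℍ => affMul p.1 p.2) = fun p =>
    ((p.1.re + p.1.im * p.2.re : ℝ) : ℂ) + ((p.1.im * p.2.im : ℝ) : ℂ) * Complex.I := by
    ext p
    apply Complex.ext <;> simp [affMul]
  rw [this]
  fun_prop

theorem measurable_affMul : Measurable fun p : ℍ × ℍ => affMul p.1 p.2 :=
  continuous_affMul.measurable

theorem continuous_affInv : Continuous affInv := by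
  refine UpperHalfPlane.isEmbedding_coe.continuous_iff.2 ?_
  have m1 := UpperHalfPlane.continuous_re
  have m2 := UpperHalfPlane.continuous_im
  have : (UpperHalfPlane.coe ∘ affInv) = fun p =>
    ((-p.re / p.im : ℝ) : ℂ) + ((1 / p.im : ℝ) : ℂ) * Complex.I := by
    ext p
    apply Complex.ext <;> simp [affInv]
  rw [this]
  have h : ∀ p : ℍ, p.im ≠ 0 := fun p => p.im_ne_zero
  fun_prop (disch := exact h _)

theorem measurable_affInv : Measurable affInv := continuous_affInv.measurable

/-! ### The vectors with Fourier transform `t ^ β * exp (-t)` -/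

theorem exists_powerExp {β : ℝ} (hβ : 0 < β) : ∃ f : H2, fourierL2 (f : L2R) =ᵐ[volume] fun t =>
    ((Set.indicator (Set.Ioi (0 : ℝ)) (fun t => t ^ β * Real.exp (-t)) t : ℝ) : ℂ) :=
  exists_fourierL2_eq (memLp_monomial hβ).ofReal fun t ht => by
    rw [Set.indicator_of_notMem (by simpa using ht.le)]; simp

/-- The element of `H²(ℂ⁺)` whose Fourier transform is `t ^ β * exp (-t)` on the half-line. -/
noncomputable def powerExp (β : ℝ) (hβ : 0 < β) : H2 := (exists_powerExp hβ).choose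

theorem fourierL2_powerExp {β : ℝ} (hβ : 0 < β) :
    ∀ᵐ t : ℝ, 0 < t → fourierL2 (powerExp β hβ : L2R) t = ((t ^ β * Real.exp (-t) : ℝ) : ℂ) := by
  filter_upwards [(exists_powerExp hβ).choose_spec] with t h ht
  refine h.trans ?_
  rw [Set.indicator_of_mem (show t ∈ Set.Ioi (0 : ℝ) from ht)]

/-- The point `s + i x` of the right half-plane attached to `x + i s`: the Fourier transform of
`π(z) (powerExp β)` is a multiple of `t ^ β * exp (-(rightPoint z) * t)`. -/
noncomputable def rightPoint (z : ℍ) : ℂ := (z.im : ℂ) + z.re * Complex.I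

@[simp] theorem rightPoint_re (z : ℍ) : (rightPoint z).re = z.im := by simp [rightPoint]
@[simp] theorem rightPoint_im (z : ℍ) : (rightPoint z).im = z.re := by simp [rightPoint]
@[simp] theorem rightPoint_I : rightPoint UpperHalfPlane.I = 1 := by simp [rightPoint]

theorem fourierL2_rep_powerExp (z : ℍ) {β : ℝ} (hβ : 0 < β) :
    ∀ᵐ t : ℝ, 0 < t → fourierL2 (rep z (powerExp β hβ) : H2) t =
      ((z.im ^ (1 / 2 + β) : ℝ) : ℂ) * (((t ^ β : ℝ) : ℂ) * Complex.exp (-(rightPoint z * t))) := by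
  have hs := z.im_pos
  have hq : Measure.QuasiMeasurePreserving (fun t : ℝ => z.im * t) :=
    ⟨by fun_prop, by rw [map_scale hs]; exact Measure.smul_absolutelyContinuous⟩
  filter_upwards [fourierL2_rep z (powerExp β hβ), hq.ae (fourierL2_powerExp hβ)] with t h1 h2 ht
  rw [h1, h2 (by positivity), Real.mul_rpow hs.le ht.le, Real.rpow_add hs, ← Real.sqrt_eq_rpow,
    show -(rightPoint z * t) = -(z.re * t : ℝ) * Complex.I + ((-(z.im * t) : ℝ) : ℂ) by
      simp only [rightPoint]; push_cast; ring, Complex.exp_add, ← Complex.ofReal_exp]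
  push_cast
  ring

/-- Matrix coefficients of the vectors `powerExp β`. -/
theorem inner_rep_powerExp (z w : ℍ) {a b : ℝ} (ha : 0 < a) (hb : 0 < b) :
    inner ℂ (rep z (powerExp a ha)) (rep w (powerExp b hb)) =
      (2 * Real.pi : ℂ)⁻¹ * ((z.im ^ (1 / 2 + a) : ℝ) : ℂ) * ((w.im ^ (1 / 2 + b) : ℝ) : ℂ) *
        ((Real.Gamma (a + b + 1) : ℂ) *
          ((starRingEnd ℂ) (rightPoint z) + rightPoint w) ^ (-(a + b + 1) : ℂ)) := by
  have hp : 0 < ((starRingEnd ℂ) (rightPoint z) + rightPoint w).re := by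
    simp; have := z.im_pos; have := w.im_pos; positivity
  have h := integral_rpow_mul_cexp (a := a + b) (by linarith) hp
  rw [inner_eq_integral, mul_assoc, mul_assoc]
  congr 1
  push_cast at h
  rw [← h, ← integral_const_mul, ← integral_const_mul]
  refine setIntegral_congr_ae measurableSet_Ioi ?_
  filter_upwards [fourierL2_rep_powerExp z ha, fourierL2_rep_powerExp w hb] with t h1 h2 ht
  rw [h1 ht, h2 ht, add_mul, neg_add, Complex.exp_add, Real.rpow_add ht]
  simp only [map_mul, Complex.conj_ofReal, ← Complex.exp_conj, map_neg]
  push_cast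
  ring

/-! ### The matrix coefficients of the wavelets -/

/-- Sesquilinearity of the inner product, stated for `H2` so that it can be used for rewriting. -/
theorem H2_inner_sum_right {ι : Type*} (s : Finset ι) (f : H2) (g : ι → H2) :
    inner ℂ f (∑ i ∈ s, g i) = ∑ i ∈ s, inner ℂ f (g i) := inner_sum s g f

theorem H2_inner_sum_left {ι : Type*} (s : Finset ι) (f : H2) (g : ι → H2) :
    inner ℂ (∑ i ∈ s, g i) f = ∑ i ∈ s, inner ℂ (g i) f := sum_inner s g f

theorem H2_inner_smul_right (f g : H2) (c : ℂ) : inner ℂ f (c • g) = c * inner ℂ f g :=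
  inner_smul_right f g c

theorem H2_inner_smul_left (f g : H2) (c : ℂ) :
    inner ℂ (c • f) g = (starRingEnd ℂ) c * inner ℂ f g := inner_smul_left f g c

theorem H2_inner_conj_symm (f g : H2) : (starRingEnd ℂ) (inner ℂ f g) = inner ℂ g f :=
  inner_conj_symm g f

/-- The normalizing constant of `ψ_n^α`. -/
noncomputable def waveletNorm (n : ℕ) (α : ℝ) : ℝ :=
  Real.sqrt (2 ^ (α + 2) * Real.pi * (n.factorial : ℝ) / Real.Gamma (n + α + 1))

theorem waveletNorm_sq (n : ℕ) {α : ℝ} (hα : 0 < α) : waveletNorm n α ^ 2 =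
    2 ^ (α + 2) * Real.pi * (n.factorial : ℝ) / Real.Gamma (n + α + 1) :=
  Real.sq_sqrt (div_nonneg (by positivity) (Real.Gamma_pos_of_pos (by positivity)).le)

theorem waveletHat_of_pos (n : ℕ) (α : ℝ) {t : ℝ} (ht : 0 < t) : waveletHat n α t =
    ∑ k ∈ Finset.range (n + 1), waveletNorm n α * (laguerreCoeff n α k * 2 ^ k) *
      (t ^ (α / 2 + k) * Real.exp (-t)) := by
  simp only [waveletHat, if_pos ht, laguerre, Finset.mul_sum, waveletNorm, laguerreCoeff]
  refine Finset.sum_congr rfl fun k _ => ?_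
  rw [Real.rpow_add ht, Real.rpow_natCast, mul_pow]
  ring

theorem wavelet_eq_sum (n : ℕ) {α : ℝ} (hα : 0 < α) : wavelet n α hα =
    ∑ k ∈ Finset.range (n + 1), ((waveletNorm n α * (laguerreCoeff n α k * 2 ^ k) : ℝ) : ℂ) •
      powerExp (α / 2 + k) (by positivity) := by
  refine H2_ext ?_
  rw [Submodule.coe_sum]
  have h1 : ∀ᵐ t : ℝ, ∀ k : ℕ, 0 < t → fourierL2 (powerExp (α / 2 + k) (by positivity) : H2) t =
      ((t ^ (α / 2 + k) * Real.exp (-t) : ℝ) : ℂ) :=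
    ae_all_iff.2 fun k => fourierL2_powerExp _
  have h2 : ∀ᵐ t : ℝ, ∀ k : ℕ,
      fourierL2 ((((waveletNorm n α * (laguerreCoeff n α k * 2 ^ k) : ℝ) : ℂ) •
        powerExp (α / 2 + k) (by positivity) : H2) : L2R) t =
      ((waveletNorm n α * (laguerreCoeff n α k * 2 ^ k) : ℝ) : ℂ) *
        fourierL2 (powerExp (α / 2 + k) (by positivity) : H2) t :=
    ae_all_iff.2 fun k => fourierL2_smul _ _
  filter_upwards [fourierL2_waveletL2 n α hα, fourierL2_sum (Finset.range (n + 1)) fun k =>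
    ((((waveletNorm n α * (laguerreCoeff n α k * 2 ^ k) : ℝ) : ℂ) •
        powerExp (α / 2 + k) (by positivity) : H2) : L2R), h1, h2] with t e1 e2 e3 e4 ht
  rw [e2]
  refine e1.trans ?_
  rw [waveletHat_of_pos n α ht, Complex.ofReal_sum]
  refine Finset.sum_congr rfl fun k _ => ?_
  rw [e4, e3 _ ht]
  push_cast; rfl

theorem cpow_neg_add_natCast {q : ℂ} (hq : q ≠ 0) (a : ℂ) (k : ℕ) :
    q ^ (-(a + k + 1)) = q ^ (-(a + 1)) / q ^ k := by
  rw [show -(a + k + 1) = -(a + 1) - k by ring, Complex.cpow_sub _ _ hq, Complex.cpow_natCast]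

/-- The coefficient of `π(z) ψ_n^α` along `π(w) (powerExp (α / 2))`. The exponent `α / 2` is chosen
so that the sum over the Laguerre coefficients collapses to an `n`-th power. -/
theorem inner_rep_powerExp_rep_wavelet (n : ℕ) {α : ℝ} (hα : 0 < α) (w z : ℍ) :
    inner ℂ (rep w (powerExp (α / 2) (by positivity))) (rep z (wavelet n α hα)) =
      ((2 * Real.pi)⁻¹ * waveletNorm n α * (Real.Gamma (n + α + 1) / n.factorial) *
        w.im ^ ((1 + α) / 2) * z.im ^ ((1 + α) / 2) : ℝ) *
      (((starRingEnd ℂ) (rightPoint w) + rightPoint z) ^ (-(α + 1) : ℂ) *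
        (1 - 2 * z.im / ((starRingEnd ℂ) (rightPoint w) + rightPoint z)) ^ n) := by
  set q := (starRingEnd ℂ) (rightPoint w) + rightPoint z with hq
  have hq0 : q ≠ 0 := by
    intro h
    have h2 := congrArg Complex.re h
    simp [hq] at h2
    have := z.im_pos; have := w.im_pos; linarith
  have h := sum_laguerreCoeff_zero n (α := α) (by linarith) (2 * z.im / q)
  rw [wavelet_eq_sum, map_sum]
  simp only [map_smul]
  rw [H2_inner_sum_right]
  simp only [H2_inner_smul_right, inner_rep_powerExp, ← hq]
  push_cast at h ⊢
  have e : ∀ c : ℂ, c * (q ^ (-(α + 1) : ℂ) * (1 - 2 * z.im / q) ^ n) =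
    c * q ^ (-(α + 1) : ℂ) * (1 - 2 * z.im / q) ^ n := fun c => by ring
  rw [e]
  have e2 : ((2 * Real.pi : ℂ)⁻¹ * waveletNorm n α * (Real.Gamma (n + α + 1) / n.factorial) *
        ((w.im ^ ((1 + α) / 2) : ℝ) : ℂ) * ((z.im ^ ((1 + α) / 2) : ℝ) : ℂ) * q ^ (-(α + 1) : ℂ) *
          (1 - 2 * z.im / q) ^ n) = ((2 * Real.pi : ℂ)⁻¹ * waveletNorm n α *
        ((w.im ^ ((1 + α) / 2) : ℝ) : ℂ) * ((z.im ^ ((1 + α) / 2) : ℝ) : ℂ) * q ^ (-(α + 1) : ℂ)) *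
         ((Real.Gamma (n + α + 1) / n.factorial) * (1 - 2 * z.im / q) ^ n) := by ring
  rw [e2, ← h, Finset.mul_sum]
  refine Finset.sum_congr rfl fun k _ => ?_
  rw [show α / 2 + (α / 2 + k) + 1 = α + k + 1 by ring,
    show (α : ℂ) / 2 + (α / 2 + k) + 1 = α + k + 1 by ring, cpow_neg_add_natCast hq0,
    show 1 / 2 + α / 2 = (1 + α) / 2 by ring, show 1 / 2 + (α / 2 + k) = (1 + α) / 2 + k by ring,
    Real.rpow_add z.im_pos, Real.rpow_natCast]
  push_cast
  ring

/-- The wavelet transform of `ψ_n^α` with respect to itself as a double sum. -/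
theorem waveletTransform_wavelet_eq_sum (n : ℕ) {α : ℝ} (hα : 0 < α) (z : ℍ) :
    waveletTransform (wavelet n α hα) (wavelet n α hα) z =
      ((2 * Real.pi)⁻¹ * waveletNorm n α ^ 2 * z.im ^ ((1 + α) / 2) : ℝ) *
      ((starRingEnd ℂ) (rightPoint z) + 1) ^ (-(α + 1) : ℂ) *
      ∑ j ∈ Finset.range (n + 1), ∑ k ∈ Finset.range (n + 1),
      (laguerreCoeff n α j : ℂ) * laguerreCoeff n α k * Real.Gamma (α + j + k + 1) *
        (2 * z.im / ((starRingEnd ℂ) (rightPoint z) + 1)) ^ j *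
          (2 / ((starRingEnd ℂ) (rightPoint z) + 1)) ^ k := by
  set p := (starRingEnd ℂ) (rightPoint z) + 1 with hp
  have hp0 : p ≠ 0 := by
    intro h
    have h2 := congrArg Complex.re h
    simp [hp] at h2
    have := z.im_pos; linarith
  have h1 : waveletTransform (wavelet n α hα) (wavelet n α hα) z =
    inner ℂ (rep z (wavelet n α hα)) (rep UpperHalfPlane.I (wavelet n α hα)) := by rw [rep_I]; rfl
  rw [h1, wavelet_eq_sum, map_sum, map_sum, H2_inner_sum_left, Finset.mul_sum]
  refine Finset.sum_congr rfl fun j _ => ?_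
  rw [H2_inner_sum_right, Finset.mul_sum]
  refine Finset.sum_congr rfl fun k _ => ?_
  simp only [map_smul]
  rw [H2_inner_smul_right, H2_inner_smul_left,
    inner_rep_powerExp, rightPoint_I, ← hp]
  have e3 : (-((α / 2 + j : ℝ) + (α / 2 + k : ℝ) + 1) : ℂ) = -(α + (j + k : ℕ) + 1) := by
    push_cast; ring
  rw [e3, cpow_neg_add_natCast hp0, show α / 2 + j + (α / 2 + k) + 1 = α + j + k + 1 by ring,
    show 1 / 2 + (α / 2 + j) = (1 + α) / 2 + j by ring,
    Real.rpow_add z.im_pos, Real.rpow_natCast]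
  simp only [UpperHalfPlane.I_im, Real.one_rpow, Complex.conj_ofReal]
  push_cast
  rw [pow_add]
  ring

/-! ### Integration over the upper half-plane and the disk -/

theorem integral_upperHalfPlane {E : Type*} [NormedAddCommGroup E] [NormedSpace ℝ E] (g : ℂ → E) :
    ∫ z : ℍ, g z = ∫ w in {w : ℂ | 0 < w.im}, ((w.im ^ 2)⁻¹ : ℝ) • g w := by
  have hm : Measurable fun z : ℍ => ((1 / NNReal.mk z.im z.im_pos.le : NNReal) ^ 2) := by
    refine Measurable.pow_const (Measurable.const_div ?_ _) _
    exact measurable_im.subtype_mk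
  rw [UpperHalfPlane.volume_def, integral_withDensity_eq_integral_smul hm]
  have h := UpperHalfPlane.measurableEmbedding_coe.integral_map
    (μ := volume.comap UpperHalfPlane.coe)
    (fun w : ℂ => ((w.im ^ 2)⁻¹ : ℝ) • g w)
  rw [UpperHalfPlane.measurableEmbedding_coe.map_comap, UpperHalfPlane.range_coe] at h
  refine Eq.trans ?_ h.symm
  refine integral_congr_ae (.of_forall fun z => ?_)
  simp [NNReal.smul_def]

theorem integrable_upperHalfPlane_iff {E : Type*} [NormedAddCommGroup E] [NormedSpace ℝ E]
    (g : ℂ → E) : Integrable (fun z : ℍ => g z) ↔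
      IntegrableOn (fun w : ℂ => ((w.im ^ 2)⁻¹ : ℝ) • g w) {w : ℂ | 0 < w.im} := by
  have hm : Measurable fun z : ℍ => ((1 / NNReal.mk z.im z.im_pos.le : NNReal) ^ 2) := by
    refine Measurable.pow_const (Measurable.const_div ?_ _) _
    exact measurable_im.subtype_mk
  rw [UpperHalfPlane.volume_def, integrable_withDensity_iff_integrable_smul hm]
  have h := UpperHalfPlane.measurableEmbedding_coe.integrable_map_iff
    (μ := volume.comap UpperHalfPlane.coe) (g := fun w : ℂ => ((w.im ^ 2)⁻¹ : ℝ) • g w)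
  rw [UpperHalfPlane.measurableEmbedding_coe.map_comap, UpperHalfPlane.range_coe] at h
  refine Iff.trans ?_ h.symm
  refine integrable_congr (.of_forall fun z => ?_)
  simp [NNReal.smul_def]

/-- The Cayley transform of the upper half-plane onto the unit disk. -/
noncomputable def cayley (z : ℂ) : ℂ := (z - Complex.I) / (z + Complex.I)

/-- The inverse of the Cayley transform. -/
noncomputable def cayleyInv (w : ℂ) : ℂ := Complex.I * (1 + w) / (1 - w)

theorem mem_pseudoDisk_I {R : ℝ} {z : ℍ} :
    z ∈ pseudoDisk R UpperHalfPlane.I ↔ ‖cayley z‖ < R := by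
  have h1 : ‖(Complex.I : ℂ) - (starRingEnd ℂ) (z : ℂ)‖ = ‖(z : ℂ) + Complex.I‖ := by
    rw [← RCLike.norm_conj (Complex.I - (starRingEnd ℂ) (z : ℂ)), ← norm_neg]
    congr 1
    simp [add_comm]
  simp only [pseudoDisk, Set.mem_ofPred_eq, cayley, norm_div, UpperHalfPlane.coe_I]
  rw [h1, norm_sub_rev]

theorem one_sub_ne_zero_of_norm_lt {w : ℂ} (hw : ‖w‖ < 1) : 1 - w ≠ 0 := by
  intro h
  rw [← sub_eq_zero.1 h] at hw
  simp at hw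

theorem cayleyInv_im {w : ℂ} : (cayleyInv w).im = (1 - ‖w‖ ^ 2) / ‖1 - w‖ ^ 2 := by
  rw [cayleyInv, Complex.div_im, ← Complex.normSq_eq_norm_sq, ← Complex.normSq_eq_norm_sq]
  simp [Complex.normSq_apply]
  ring

theorem cayley_cayleyInv {w : ℂ} (hw : ‖w‖ < 1) : cayley (cayleyInv w) = w := by
  have h := one_sub_ne_zero_of_norm_lt hw
  have hI := Complex.I_ne_zero
  have h2 : cayleyInv w + Complex.I = 2 * Complex.I / (1 - w) := by
    rw [cayleyInv]; field_simp; ring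
  have h3 : cayleyInv w - Complex.I = 2 * Complex.I * w / (1 - w) := by
    rw [cayleyInv]; field_simp; ring
  rw [cayley, h2, h3]; field_simp

theorem add_I_ne_zero (z : ℍ) : (z : ℂ) + Complex.I ≠ 0 := by
  intro h
  have := congrArg Complex.im h
  simp at this
  have := z.im_pos; linarith

theorem cayleyInv_cayley (z : ℍ) : cayleyInv (cayley z) = z := by
  have h := add_I_ne_zero z
  have hI := Complex.I_ne_zero
  have h2 : 1 - cayley z = 2 * Complex.I / (z + Complex.I) := by
    rw [cayley]; field_simp; ring
  have h3 : 1 + cayley z = 2 * z / (z + Complex.I) := by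
    rw [cayley]; field_simp; ring
  rw [cayleyInv, h2, h3]; field_simp

/-- The image of the hyperbolic measure under the Cayley transform. -/
theorem setIntegral_pseudoDisk {R : ℝ} (hR : R < 1) (F : ℂ → ℂ) :
    ∫ z in pseudoDisk R UpperHalfPlane.I, F (cayley z) =
      ∫ w in Metric.ball (0 : ℂ) R, (4 / (1 - ‖w‖ ^ 2) ^ 2 : ℝ) • F w := by
  set T : Set ℂ := {w : ℂ | ‖cayley w‖ < R} with hT
  have hTm : MeasurableSet T := by
    refine measurableSet_lt (Measurable.norm ?_) measurable_const
    unfold cayley; fun_prop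
  have hpre : pseudoDisk R UpperHalfPlane.I = UpperHalfPlane.coe ⁻¹' T := by
    ext z; exact mem_pseudoDisk_I
  have himm : MeasurableSet {w : ℂ | 0 < w.im} := measurableSet_lt measurable_const (by fun_prop)
  rw [hpre, ← integral_indicator (UpperHalfPlane.measurable_coe hTm)]
  have h1 : (fun z : ℍ => (UpperHalfPlane.coe ⁻¹' T).indicator (fun z : ℍ => F (cayley z)) z) =
      fun z : ℍ => T.indicator (fun w => F (cayley w)) z := by
    ext z; simp only [Set.indicator, Set.mem_preimage]
  rw [h1, integral_upperHalfPlane]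
  have himage : cayleyInv '' Metric.ball (0 : ℂ) R = {w : ℂ | 0 < w.im} ∩ T := by
    ext z
    constructor
    · rintro ⟨w, hw, rfl⟩
      have hw' : ‖w‖ < R := by simpa using hw
      have h1 := one_sub_ne_zero_of_norm_lt (hw'.trans hR)
      refine ⟨?_, ?_⟩
      · change 0 < (cayleyInv w).im
        rw [cayleyInv_im]
        have : 0 < ‖1 - w‖ := norm_pos_iff.2 h1
        have : 0 < 1 - ‖w‖ ^ 2 := by nlinarith [norm_nonneg w]
        positivity
      · change ‖cayley (cayleyInv w)‖ < R
        rwa [cayley_cayleyInv (hw'.trans hR)]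
    · rintro ⟨hz, hzT⟩
      have h0 := cayleyInv_cayley ⟨z, hz⟩
      exact ⟨cayley z, mem_ball_zero_iff.2 hzT, h0⟩
  have h2 : ∀ w : ℂ, ((w.im ^ 2)⁻¹ : ℝ) • T.indicator (fun w => F (cayley w)) w =
      T.indicator (fun w => ((w.im ^ 2)⁻¹ : ℝ) • F (cayley w)) w := by
    intro w
    by_cases h : w ∈ T <;> simp [h]
  simp_rw [h2]
  rw [setIntegral_indicator hTm, ← himage]
  have hder : ∀ w ∈ Metric.ball (0 : ℂ) R, HasFDerivWithinAt cayleyInv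
      (((ContinuousLinearMap.toSpanSingleton ℂ (2 * Complex.I / (1 - w) ^ 2)).restrictScalars ℝ :
        ℂ →L[ℝ] ℂ)) (Metric.ball (0 : ℂ) R) w := by
    intro w hw
    have hw' : ‖w‖ < R := by simpa using hw
    have h1 := one_sub_ne_zero_of_norm_lt (hw'.trans hR)
    have hd : HasDerivAt cayleyInv (2 * Complex.I / (1 - w) ^ 2) w := by
      have := (((hasDerivAt_id w).const_add 1).const_mul Complex.I).div
        ((hasDerivAt_id w).const_sub 1) h1
      refine this.congr_deriv ?_
      simp; ring
    exact (hd.hasFDerivAt.restrictScalars ℝ).hasFDerivWithinAt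
  have hinj : Set.InjOn cayleyInv (Metric.ball (0 : ℂ) R) := by
    intro a ha b hb hab
    have ha' : ‖a‖ < 1 := lt_trans (by simpa using ha) hR
    have hb' : ‖b‖ < 1 := lt_trans (by simpa using hb) hR
    rw [← cayley_cayleyInv ha', hab, cayley_cayleyInv hb']
  rw [integral_image_eq_integral_abs_det_fderiv_smul volume measurableSet_ball hder hinj]
  refine setIntegral_congr_fun measurableSet_ball fun w hw => ?_
  have hw' : ‖w‖ < 1 := lt_trans (by simpa using hw) hR
  have h1 := one_sub_ne_zero_of_norm_lt hw'
  have hdet : ((ContinuousLinearMap.toSpanSingleton ℂ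
      (2 * Complex.I / (1 - w) ^ 2)).restrictScalars ℝ : ℂ →L[ℝ] ℂ).det = 4 / ‖1 - w‖ ^ 4 := by
    simp [ContinuousLinearMap.det, LinearMap.det_restrictScalars, Algebra.norm_complex_eq,
      Complex.normSq_eq_norm_sq, ← pow_mul]
    norm_num
  simp only [hdet, cayley_cayleyInv hw', cayleyInv_im, smul_smul]
  congr 1
  have : 0 < ‖1 - w‖ := norm_pos_iff.2 h1
  have : 0 < 1 - ‖w‖ ^ 2 := by nlinarith [norm_nonneg w]
  rw [abs_of_pos (by positivity)]
  field_simp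

theorem integral_ball_polar {R : ℝ} (hR : 0 < R) {G : ℂ → ℂ}
    (hG : ContinuousOn G (Metric.closedBall 0 R)) :
    ∫ w in Metric.ball (0 : ℂ) R, G w = ∫ r in (0 : ℝ)..R, (r : ℂ) *
      ∫ θ in (-Real.pi)..Real.pi, G (r * Complex.exp (θ * Complex.I)) := by
  have hπ := Real.pi_pos
  have hsymm : ∀ p : ℝ × ℝ, Complex.polarCoord.symm p = p.1 * Complex.exp (p.2 * Complex.I) := by
    intro p
    rw [Complex.polarCoord_symm_apply, Complex.exp_mul_I]; push_cast; rfl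
  rw [← integral_indicator measurableSet_ball, ← Complex.integral_comp_polarCoord_symm,
    polarCoord_target]
  have h1 : ∫ p in Set.Ioi (0 : ℝ) ×ˢ Set.Ioo (-Real.pi) Real.pi,
      p.1 • (Metric.ball (0 : ℂ) R).indicator G (Complex.polarCoord.symm p) =
      ∫ p in Set.Ioo (0 : ℝ) R ×ˢ Set.Ioo (-Real.pi) Real.pi,
        (p.1 : ℂ) * G (p.1 * Complex.exp (p.2 * Complex.I)) := by
    rw [← integral_indicator (measurableSet_Ioi.prod measurableSet_Ioo),
      ← integral_indicator (measurableSet_Ioo.prod measurableSet_Ioo)]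
    congr 1
    ext ⟨r, θ⟩
    by_cases hr : 0 < r
    · by_cases hrR : r < R
      · simp [Set.indicator, hsymm, hr, hrR, abs_of_pos hr]
      · simp [Set.indicator, hsymm, hr, hrR, abs_of_pos hr]
    · simp [Set.indicator, hr]
  rw [h1, Measure.volume_eq_prod, setIntegral_prod]
  · rw [intervalIntegral.integral_of_le hR.le, integral_Ioc_eq_integral_Ioo]
    refine setIntegral_congr_fun measurableSet_Ioo fun r _ => ?_
    simp only
    rw [integral_const_mul, intervalIntegral.integral_of_le (by linarith),
      integral_Ioc_eq_integral_Ioo]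
  · have hc : ContinuousOn (fun p : ℝ × ℝ => (p.1 : ℂ) * G (p.1 * Complex.exp (p.2 * Complex.I)))
        (Set.Icc 0 R ×ˢ Set.Icc (-Real.pi) Real.pi) := by
      refine ContinuousOn.mul (by fun_prop) (hG.comp (by fun_prop) ?_)
      rintro ⟨r, θ⟩ ⟨⟨h0, h1⟩, -⟩
      simp only at h0 h1
      simpa [abs_of_nonneg h0] using h1
    exact (hc.integrableOn_compact (isCompact_Icc.prod isCompact_Icc)).mono_set
      (Set.prod_mono Set.Ioo_subset_Icc_self Set.Ioo_subset_Icc_self)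

/-! ### Circle averages of binomial series -/

theorem choose_add_sub_one_eq {β : ℝ} (hβ : 0 < β) (k : ℕ) :
    Ring.choose ((β : ℂ) + k - 1) k =
      ((Real.Gamma (β + k) / (Real.Gamma β * k.factorial) : ℝ) : ℂ) := by
  have h1 : Ring.choose ((β : ℂ) + k - 1) k = Ring.multichoose (β : ℂ) k := by
    rw [Ring.choose]; congr 1; ring
  have h2 := Ring.factorial_nsmul_multichoose_eq_ascPochhammer (β : ℂ) k
  have h3 : (ascPochhammer ℕ k).smeval (β : ℂ) =
      ((Real.Gamma (β + k) / Real.Gamma β : ℝ) : ℂ) := by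
    have p := (Real.Gamma_pos_of_pos hβ).ne'
    rw [Polynomial.ascPochhammer_smeval_eq_eval]
    induction k with
    | zero => simp [p]
    | succ k ih =>
      rw [ascPochhammer_succ_eval, ih (by rw [Ring.choose]; congr 1; ring)
          (Ring.factorial_nsmul_multichoose_eq_ascPochhammer (β : ℂ) k),
        show β + ((k + 1 : ℕ) : ℝ) = β + k + 1 by push_cast; ring,
        Real.Gamma_add_one (by positivity)]
      push_cast; ring
  have hk : (k.factorial : ℂ) ≠ 0 := by exact_mod_cast Nat.factorial_ne_zero k
  have p : (Real.Gamma β : ℂ) ≠ 0 := by exact_mod_cast (Real.Gamma_pos_of_pos hβ).ne'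
  rw [h3, nsmul_eq_mul] at h2
  rw [h1]
  push_cast at h2 ⊢
  field_simp at h2 ⊢
  linear_combination h2

/-- The binomial series with coefficients written as Gamma quotients. -/
theorem hasSum_one_sub_cpow {β : ℝ} (hβ : 0 < β) {u : ℂ} (hu : ‖u‖ < 1) :
    HasSum (fun k : ℕ => ((Real.Gamma (β + k) / (Real.Gamma β * k.factorial) : ℝ) : ℂ) * u ^ k)
      ((1 - u) ^ (-β : ℂ)) := by
  have h := (Complex.one_div_one_sub_cpow_hasFPowerSeriesOnBall_zero (β : ℂ)).hasSum (y := u)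
    (by
      rw [Metric.mem_eball, edist_zero_right, ← ofReal_norm]
      exact ENNReal.ofReal_lt_one.2 hu)
  rw [zero_add, one_div, ← Complex.cpow_neg] at h
  simpa only [FormalMultilinearSeries.ofScalars_apply_eq, choose_add_sub_one_eq hβ,
    smul_eq_mul] using h

theorem integral_exp_int_mul (m : ℤ) :
    ∫ θ in (-Real.pi)..Real.pi, Complex.exp (m * (θ * Complex.I)) =
      if m = 0 then (2 * Real.pi : ℂ) else 0 := by
  split_ifs with h
  · subst h; simp; ring
  · have hc : (m : ℂ) * Complex.I ≠ 0 := mul_ne_zero (by exact_mod_cast h) Complex.I_ne_zero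
    have h2 : ∀ θ : ℝ, Complex.exp (m * (θ * Complex.I)) = Complex.exp (m * Complex.I * θ) := by
      intro θ; congr 1; ring
    simp_rw [h2]
    rw [integral_exp_mul_complex hc, div_eq_zero_iff, sub_eq_zero]
    left
    rw [Complex.exp_eq_exp_iff_exists_int]
    exact ⟨m, by push_cast; ring⟩

/-- Averaging over a circle picks out one coefficient of the binomial series: in
`ζ ^ j (1 - ω ζ̄) ^ (-β)` only the term `ζ ^ j ζ̄ ^ j` has a nonzero mean. -/
theorem integral_circle_pow_mul_cpow {β : ℝ} (hβ : 0 < β) (j : ℕ) {r : ℝ} (hr : 0 ≤ r)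
    (hr1 : r < 1) {ω : ℂ} (hω : ‖ω‖ < 1) :
    ∫ θ in (-Real.pi)..Real.pi, (r * Complex.exp (θ * Complex.I)) ^ j *
        (1 - ω * (starRingEnd ℂ) (r * Complex.exp (θ * Complex.I))) ^ (-β : ℂ) =
      2 * Real.pi * (ω ^ j * r ^ (2 * j) *
        (Real.Gamma (β + j) / (Real.Gamma β * j.factorial) : ℝ)) := by
  set c : ℕ → ℂ := fun k => ((Real.Gamma (β + k) / (Real.Gamma β * k.factorial) : ℝ) : ℂ) with hc
  have hωr : ‖ω * r‖ < 1 := by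
    rw [norm_mul, Complex.norm_real, Real.norm_of_nonneg hr]
    nlinarith [norm_nonneg ω]
  let f : ℕ → C(ℝ, ℂ) := fun k =>
    ⟨fun θ => c k * (ω * r) ^ k * (r : ℂ) ^ j * Complex.exp (((j : ℤ) - k : ℤ) * (θ * Complex.I)),
      by fun_prop⟩
  have hfs : Summable fun k => ‖(f k).restrict
      (⟨Set.uIcc (-Real.pi) Real.pi, isCompact_uIcc⟩ : TopologicalSpace.Compacts ℝ)‖ := by
    have hs := ((hasSum_one_sub_cpow hβ hωr).summable.norm).mul_right (‖(r : ℂ) ^ j‖)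
    refine Summable.of_nonneg_of_le (fun _ => norm_nonneg _) (fun k => ?_) hs
    refine (ContinuousMap.norm_le _ (by positivity)).2 fun θ => ?_
    have he : ‖Complex.exp (((j : ℤ) - k : ℤ) * ((θ : ℝ) * Complex.I))‖ = 1 := by
      have : (((j : ℤ) - k : ℤ) * ((θ : ℝ) * Complex.I) : ℂ) =
        ((((j : ℤ) - k : ℤ) * (θ : ℝ) : ℝ) : ℂ) * Complex.I := by push_cast; ring
      rw [this, Complex.norm_exp_ofReal_mul_I]
    change ‖c k * (ω * r) ^ k * (r : ℂ) ^ j *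
      Complex.exp (((j : ℤ) - k : ℤ) * ((θ : ℝ) * Complex.I))‖ ≤ _
    rw [norm_mul, he, mul_one, norm_mul]
  have h1 := intervalIntegral.hasSum_intervalIntegral_of_summable_norm hfs
  have h2 : ∀ θ : ℝ, ∑' k, f k θ = (r * Complex.exp (θ * Complex.I)) ^ j *
        (1 - ω * (starRingEnd ℂ) (r * Complex.exp (θ * Complex.I))) ^ (-β : ℂ) := by
    intro θ
    have hn : ‖ω * (starRingEnd ℂ) (r * Complex.exp (θ * Complex.I))‖ < 1 := by
      rw [norm_mul, RCLike.norm_conj, norm_mul, Complex.norm_exp_ofReal_mul_I, mul_one,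
        ← norm_mul]
      exact hωr
    have h3 := (hasSum_one_sub_cpow hβ hn).mul_left ((r * Complex.exp (θ * Complex.I)) ^ j)
    rw [← h3.tsum_eq]
    refine tsum_congr fun k => ?_
    change c k * (ω * r) ^ k * (r : ℂ) ^ j * Complex.exp (((j : ℤ) - k : ℤ) * (θ * Complex.I)) = _
    have he : Complex.exp (((j : ℤ) - k : ℤ) * (θ * Complex.I)) =
        Complex.exp (θ * Complex.I) ^ j * Complex.exp (-(θ * Complex.I)) ^ k := by
      rw [← Complex.exp_nat_mul, ← Complex.exp_nat_mul, ← Complex.exp_add]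
      congr 1; push_cast; ring
    rw [he, map_mul, ← Complex.exp_conj, map_mul, Complex.conj_ofReal, Complex.conj_ofReal,
      Complex.conj_I, mul_neg, mul_pow, mul_pow, mul_pow, mul_pow]
    ring
  simp_rw [← h2]
  rw [← h1.tsum_eq, tsum_eq_single j]
  · change ∫ θ in (-Real.pi)..Real.pi, c j * (ω * r) ^ j * (r : ℂ) ^ j *
      Complex.exp (((j : ℤ) - j : ℤ) * (θ * Complex.I)) = _
    rw [intervalIntegral.integral_const_mul, integral_exp_int_mul, if_pos (by ring)]
    rw [mul_pow]; ring
  · intro k hk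
    change ∫ θ in (-Real.pi)..Real.pi, c k * (ω * r) ^ k * (r : ℂ) ^ j *
      Complex.exp (((j : ℤ) - k : ℤ) * (θ * Complex.I)) = _
    rw [intervalIntegral.integral_const_mul, integral_exp_int_mul, if_neg (by omega), mul_zero]

/-- The circle average of `(ω - ζ) ^ n (1 - ω ζ̄) ^ (-(n + α + 1))` is `ω ^ n` times a Jacobi
polynomial: only the term of `ζ`-degree equal to the `ζ̄`-degree survives. -/
theorem integral_circle_eq_jacobi (n : ℕ) {α : ℝ} (hα : 0 < α) {r : ℝ} (hr : 0 ≤ r)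
    (hr1 : r < 1) {ω : ℂ} (hω : ‖ω‖ < 1) :
    ∫ θ in (-Real.pi)..Real.pi, (ω - r * Complex.exp (θ * Complex.I)) ^ n *
        (1 - ω * (starRingEnd ℂ) (r * Complex.exp (θ * Complex.I))) ^ (-(n + α + 1) : ℂ) =
      2 * Real.pi * ω ^ n * (jacobi n 0 α (1 - 2 * r ^ 2) : ℂ) := by
  have hβ : 0 < (n : ℝ) + α + 1 := by positivity
  have hβ' : (-(n + α + 1) : ℂ) = -(((n : ℝ) + α + 1 : ℝ) : ℂ) := by push_cast; ring
  have hcont : ∀ j : ℕ, Continuous fun θ : ℝ => (r * Complex.exp (θ * Complex.I)) ^ j *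
        (1 - ω * (starRingEnd ℂ) (r * Complex.exp (θ * Complex.I))) ^ (-(n + α + 1) : ℂ) := by
    intro j
    refine Continuous.mul (by fun_prop) (Continuous.cpow ?_ continuous_const fun θ => ?_)
    · exact continuous_const.sub (continuous_const.mul (Complex.continuous_conj.comp (by fun_prop)))
    · refine Or.inl ?_
      have hn : ‖ω * (starRingEnd ℂ) (r * Complex.exp (θ * Complex.I))‖ < 1 := by
        rw [norm_mul, RCLike.norm_conj, norm_mul, Complex.norm_exp_ofReal_mul_I, mul_one,
          Complex.norm_real, Real.norm_of_nonneg hr]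
        nlinarith [norm_nonneg ω]
      have := (Complex.abs_re_le_norm _).trans_lt hn
      rw [Complex.sub_re, Complex.one_re]
      linarith [(abs_lt.1 this).2]
  have h1 : ∀ θ : ℝ, (ω - r * Complex.exp (θ * Complex.I)) ^ n *
        (1 - ω * (starRingEnd ℂ) (r * Complex.exp (θ * Complex.I))) ^ (-(n + α + 1) : ℂ) =
      ∑ j ∈ Finset.range (n + 1), ((-1) ^ j * ω ^ (n - j) * n.choose j) *
        ((r * Complex.exp (θ * Complex.I)) ^ j *
        (1 - ω * (starRingEnd ℂ) (r * Complex.exp (θ * Complex.I))) ^ (-(n + α + 1) : ℂ)) := by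
    intro θ
    rw [sub_eq_neg_add, add_pow, Finset.sum_mul]
    refine Finset.sum_congr rfl fun j _ => ?_
    rw [neg_pow]; ring
  simp_rw [h1]
  rw [intervalIntegral.integral_finsetSum fun j _ =>
    ((hcont j).const_mul _).intervalIntegrable _ _, jacobi_zero_left n (by linarith),
    Complex.ofReal_sum, Finset.mul_sum]
  refine Finset.sum_congr rfl fun j hj => ?_
  rw [intervalIntegral.integral_const_mul, hβ', integral_circle_pow_mul_cpow hβ j hr hr1 hω]
  have : ω ^ n = ω ^ (n - j) * ω ^ j := by
    rw [← pow_add]; congr 1; simp at hj; omega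
  rw [this, neg_pow (r ^ 2) j, ← pow_mul, show (n : ℝ) + α + 1 + j = n + α + j + 1 by ring]
  push_cast
  ring

/-- The localization constant: the radial weight is integrated against the circle averages of the
kernel, each of which contributes the same factor `ω ^ n`. -/
theorem setIntegral_pseudoDisk_jacobi (n : ℕ) {α R : ℝ} (hα : 0 < α) (hR₀ : 0 < R) (hR₁ : R < 1)
    {ω : ℂ} (hω : ‖ω‖ < 1) :
    ∫ z in pseudoDisk R UpperHalfPlane.I, ((((1 - ‖cayley z‖ ^ 2) ^ (α + 1) *
        jacobi n 0 α (1 - 2 * ‖cayley z‖ ^ 2) : ℝ) : ℂ) * ((ω - cayley z) ^ n *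
        (1 - ω * (starRingEnd ℂ) (cayley z)) ^ (-(n + α + 1) : ℂ))) =
      (localConst n α R : ℂ) * ω ^ n := by
  rw [setIntegral_pseudoDisk hR₁ fun w => ((((1 - ‖w‖ ^ 2) ^ (α + 1) *
        jacobi n 0 α (1 - 2 * ‖w‖ ^ 2) : ℝ) : ℂ) * ((ω - w) ^ n *
        (1 - ω * (starRingEnd ℂ) w) ^ (-(n + α + 1) : ℂ)))]
  have hjc : Continuous (jacobi n 0 α) := by unfold jacobi; fun_prop
  rw [integral_ball_polar hR₀]
  · have h1 : ∀ r ∈ Set.uIcc 0 R, ((r : ℂ) * ∫ θ in (-Real.pi)..Real.pi,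
        (4 / (1 - ‖(r : ℂ) * Complex.exp (θ * Complex.I)‖ ^ 2) ^ 2 : ℝ) •
        ((((1 - ‖(r : ℂ) * Complex.exp (θ * Complex.I)‖ ^ 2) ^ (α + 1) *
        jacobi n 0 α (1 - 2 * ‖(r : ℂ) * Complex.exp (θ * Complex.I)‖ ^ 2) : ℝ) : ℂ) *
        ((ω - r * Complex.exp (θ * Complex.I)) ^ n *
        (1 - ω * (starRingEnd ℂ) (r * Complex.exp (θ * Complex.I))) ^ (-(n + α + 1) : ℂ)))) =
        ω ^ n * ((4 * Real.pi * ((1 - r ^ 2) ^ (α - 1) * jacobi n 0 α (1 - 2 * r ^ 2) ^ 2 *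
          (2 * r)) : ℝ) : ℂ) := by
      intro r hr
      rw [Set.uIcc_of_le hR₀.le] at hr
      have hr1 : r < 1 := hr.2.trans_lt hR₁
      have hnorm : ∀ θ : ℝ, ‖(r : ℂ) * Complex.exp (θ * Complex.I)‖ = r := by
        intro θ
        rw [norm_mul, Complex.norm_exp_ofReal_mul_I, mul_one, Complex.norm_real,
          Real.norm_of_nonneg hr.1]
      simp only [hnorm]
      rw [intervalIntegral.integral_smul, intervalIntegral.integral_const_mul,
        integral_circle_eq_jacobi n hα hr.1 hr1 hω, Complex.real_smul]
      have hp : 0 < 1 - r ^ 2 := by nlinarith [hr.1]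
      have hpow : (1 - r ^ 2) ^ (α + 1) = (1 - r ^ 2) ^ (α - 1) * (1 - r ^ 2) ^ 2 := by
        rw [← Real.rpow_natCast (1 - r ^ 2) 2, ← Real.rpow_add hp]; congr 1; push_cast; ring
      have hp' : (1 - (r : ℂ) ^ 2) ≠ 0 := by exact_mod_cast hp.ne'
      rw [hpow]
      push_cast
      field_simp
    rw [intervalIntegral.integral_congr h1, intervalIntegral.integral_const_mul, mul_comm (_ ^ n)]
    congr 1
    rw [intervalIntegral.integral_ofReal, intervalIntegral.integral_const_mul, localConst]
    congr 2
    have hc : ContinuousOn (fun u : ℝ => (1 - u) ^ (α - 1) * jacobi n 0 α (1 - 2 * u) ^ 2)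
        ((fun r : ℝ => r ^ 2) '' Set.uIcc 0 R) := by
      refine ContinuousOn.mul (ContinuousOn.rpow_const (by fun_prop) ?_)
        (Continuous.continuousOn (by fun_prop))
      rintro _ ⟨r, hr, rfl⟩
      rw [Set.uIcc_of_le hR₀.le] at hr
      have := hr.2.trans_lt hR₁
      left; simp only; nlinarith [hr.1]
    have := intervalIntegral.integral_comp_mul_deriv' (a := 0) (b := R) (f := fun r : ℝ => r ^ 2)
      (f' := fun r => 2 * r) (g := fun u : ℝ => (1 - u) ^ (α - 1) * jacobi n 0 α (1 - 2 * u) ^ 2)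
      (fun r _ => by simpa using hasDerivAt_pow 2 r) (by fun_prop) hc
    simpa using this
  · have hb : ∀ w ∈ Metric.closedBall (0 : ℂ) R, 0 < 1 - ‖w‖ ^ 2 := by
      intro w hw
      have : ‖w‖ ≤ R := by simpa using hw
      nlinarith [norm_nonneg w]
    refine ContinuousOn.smul (ContinuousOn.div (by fun_prop) (by fun_prop) fun w hw =>
      pow_ne_zero _ (hb w hw).ne') (ContinuousOn.mul ?_ (ContinuousOn.mul (by fun_prop) ?_))
    · refine Complex.continuous_ofReal.comp_continuousOn (ContinuousOn.mul
        (ContinuousOn.rpow_const (by fun_prop) fun w hw => Or.inl (hb w hw).ne')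
        (Continuous.continuousOn (by fun_prop)))
    · refine ContinuousOn.cpow (Continuous.continuousOn ?_) continuousOn_const fun w hw => ?_
      · exact continuous_const.sub (continuous_const.mul Complex.continuous_conj)
      · have hw' : ‖w‖ ≤ R := by simpa using hw
        refine Or.inl ?_
        have hn : ‖ω * (starRingEnd ℂ) w‖ < 1 := by
          rw [norm_mul, RCLike.norm_conj]
          nlinarith [norm_nonneg ω, norm_nonneg w]
        have := (Complex.abs_re_le_norm _).trans_lt hn
        rw [Complex.sub_re, Complex.one_re]
        linarith [(abs_lt.1 this).2]

/-! ### Totality of the orbit of `powerExp β` -/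

theorem isClosed_H2 : IsClosed (H2 : Set L2R) := by
  refine IsSeqClosed.isClosed fun f g hf hfg => ?_
  have h1 : Filter.Tendsto (fun k => (𝓕 (f k) : L2R)) Filter.atTop (nhds (𝓕 g : L2R)) :=
    ((Lp.fourierTransformₗᵢ ℝ ℂ).continuous.tendsto g).comp hfg
  have h2 := (tendstoInMeasure_of_tendsto_Lp h1).exists_seq_tendsto_ae
  obtain ⟨ns, -, h3⟩ := h2
  have h4 : ∀ᵐ ξ : ℝ, ∀ k, ξ < 0 → fourierL2 (f k) ξ = 0 := ae_all_iff.2 fun k => hf k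
  change ∀ᵐ ξ : ℝ, ξ < 0 → fourierL2 g ξ = 0
  filter_upwards [quasi_div.ae h3, h4] with ξ h5 h6 hξ
  refine tendsto_nhds_unique h5 ?_
  have : (fun i => (𝓕 (f (ns i)) : L2R) (ξ / (2 * Real.pi))) = fun _ => 0 :=
    funext fun i => h6 (ns i) hξ
  rw [this]
  exact tendsto_const_nhds

instance completeSpace_H2 : CompleteSpace H2 := isClosed_H2.completeSpace_coe

/-- A vector orthogonal to the orbit of `powerExp β` vanishes, by uniqueness for the Fourier
transform on `L¹(ℝ)`. -/
theorem eq_zero_of_inner_rep_powerExp {β : ℝ} (hβ : 0 < β) {g : H2}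
    (h : ∀ w : ℍ, inner ℂ (rep w (powerExp β hβ)) g = 0) : g = 0 := by
  set G : ℝ → ℂ := fun t => ((Set.indicator (Set.Ioi (0 : ℝ)) (fun t => t ^ β * Real.exp (-t)) t
    : ℝ) : ℂ) * fourierL2 (g : L2R) t with hG
  have hGi : Integrable G := (memLp_monomial hβ).ofReal.integrable_mul (memLp_fourierL2 g)
  have hF : 𝓕 G = 0 := by
    ext ξ
    -- the matrix coefficients at height `1` are the values of the Fourier transform of `G`
    let w : ℍ := ⟨⟨-(2 * Real.pi * ξ), 1⟩, one_pos⟩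
    have hre : w.re = -(2 * Real.pi * ξ) := rfl
    have him : w.im = 1 := rfl
    have h1 := h w
    rw [inner_eq_integral, mul_eq_zero] at h1
    have h2 := h1.resolve_left (by simp [Real.pi_ne_zero])
    rw [Real.fourier_real_eq_integral_exp_smul, Pi.zero_apply, ← h2,
      ← integral_indicator measurableSet_Ioi]
    refine integral_congr_ae ?_
    filter_upwards [fourierL2_rep_powerExp w hβ] with t ht
    by_cases h0 : 0 < t
    · rw [Set.indicator_of_mem (show t ∈ Set.Ioi (0 : ℝ) from h0), ht h0, hG]
      simp only [Set.indicator_of_mem (show t ∈ Set.Ioi (0 : ℝ) from h0), him, Real.one_rpow,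
        Complex.ofReal_one, one_mul, map_mul, Complex.conj_ofReal, ← Complex.exp_conj, map_neg]
      have : -((starRingEnd ℂ) (rightPoint w) * t) =
          ((-2 * Real.pi * t * ξ : ℝ) : ℂ) * Complex.I + ((-t : ℝ) : ℂ) := by
        rw [rightPoint, hre, him]; simp [map_ofNat]; ring
      rw [this, Complex.exp_add, ← Complex.ofReal_exp, smul_eq_mul]
      push_cast; ring
    · have h0' : t ∉ Set.Ioi (0 : ℝ) := h0
      simp [hG, Set.indicator_of_notMem h0']
  have h3 := ae_eq_zero_of_fourier_eq_zero hGi hF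
  refine H2_ext ?_
  filter_upwards [h3, fourierL2_zero] with t h4 h5 ht
  rw [Submodule.coe_zero, h5]
  simp only [hG, Set.indicator_of_mem (show t ∈ Set.Ioi (0 : ℝ) from ht)] at h4
  refine (mul_eq_zero.1 h4).resolve_left ?_
  exact_mod_cast (mul_pos (Real.rpow_pos_of_pos ht β) (Real.exp_pos _)).ne'

theorem dense_span_rep_powerExp {β : ℝ} (hβ : 0 < β) :
    Dense (Submodule.span ℂ (Set.range fun w : ℍ => rep w (powerExp β hβ)) : Set H2) := by
  rw [Submodule.dense_iff_topologicalClosure_eq_top, Submodule.topologicalClosure_eq_top_iff,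
    Submodule.eq_bot_iff]
  intro g hg
  refine eq_zero_of_inner_rep_powerExp hβ fun w => ?_
  exact (Submodule.mem_orthogonal _ _).1 hg _ (Submodule.subset_span ⟨w, rfl⟩)

/-! ### The matrix coefficients in the disk model -/

/-- The point `1 + s - i x = -i (z + i)`. -/
noncomputable def denomPoint (z : ℍ) : ℂ := (starRingEnd ℂ) (rightPoint z) + 1

theorem denomPoint_eq (z : ℍ) : denomPoint z = -Complex.I * (z + Complex.I) := by
  apply Complex.ext <;> simp [denomPoint]

theorem denomPoint_re (z : ℍ) : (denomPoint z).re = z.im + 1 := by simp [denomPoint]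

theorem denomPoint_ne_zero (z : ℍ) : denomPoint z ≠ 0 := by
  intro h
  have := denomPoint_re z
  rw [h] at this
  have := z.im_pos
  simp at *; linarith

theorem denomPoint_mul_cayley (z : ℍ) : denomPoint z * cayley z = denomPoint z - 2 := by
  have h := add_I_ne_zero z
  rw [denomPoint_eq, cayley]
  field_simp
  linear_combination (2 : ℂ) * Complex.I_sq

theorem conj_denomPoint_add (z : ℍ) :
    denomPoint z + (starRingEnd ℂ) (denomPoint z) = 2 * z.im + 2 := by
  apply Complex.ext <;> simp [denomPoint]
  ring

theorem one_sub_norm_cayley_sq (z : ℍ) :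
    1 - ‖cayley z‖ ^ 2 = 4 * z.im / ‖denomPoint z‖ ^ 2 := by
  have hp : ‖denomPoint z‖ ≠ 0 := norm_ne_zero_iff.2 (denomPoint_ne_zero z)
  have h1 : ‖denomPoint z‖ * ‖cayley z‖ = ‖denomPoint z - 2‖ := by
    rw [← norm_mul, denomPoint_mul_cayley]
  have h2 : ‖cayley z‖ ^ 2 = ‖denomPoint z - 2‖ ^ 2 / ‖denomPoint z‖ ^ 2 := by
    rw [← h1]; field_simp
  rw [h2, eq_div_iff (pow_ne_zero 2 hp), sub_mul, div_mul_cancel₀ _ (pow_ne_zero 2 hp),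
    ← Complex.normSq_eq_norm_sq, ← Complex.normSq_eq_norm_sq]
  simp [Complex.normSq_apply, denomPoint]
  ring

theorem norm_cayley_lt_one (z : ℍ) : ‖cayley z‖ < 1 := by
  have h := one_sub_norm_cayley_sq z
  have : 0 < ‖denomPoint z‖ := norm_pos_iff.2 (denomPoint_ne_zero z)
  have := z.im_pos
  have h2 : 0 < 1 - ‖cayley z‖ ^ 2 := by rw [h]; positivity
  nlinarith [norm_nonneg (cayley z)]

theorem re_one_sub_pos {u : ℂ} (hu : ‖u‖ < 1) : 0 < (1 - u).re := by
  have := (Complex.abs_re_le_norm _).trans_lt hu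
  rw [Complex.sub_re, Complex.one_re]
  linarith [(abs_lt.1 this).2]

/-- Up to a weight and a phase, `⟨ψ_n^α, π(z) ψ_n^α⟩` is a Jacobi polynomial of the squared
pseudohyperbolic distance from `z` to `i`. -/
theorem waveletTransform_wavelet (n : ℕ) {α : ℝ} (hα : 0 < α) (z : ℍ) :
    waveletTransform (wavelet n α hα) (wavelet n α hα) z =
      ((2 ^ (α + 1) * z.im ^ ((1 + α) / 2) : ℝ) : ℂ) * denomPoint z ^ (-(α + 1) : ℂ) *
      (((starRingEnd ℂ) (denomPoint z) / denomPoint z) ^ n *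
        (jacobi n 0 α (1 - 2 * ‖cayley z‖ ^ 2) : ℂ)) := by
  have hp := denomPoint_ne_zero z
  have hc := denomPoint_mul_cayley z
  have hs := conj_denomPoint_add z
  have hr : (1 - 2 * (z.im : ℂ) / denomPoint z) * (1 - 2 / denomPoint z) =
      ((‖cayley z‖ ^ 2 : ℝ) : ℂ) * (1 - 2 * (z.im : ℂ) / denomPoint z - 2 / denomPoint z) := by
    have hcc : (starRingEnd ℂ) (denomPoint z) * (starRingEnd ℂ) (cayley z) =
        (starRingEnd ℂ) (denomPoint z) - 2 := by
      rw [← map_mul, hc, map_sub, map_ofNat]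
    have hn : ((‖cayley z‖ ^ 2 : ℝ) : ℂ) = cayley z * (starRingEnd ℂ) (cayley z) := by
      rw [Complex.mul_conj, Complex.normSq_eq_norm_sq]
    rw [hn]
    have h2 : 2 / denomPoint z = 1 - cayley z := by field_simp; linear_combination hc
    have h3 : 2 * (z.im : ℂ) / denomPoint z =
        1 + (starRingEnd ℂ) (denomPoint z) * (starRingEnd ℂ) (cayley z) / denomPoint z := by
      field_simp; linear_combination -hs - hcc
    have h4 : 1 - 2 * (z.im : ℂ) / denomPoint z - 2 / denomPoint z =
        -((starRingEnd ℂ) (denomPoint z)) / denomPoint z := by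
      field_simp; linear_combination hs
    rw [h4, h2, h3]; field_simp; ring
  rw [waveletTransform_wavelet_eq_sum, ← denomPoint,
    sum_sum_laguerreCoeff_eq_jacobi n (by linarith) _ _ _ hr]
  have h5 : 2 * (z.im : ℂ) / denomPoint z + 2 / denomPoint z - 1 =
      (starRingEnd ℂ) (denomPoint z) / denomPoint z := by
    field_simp; linear_combination -hs
  have hN : (2 * Real.pi)⁻¹ * waveletNorm n α ^ 2 * (Real.Gamma (n + α + 1) / n.factorial) =
      2 ^ (α + 1) := by
    have p : Real.Gamma (n + α + 1) ≠ 0 := (Real.Gamma_pos_of_pos (by positivity)).ne'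
    have := Nat.factorial_ne_zero n
    rw [waveletNorm_sq n hα, show α + 2 = α + 1 + 1 by ring, Real.rpow_add two_pos (α + 1),
      Real.rpow_one]
    field_simp
  rw [h5, ← hN]
  push_cast
  ring

/-- The coefficient of `π(z) ψ_n^α` along `π(w) (powerExp (α / 2))` in disk coordinates: its weight
and phase in `z` are conjugate to those of `waveletTransform_wavelet`, and `M` depends only
on `w`. -/
theorem inner_rep_powerExp_rep_wavelet_disk (n : ℕ) {α : ℝ} (hα : 0 < α) (w : ℍ) :
    ∃ M : ℂ, ∀ z : ℍ,
    inner ℂ (rep w (powerExp (α / 2) (by positivity))) (rep z (wavelet n α hα)) =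
      M * ((z.im ^ ((1 + α) / 2) : ℝ) : ℂ) * (starRingEnd ℂ) (denomPoint z) ^ (-(α + 1) : ℂ) *
        (denomPoint z / (starRingEnd ℂ) (denomPoint z)) ^ n *
      ((cayley w - cayley z) ^ n *
        (1 - cayley w * (starRingEnd ℂ) (cayley z)) ^ (-(n + α + 1) : ℂ)) := by
  set ω := cayley w with hω
  have hω1 : ‖ω‖ < 1 := norm_cayley_lt_one w
  have hω2 : 1 - ω ≠ 0 := one_sub_ne_zero_of_norm_lt hω1
  refine ⟨((2 * Real.pi)⁻¹ * waveletNorm n α * (Real.Gamma (n + α + 1) / n.factorial) *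
        w.im ^ ((1 + α) / 2) : ℝ) * (1 - ω) ^ (α + 1 : ℂ), fun z => ?_⟩
  rw [inner_rep_powerExp_rep_wavelet]
  set p := denomPoint z with hp
  set p' := (starRingEnd ℂ) p with hp'
  set ζ := cayley z with hζ
  set ζ' := (starRingEnd ℂ) ζ with hζ'
  set q := (starRingEnd ℂ) (rightPoint w) + rightPoint z with hq
  have hp0 : p ≠ 0 := denomPoint_ne_zero z
  have hp'0 : p' ≠ 0 := (map_ne_zero _).2 hp0
  have hc : p * ζ = p - 2 := denomPoint_mul_cayley z
  have hc' : p' * ζ' = p' - 2 := by rw [hp', hζ', ← map_mul, hc, map_sub, map_ofNat]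
  have hs : p + p' = 2 * z.im + 2 := conj_denomPoint_add z
  have hz : rightPoint z = p' - 1 := by rw [hp', hp, denomPoint]; simp
  have hw : denomPoint w * ω = denomPoint w - 2 := denomPoint_mul_cayley w
  have hqw : q = denomPoint w + p' - 2 := by rw [hq, hz, denomPoint]; ring
  have hωζ : ‖ω * ζ'‖ < 1 := by
    rw [norm_mul, hζ', RCLike.norm_conj]
    nlinarith [norm_nonneg ω, norm_nonneg ζ, norm_cayley_lt_one z]
  have hd : 1 - ω * ζ' ≠ 0 := one_sub_ne_zero_of_norm_lt hωζ
  have e1 : q * (1 - ω) = p' * (1 - ω * ζ') := by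
    rw [hqw]; linear_combination -hw + ω * hc'
  have e2 : (q - 2 * z.im) * (1 - ω) = p * (ω - ζ) := by
    rw [hqw]; linear_combination -hw + hc + (1 - ω) * hs
  have hq0 : q ≠ 0 := by
    intro h
    rw [h, zero_mul] at e1
    exact mul_ne_zero hp'0 hd e1.symm
  have e3 : 1 - 2 * z.im / q = p / p' * ((ω - ζ) / (1 - ω * ζ')) := by
    have : 1 - 2 * z.im / q = ((q - 2 * z.im) * (1 - ω)) / (q * (1 - ω)) := by field_simp
    rw [this, e1, e2]; field_simp
  have hqre : 0 < q.re := by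
    simp [hq]; have := z.im_pos; have := w.im_pos; positivity
  have hpre : 0 < p'.re := by
    simp [hp', hp, denomPoint]; have := z.im_pos; positivity
  have e4 : q ^ (-(α + 1) : ℂ) = (1 - ω) ^ (α + 1 : ℂ) * p' ^ (-(α + 1) : ℂ) *
      (1 - ω * ζ') ^ (-(α + 1) : ℂ) := by
    have := congrArg (fun x : ℂ => x ^ (-(α + 1) : ℂ)) e1
    rw [mul_cpow_of_re_pos hqre (re_one_sub_pos hω1), mul_cpow_of_re_pos hpre
      (re_one_sub_pos hωζ), Complex.cpow_neg (1 - ω)] at this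
    have h0 : (1 - ω) ^ (α + 1 : ℂ) ≠ 0 := by
      rw [Complex.cpow_def_of_ne_zero hω2]; exact Complex.exp_ne_zero _
    rw [mul_assoc, ← this]; field_simp
  have e5 : (1 - ω * ζ') ^ (-(n + α + 1) : ℂ) =
      (1 - ω * ζ') ^ (-(α + 1) : ℂ) / (1 - ω * ζ') ^ n := by
    rw [show (-(n + α + 1) : ℂ) = -(α + 1) - n by ring, Complex.cpow_sub _ _ hd,
      Complex.cpow_natCast]
  rw [e3, e4, e5, mul_pow, div_pow (ω - ζ)]
  push_cast
  ring

/-! ### The localized reconstruction of the wavelet -/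

/-- The weak identity tested against the orbit of `powerExp (α / 2)`. The phases of the two factors
cancel, and their weights combine to a power of `1 - |ζ|²`. -/
theorem setIntegral_waveletTransform_mul_powerExp (n : ℕ) {α R : ℝ} (hα : 0 < α) (hR₀ : 0 < R)
    (hR₁ : R < 1) (w : ℍ) :
    ∫ z in pseudoDisk R UpperHalfPlane.I,
      waveletTransform (wavelet n α hα) (wavelet n α hα) z *
        inner ℂ (rep w (powerExp (α / 2) (by positivity))) (rep z (wavelet n α hα)) =
      (localConst n α R : ℂ) *
        inner ℂ (rep w (powerExp (α / 2) (by positivity))) (wavelet n α hα) := by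
  obtain ⟨M, hM⟩ := inner_rep_powerExp_rep_wavelet_disk n hα w
  have hI : inner ℂ (rep w (powerExp (α / 2) (by positivity))) (wavelet n α hα) =
      M * ((2 : ℝ) ^ (-(α + 1)) : ℝ) * cayley w ^ n := by
    have h := hM UpperHalfPlane.I
    have hd : denomPoint UpperHalfPlane.I = ((2 : ℝ) : ℂ) := by
      rw [denomPoint, rightPoint_I]; norm_num
    have hc : cayley (UpperHalfPlane.I : ℍ) = 0 := by simp [cayley]
    have h2 : (((2 : ℝ) : ℂ)) ^ (-(α + 1) : ℂ) = (((2 : ℝ) ^ (-(α + 1)) : ℝ) : ℂ) := by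
      rw [Complex.ofReal_cpow (by norm_num)]; push_cast; rfl
    rw [rep_I] at h
    rw [h, hd, hc, Complex.conj_ofReal, h2, div_self (by norm_num)]
    simp
  rw [hI, mul_comm (M * _), ← mul_assoc,
    ← setIntegral_pseudoDisk_jacobi n hα hR₀ hR₁ (norm_cayley_lt_one w), ← integral_mul_const]
  refine integral_congr_ae (.of_forall fun z => ?_)
  simp only
  rw [waveletTransform_wavelet, hM]
  have hp0 := denomPoint_ne_zero z
  have hp'0 : (starRingEnd ℂ) (denomPoint z) ≠ 0 := (map_ne_zero _).2 hp0
  have hs := z.im_pos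
  have hre : 0 < (denomPoint z).re := by rw [denomPoint_re]; linarith
  have hn : 0 < ‖denomPoint z‖ := norm_pos_iff.2 hp0
  have e1 : denomPoint z ^ (-(α + 1) : ℂ) * (starRingEnd ℂ) (denomPoint z) ^ (-(α + 1) : ℂ) =
      (((‖denomPoint z‖ ^ 2) ^ (-(α + 1)) : ℝ) : ℂ) := by
    rw [← mul_cpow_of_re_pos hre (by simpa using hre), Complex.mul_conj,
      Complex.normSq_eq_norm_sq, Complex.ofReal_cpow (by positivity)]
    push_cast; rfl
  have e2 : (1 - ‖cayley z‖ ^ 2) ^ (α + 1) * 2 ^ (-(α + 1)) =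
      2 ^ (α + 1) * (z.im ^ ((1 + α) / 2) * z.im ^ ((1 + α) / 2)) *
        (‖denomPoint z‖ ^ 2) ^ (-(α + 1)) := by
    rw [one_sub_norm_cayley_sq, ← Real.rpow_add hs, show (1 + α) / 2 + (1 + α) / 2 = α + 1 by ring,
      Real.div_rpow (by positivity) (by positivity), Real.mul_rpow (by norm_num) hs.le,
      Real.rpow_neg (by positivity), Real.rpow_neg (by norm_num),
      show (4 : ℝ) = 2 * 2 by norm_num, Real.mul_rpow (by norm_num) (by norm_num)]
    have : (2 : ℝ) ^ (α + 1) ≠ 0 := (Real.rpow_pos_of_pos two_pos _).ne'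
    field_simp
  have e2' := congrArg Complex.ofReal e2
  have e3 : ((starRingEnd ℂ) (denomPoint z) / denomPoint z) ^ n *
      (denomPoint z / (starRingEnd ℂ) (denomPoint z)) ^ n = 1 := by
    rw [← mul_pow, div_mul_div_comm, mul_comm, div_self (mul_ne_zero hp0 hp'0), one_pow]
  simp only [Complex.ofReal_mul] at e2' ⊢
  -- what remains is algebra in the following quantities, given `e1`, `e2'` and `e3`
  generalize (((2 : ℝ) ^ (α + 1) : ℝ) : ℂ) = a at *
  generalize ((z.im ^ ((1 + α) / 2) : ℝ) : ℂ) = σ at *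
  generalize (((‖denomPoint z‖ ^ 2) ^ (-(α + 1)) : ℝ) : ℂ) = N at *
  generalize denomPoint z ^ (-(α + 1) : ℂ) = P at *
  generalize (starRingEnd ℂ) (denomPoint z) ^ (-(α + 1) : ℂ) = P' at *
  generalize ((starRingEnd ℂ) (denomPoint z) / denomPoint z) ^ n = ρ at *
  generalize (denomPoint z / (starRingEnd ℂ) (denomPoint z)) ^ n = ρ' at *
  generalize (jacobi n 0 α (1 - 2 * ‖cayley z‖ ^ 2) : ℂ) = J at *
  generalize (cayley w - cayley z) ^ n *
        (1 - cayley w * (starRingEnd ℂ) (cayley z)) ^ (-(n + α + 1) : ℂ) = Q at *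
  linear_combination (a * σ ^ 2 * J * M * Q * ρ * ρ') * e1 + (a * σ ^ 2 * J * M * Q * N) * e3 -
    J * M * Q * e2'

theorem volume_pseudoDisk_I_lt_top {R : ℝ} (hR₁ : R < 1) :
    volume (pseudoDisk R UpperHalfPlane.I) < ⊤ := by
  -- the disk lies in the image of a compact disk under the inverse Cayley transform
  have hc : IsCompact ((fun w : Metric.closedBall (0 : ℂ) R => (⟨cayleyInv w, by
      have hw : ‖(w : ℂ)‖ < 1 := (mem_closedBall_zero_iff.1 w.2).trans_lt hR₁
      have h1 := one_sub_ne_zero_of_norm_lt hw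
      rw [cayleyInv_im]
      have : 0 < ‖1 - (w : ℂ)‖ := norm_pos_iff.2 h1
      have : 0 < 1 - ‖(w : ℂ)‖ ^ 2 := by nlinarith [norm_nonneg (w : ℂ)]
      positivity⟩ : ℍ)) '' Set.univ) := by
    have : CompactSpace (Metric.closedBall (0 : ℂ) R) :=
      isCompact_iff_compactSpace.1 (isCompact_closedBall 0 R)
    refine isCompact_univ.image ?_
    refine UpperHalfPlane.isOpenEmbedding_coe.isInducing.continuous_iff.2 ?_
    change Continuous fun w : Metric.closedBall (0 : ℂ) R => cayleyInv w
    unfold cayleyInv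
    refine Continuous.div (by fun_prop) (by fun_prop) fun w => ?_
    exact one_sub_ne_zero_of_norm_lt ((mem_closedBall_zero_iff.1 w.2).trans_lt hR₁)
  refine (measure_mono fun z hz => ?_).trans_lt hc.measure_lt_top
  have hz' : ‖cayley z‖ < R := mem_pseudoDisk_I.1 hz
  exact ⟨⟨cayley z, mem_closedBall_zero_iff.2 hz'.le⟩, trivial,
    UpperHalfPlane.ext (cayleyInv_cayley z)⟩

theorem integrableOn_waveletTransform_mul_inner (ψ h : H2) {R : ℝ} (hR₁ : R < 1) :
    IntegrableOn (fun z : ℍ => waveletTransform ψ ψ z * inner ℂ h (rep z ψ))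
      (pseudoDisk R UpperHalfPlane.I) := by
  refine Measure.integrableOn_of_bounded (M := ‖ψ‖ * ‖ψ‖ * (‖h‖ * ‖ψ‖))
    (volume_pseudoDisk_I_lt_top hR₁).ne ?_ (.of_forall fun z => ?_)
  · exact ((stronglyMeasurable_waveletTransform ψ ψ).mul
      (stronglyMeasurable_inner_rep h ψ)).aestronglyMeasurable
  · rw [norm_mul]
    gcongr
    · exact norm_waveletTransform_le z ψ ψ
    · exact norm_inner_rep_le z h ψ

/-- The localized reconstruction formula for `ψ_n^α`: both sides are continuous and antilinear in
`h`, and agree on the orbit of `powerExp (α / 2)`, whose span is dense. -/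
theorem setIntegral_waveletTransform_mul_inner (n : ℕ) {α R : ℝ} (hα : 0 < α) (hR₀ : 0 < R)
    (hR₁ : R < 1) (h : H2) :
    ∫ z in pseudoDisk R UpperHalfPlane.I,
      waveletTransform (wavelet n α hα) (wavelet n α hα) z *
        inner ℂ h (rep z (wavelet n α hα)) =
      (localConst n α R : ℂ) * inner ℂ h (wavelet n α hα) := by
  set ψ := wavelet n α hα
  set D := pseudoDisk R UpperHalfPlane.I
  have hint := fun h : H2 => integrableOn_waveletTransform_mul_inner ψ h hR₁
  let L : H2 →ₗ⋆[ℂ] ℂ :=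
    { toFun := fun h => (∫ z in D, waveletTransform ψ ψ z * inner ℂ h (rep z ψ)) -
        (localConst n α R : ℂ) * inner ℂ h ψ
      map_add' := fun f g => by
        have e : ∀ k : H2, inner ℂ (f + g) k = inner ℂ f k + inner ℂ g k :=
          fun k => inner_add_left f g k
        simp only [e, mul_add]
        rw [integral_add (hint f) (hint g)]
        ring
      map_smul' := fun c f => by
        simp only [H2_inner_smul_left, smul_eq_mul]
        have e : ∀ z : ℍ, waveletTransform ψ ψ z * ((starRingEnd ℂ) c * inner ℂ f (rep z ψ)) =
          (starRingEnd ℂ) c * (waveletTransform ψ ψ z * inner ℂ f (rep z ψ)) := fun z => by ring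
        simp only [e]
        rw [integral_const_mul]
        ring }
  let L' : H2 →L⋆[ℂ] ℂ := L.mkContinuous
    (‖ψ‖ * ‖ψ‖ * ‖ψ‖ * volume.real D + ‖(localConst n α R : ℂ)‖ * ‖ψ‖) fun h => by
      have h1 : ‖∫ z in D, waveletTransform ψ ψ z * inner ℂ h (rep z ψ)‖ ≤
          (‖ψ‖ * ‖ψ‖ * (‖h‖ * ‖ψ‖)) * volume.real D := by
        refine norm_setIntegral_le_of_norm_le_const (volume_pseudoDisk_I_lt_top hR₁) fun z _ => ?_
        rw [norm_mul]
        gcongr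
        · exact norm_waveletTransform_le z ψ ψ
        · exact norm_inner_rep_le z h ψ
      have h2 : ‖(localConst n α R : ℂ) * inner ℂ h ψ‖ ≤
          ‖(localConst n α R : ℂ)‖ * (‖h‖ * ‖ψ‖) := by
        rw [norm_mul]
        gcongr
        exact norm_inner_le_norm (𝕜 := ℂ) h ψ
      refine (norm_sub_le _ _).trans ((add_le_add h1 h2).trans (le_of_eq ?_))
      ring
  have hL : L' = 0 := by
    refine ContinuousLinearMap.ext_on (dense_span_rep_powerExp (β := α / 2) (by positivity)) ?_
    rintro _ ⟨w, rfl⟩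
    exact sub_eq_zero.2 (setIntegral_waveletTransform_mul_powerExp n hα hR₀ hR₁ w)
  exact sub_eq_zero.1 (congrArg (fun T : H2 →L⋆[ℂ] ℂ => T h) hL)

/-! ### Integration over the upper half-plane in the coordinates `(x, s)` -/

theorem volume_restrict_coords :
    (volume : Measure (ℝ × ℝ)).restrict (Set.univ ×ˢ Set.Ioi (0 : ℝ)) =
    (volume : Measure ℝ).prod (volume.restrict (Set.Ioi (0 : ℝ))) := by
  rw [Measure.volume_eq_prod, ← Measure.prod_restrict, Measure.restrict_univ]

theorem integrable_coords_iff (g : ℝ → ℝ → ℂ) : Integrable (fun z : ℍ => g z.re z.im) ↔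
    Integrable (fun p : ℝ × ℝ => ((p.2 ^ 2)⁻¹ : ℝ) • g p.1 p.2)
      ((volume : Measure ℝ).prod (volume.restrict (Set.Ioi (0 : ℝ)))) := by
  refine (integrable_upperHalfPlane_iff (fun w : ℂ => g w.re w.im)).trans ?_
  rw [← volume_restrict_coords]
  have h := (Complex.volume_preserving_equiv_real_prod.integrableOn_comp_preimage
    Complex.measurableEquivRealProd.measurableEmbedding
    (f := fun p : ℝ × ℝ => ((p.2 ^ 2)⁻¹ : ℝ) • g p.1 p.2) (s := Set.univ ×ˢ Set.Ioi (0 : ℝ)))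
  refine Iff.trans ?_ h
  have : Complex.measurableEquivRealProd ⁻¹' (Set.univ ×ˢ Set.Ioi (0 : ℝ)) =
      {w : ℂ | 0 < w.im} := by
    ext w; simp
  rw [this]
  rfl

theorem integral_coords (g : ℝ → ℝ → ℂ) : ∫ z : ℍ, g z.re z.im =
    ∫ p, ((p.2 ^ 2)⁻¹ : ℝ) • g p.1 p.2
      ∂((volume : Measure ℝ).prod (volume.restrict (Set.Ioi (0 : ℝ)))) := by
  refine (integral_upperHalfPlane (fun w : ℂ => g w.re w.im)).trans ?_
  rw [← volume_restrict_coords]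
  have h := (Complex.volume_preserving_equiv_real_prod.setIntegral_preimage_emb
    Complex.measurableEquivRealProd.measurableEmbedding
    (fun p : ℝ × ℝ => ((p.2 ^ 2)⁻¹ : ℝ) • g p.1 p.2) (Set.univ ×ˢ Set.Ioi (0 : ℝ)))
  refine Eq.trans ?_ h
  have : Complex.measurableEquivRealProd ⁻¹' (Set.univ ×ˢ Set.Ioi (0 : ℝ)) =
      {w : ℂ | 0 < w.im} := by
    ext w; simp
  rw [this]
  rfl

/-! ### Fourier inversion for the Gamma kernel -/

theorem norm_sub_mul_I_cpow (σ x c : ℝ) :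
    ‖((σ : ℂ) - x * Complex.I) ^ (-(c + 1) : ℂ)‖ = ‖(σ : ℂ) - x * Complex.I‖ ^ (-(c + 1)) := by
  rw [show (-(c + 1) : ℂ) = ((-(c + 1) : ℝ) : ℂ) by push_cast; ring,
    Complex.norm_cpow_real]

theorem continuous_sub_mul_I_cpow {σ : ℝ} (hσ : 0 < σ) (c : ℝ) :
    Continuous fun x : ℝ => ((σ : ℂ) - x * Complex.I) ^ (-(c + 1) : ℂ) := by
  refine Continuous.cpow (by fun_prop) continuous_const fun x => Or.inl ?_
  simpa using hσ

theorem norm_sub_mul_I_sq (σ x : ℝ) : ‖(σ : ℂ) - x * Complex.I‖ ^ 2 = σ ^ 2 + x ^ 2 := by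
  rw [← Complex.normSq_eq_norm_sq]; simp [Complex.normSq_apply]; ring

theorem integrable_sub_mul_I_cpow {σ c : ℝ} (hσ : 0 < σ) (hc : 0 < c) :
    Integrable fun x : ℝ => ((σ : ℂ) - x * Complex.I) ^ (-(c + 1) : ℂ) := by
  have h := (integrable_rpow_neg_one_add_norm_sq (E := ℝ) (μ := volume) (r := c + 1)
    (by simpa using hc)).const_mul ((min σ 1) ^ (-(c + 1)))
  refine h.mono' (continuous_sub_mul_I_cpow hσ c).aestronglyMeasurable (.of_forall fun x => ?_)
  rw [norm_sub_mul_I_cpow]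
  have hm : 0 < min σ 1 := lt_min hσ one_pos
  have h1 : (1 + ‖x‖ ^ 2) ^ (-(c + 1) / 2) = Real.sqrt (1 + ‖x‖ ^ 2) ^ (-(c + 1)) := by
    rw [Real.sqrt_eq_rpow, ← Real.rpow_mul (by positivity)]; congr 1; ring
  rw [h1, ← Real.mul_rpow hm.le (Real.sqrt_nonneg _)]
  refine Real.rpow_le_rpow_of_nonpos (by positivity) ?_ (by linarith)
  refine abs_le_of_sq_le_sq' ?_ (norm_nonneg _) |>.2
  rw [mul_pow, Real.sq_sqrt (by positivity), norm_sub_mul_I_sq, Real.norm_eq_abs, sq_abs]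
  have h2 : (min σ 1) ^ 2 ≤ σ ^ 2 := by gcongr; exact min_le_left _ _
  have h3 : (min σ 1) ^ 2 ≤ 1 := by
    calc (min σ 1) ^ 2 ≤ 1 ^ 2 := by gcongr; exact min_le_right _ _
      _ = 1 := one_pow 2
  nlinarith [sq_nonneg x]

/-- Fourier inversion for the Gamma density `t ^ c * exp (-σ t)`, whose transform is a power of
`σ - i x`. -/
theorem integral_sub_mul_I_cpow_mul_exp {σ c t : ℝ} (hσ : 0 < σ) (hc : 0 < c) (ht : 0 < t) :
    ∫ x : ℝ, ((σ : ℂ) - x * Complex.I) ^ (-(c + 1) : ℂ) * Complex.exp (-(x * t : ℝ) * Complex.I) =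
      2 * Real.pi / Real.Gamma (c + 1) * ((t ^ c * Real.exp (-(σ * t)) : ℝ) : ℂ) := by
  have hΓ : (Real.Gamma (c + 1) : ℂ) ≠ 0 := by
    exact_mod_cast (Real.Gamma_pos_of_pos (by linarith)).ne'
  set g : ℝ → ℂ := fun τ => (((max τ 0) ^ c * Real.exp (-(σ * τ)) : ℝ) : ℂ) with hg
  have hgc : Continuous g := by
    refine Complex.continuous_ofReal.comp (Continuous.mul ?_ (by fun_prop))
    exact Continuous.rpow_const (by fun_prop) fun _ => Or.inr hc.le
  have hgind : g = Set.indicator (Set.Ioi (0 : ℝ)) fun τ => ((τ ^ c : ℝ) : ℂ) *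
      Complex.exp (-((σ : ℂ) * τ)) := by
    ext τ
    by_cases h : 0 < τ
    · rw [Set.indicator_of_mem (show τ ∈ Set.Ioi (0 : ℝ) from h), hg]
      simp only [max_eq_left h.le]; push_cast; rfl
    · rw [Set.indicator_of_notMem (show τ ∉ Set.Ioi (0 : ℝ) from h), hg]
      simp [max_eq_right (not_lt.1 h), Real.zero_rpow hc.ne']
  have hgi : Integrable g := by
    rw [hgind, integrable_indicator_iff measurableSet_Ioi]
    exact integrableOn_rpow_mul_cexp (by linarith) (by simpa using hσ)
  have hF : 𝓕 g = fun y : ℝ => (Real.Gamma (c + 1) : ℂ) *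
      ((σ : ℂ) - (-(2 * Real.pi) * y : ℝ) * Complex.I) ^ (-(c + 1) : ℂ) := by
    ext y
    have hp : 0 < ((σ : ℂ) - (-(2 * Real.pi) * y : ℝ) * Complex.I).re := by simpa using hσ
    rw [← integral_rpow_mul_cexp (by linarith) hp, Real.fourier_real_eq_integral_exp_smul, hgind,
      ← integral_indicator measurableSet_Ioi]
    refine integral_congr_ae (.of_forall fun τ => ?_)
    by_cases h : 0 < τ
    · simp only [Set.indicator_of_mem (show τ ∈ Set.Ioi (0 : ℝ) from h), smul_eq_mul]
      rw [mul_left_comm, ← Complex.exp_add]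
      congr 2; push_cast; ring
    · simp [Set.indicator_of_notMem (show τ ∉ Set.Ioi (0 : ℝ) from h)]
  have hFi : Integrable (𝓕 g) := by
    rw [hF]
    exact ((integrable_sub_mul_I_cpow hσ hc).comp_mul_left'
      (R := -(2 * Real.pi)) (by simp [Real.pi_ne_zero])).const_mul _
  have hinv := congrFun (hgc.fourierInv_fourier_eq hgi hFi) t
  rw [Real.fourierInv_eq', hF] at hinv
  have h1 := Measure.integral_comp_mul_left (fun x : ℝ => (Real.Gamma (c + 1) : ℂ) *
    (((σ : ℂ) - x * Complex.I) ^ (-(c + 1) : ℂ) * Complex.exp (-(x * t : ℝ) * Complex.I)))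
    (-(2 * Real.pi))
  have h2 : ∫ y : ℝ, Complex.exp (((2 * Real.pi * inner ℝ y t : ℝ) : ℂ) * Complex.I) •
      ((Real.Gamma (c + 1) : ℂ) *
      ((σ : ℂ) - (-(2 * Real.pi) * y : ℝ) * Complex.I) ^ (-(c + 1) : ℂ)) =
      ∫ x : ℝ, (Real.Gamma (c + 1) : ℂ) *
    (((σ : ℂ) - (-(2 * Real.pi) * x : ℝ) * Complex.I) ^ (-(c + 1) : ℂ) *
      Complex.exp (-(-(2 * Real.pi) * x * t : ℝ) * Complex.I)) := by
    refine integral_congr_ae (.of_forall fun y => ?_)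
    simp only [smul_eq_mul, RCLike.inner_apply, conj_trivial]
    rw [mul_comm, mul_assoc]
    congr 4; push_cast; ring
  rw [h2, h1, integral_const_mul, hg] at hinv
  simp only [max_eq_left ht.le] at hinv
  generalize ∫ x : ℝ, ((σ : ℂ) - x * Complex.I) ^ (-(c + 1) : ℂ) *
    Complex.exp (-(x * t : ℝ) * Complex.I) = J at hinv ⊢
  rw [← hinv, abs_inv, abs_neg, abs_of_pos (by positivity), Complex.real_smul]
  push_cast
  have : (Real.pi : ℂ) ≠ 0 := by exact_mod_cast Real.pi_ne_zero
  field_simp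

/-! ### An integrable wavelet transform -/

theorem waveletTransform_powerExp {a b : ℝ} (ha : 0 < a) (hb : 0 < b) (z : ℍ) :
    waveletTransform (powerExp b hb) (powerExp a ha) z =
      (((2 * Real.pi)⁻¹ * Real.Gamma (a + b + 1) * z.im ^ (1 / 2 + b) : ℝ) : ℂ) *
        (((1 + z.im : ℝ) : ℂ) - z.re * Complex.I) ^ (-((a + b : ℝ) + 1) : ℂ) := by
  have h : waveletTransform (powerExp b hb) (powerExp a ha) z =
    inner ℂ (rep z (powerExp b hb)) (rep UpperHalfPlane.I (powerExp a ha)) := by rw [rep_I]; rfl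
  rw [h, inner_rep_powerExp, rightPoint_I,
    show (starRingEnd ℂ) (rightPoint z) + 1 = ((1 + z.im : ℝ) : ℂ) - z.re * Complex.I by
      apply Complex.ext <;> simp [add_comm], show b + a + 1 = a + b + 1 by ring,
    show (-(b + a + 1) : ℂ) = -((a + b : ℝ) + 1) by push_cast; ring]
  simp only [UpperHalfPlane.I_im, Real.one_rpow]
  push_cast
  ring

/-- The window `powerExp 2` decays fast enough at `s → 0` to beat the density `s⁻²` of the invariant
measure. -/
theorem integrable_waveletTransform_powerExp {a : ℝ} (ha : 0 < a) :
    Integrable (waveletTransform (powerExp 2 two_pos) (powerExp a ha)) := by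
  have h0 : waveletTransform (powerExp 2 two_pos) (powerExp a ha) = fun z : ℍ =>
      (fun x s : ℝ => (((2 * Real.pi)⁻¹ * Real.Gamma (a + 2 + 1) * s ^ ((1 : ℝ) / 2 + 2) : ℝ) : ℂ) *
        (((1 + s : ℝ) : ℂ) - x * Complex.I) ^ (-((a + 2 : ℝ) + 1) : ℂ)) z.re z.im :=
    funext fun z => waveletTransform_powerExp ha two_pos z
  rw [h0]
  refine (integrable_coords_iff (fun x s : ℝ =>
    (((2 * Real.pi)⁻¹ * Real.Gamma (a + 2 + 1) * s ^ ((1 : ℝ) / 2 + 2) : ℝ) : ℂ) *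
      (((1 + s : ℝ) : ℂ) - x * Complex.I) ^ (-((a + 2 : ℝ) + 1) : ℂ))).2 ?_
  have hx := integrable_rpow_neg_one_add_norm_sq (E := ℝ) (μ := volume) (r := 5 / 4)
    (by norm_num)
  have hs := (integrable_one_add_norm (E := ℝ) (μ := volume) (r := 5 / 4)
    (by norm_num)).restrict (s := Set.Ioi 0)
  have h := (hx.mul_prod hs).const_mul ((2 * Real.pi)⁻¹ * Real.Gamma (a + 2 + 1))
  refine h.mono' ?_ ?_
  · exact Measurable.aestronglyMeasurable (by fun_prop)
  · have hpos : ∀ᵐ p : ℝ × ℝ ∂((volume : Measure ℝ).prod (volume.restrict (Set.Ioi (0 : ℝ)))),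
        0 < p.2 := by
      rw [← volume_restrict_coords]
      filter_upwards [ae_restrict_mem (MeasurableSet.univ.prod measurableSet_Ioi)] with p hp
      exact hp.2
    filter_upwards [hpos] with p hp
    obtain ⟨x, s⟩ := p
    simp only at hp ⊢
    have hσ : 0 < 1 + s := by linarith
    have hΓ : 0 < Real.Gamma (a + 2 + 1) := Real.Gamma_pos_of_pos (by linarith)
    set N := ‖((1 + s : ℝ) : ℂ) - x * Complex.I‖ with hN
    have hN2 : N ^ 2 = (1 + s) ^ 2 + x ^ 2 := norm_sub_mul_I_sq _ _
    have hN1 : 1 + s ≤ N := by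
      refine abs_le_of_sq_le_sq' ?_ (norm_nonneg _) |>.2
      nlinarith [sq_nonneg x]
    have hNx : Real.sqrt (1 + ‖x‖ ^ 2) ≤ N := by
      refine Real.sqrt_le_iff.2 ⟨norm_nonneg _, ?_⟩
      rw [hN2, Real.norm_eq_abs, sq_abs]; nlinarith
    have hN0 : 0 < N := by linarith
    rw [norm_smul, norm_mul, norm_sub_mul_I_cpow, ← hN, Complex.norm_real,
      Real.norm_of_nonneg (by positivity), Real.norm_of_nonneg (by positivity),
      Real.norm_of_nonneg (r := s) hp.le]
    have e1 : (s ^ 2)⁻¹ * ((2 * Real.pi)⁻¹ * Real.Gamma (a + 2 + 1) * s ^ ((1 : ℝ) / 2 + 2) *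
        N ^ (-(a + 2 + 1))) = (2 * Real.pi)⁻¹ * Real.Gamma (a + 2 + 1) *
          (s ^ ((1 : ℝ) / 2) * N ^ (-(a + 2 + 1))) := by
      rw [Real.rpow_add hp, Real.rpow_two]; field_simp
    rw [e1]
    refine mul_le_mul_of_nonneg_left ?_ (by positivity)
    -- of the exponent `a + 3 ≥ 3` of `N = |1 + s - i x|`, the part `5 / 4` pays for the integral in
    -- `x` and the part `7 / 4` for the factor `s ^ (1 / 2)` and the integral in `s`
    have e2 : N ^ (-(a + 2 + 1)) ≤ N ^ (-(5 / 4 : ℝ)) * N ^ (-(7 / 4 : ℝ)) := by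
      rw [← Real.rpow_add hN0]
      exact Real.rpow_le_rpow_of_exponent_le (by linarith) (by linarith)
    have e3 : N ^ (-(5 / 4 : ℝ)) ≤ (1 + ‖x‖ ^ 2) ^ (-(5 / 4 : ℝ) / 2) := by
      have : (1 + ‖x‖ ^ 2) ^ (-(5 / 4 : ℝ) / 2) = Real.sqrt (1 + ‖x‖ ^ 2) ^ (-(5 / 4 : ℝ)) := by
        rw [Real.sqrt_eq_rpow, ← Real.rpow_mul (by positivity)]; congr 1; ring
      rw [this]
      exact Real.rpow_le_rpow_of_nonpos (Real.sqrt_pos.2 (by positivity)) hNx (by norm_num)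
    have e4 : s ^ ((1 : ℝ) / 2) * N ^ (-(7 / 4 : ℝ)) ≤ (1 + s) ^ (-(5 / 4 : ℝ)) := by
      calc s ^ ((1 : ℝ) / 2) * N ^ (-(7 / 4 : ℝ))
          ≤ (1 + s) ^ ((1 : ℝ) / 2) * (1 + s) ^ (-(7 / 4 : ℝ)) := by
            refine mul_le_mul ?_ ?_ (by positivity) (by positivity)
            · exact Real.rpow_le_rpow hp.le (by linarith) (by norm_num)
            · exact Real.rpow_le_rpow_of_nonpos hσ hN1 (by norm_num)
        _ = (1 + s) ^ (-(5 / 4 : ℝ)) := by rw [← Real.rpow_add hσ]; norm_num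
    calc s ^ ((1 : ℝ) / 2) * N ^ (-(a + 2 + 1))
        ≤ s ^ ((1 : ℝ) / 2) * (N ^ (-(5 / 4 : ℝ)) * N ^ (-(7 / 4 : ℝ))) := by gcongr
      _ = N ^ (-(5 / 4 : ℝ)) * (s ^ ((1 : ℝ) / 2) * N ^ (-(7 / 4 : ℝ))) := by ring
      _ ≤ _ := mul_le_mul e3 e4 (by positivity) (by positivity)

/-! ### A convolution identity for wavelet transforms -/

theorem integral_mul_integral_mul_cexp {P Q : ℝ → ℂ} (hP : Integrable P)
    (hQ : IntegrableOn Q (Set.Ioi 0)) :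
    ∫ x, P x * ∫ t in Set.Ioi (0 : ℝ), Q t * Complex.exp (-(x * t : ℝ) * Complex.I) =
      ∫ t in Set.Ioi (0 : ℝ), Q t * ∫ x, P x * Complex.exp (-(x * t : ℝ) * Complex.I) := by
  simp_rw [← integral_const_mul]
  rw [integral_integral_swap]
  · refine integral_congr_ae (.of_forall fun t => integral_congr_ae (.of_forall fun x => ?_))
    simp only; ring
  · have h := (hP.mul_prod hQ).bdd_mul (c := 1)
      (f := fun p : ℝ × ℝ => Complex.exp (-(p.1 * p.2 : ℝ) * Complex.I)) (by fun_prop)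
      (.of_forall fun p => by
        rw [← Complex.ofReal_neg, Complex.norm_exp_ofReal_mul_I])
    refine h.congr (.of_forall fun p => ?_)
    simp only [Function.uncurry]; ring

theorem integral_Ioi_mul_comp_mul (h : ℝ → ℂ) {t : ℝ} (ht : 0 < t) :
    ∫ s in Set.Ioi (0 : ℝ), t * h (s * t) = ∫ u in Set.Ioi (0 : ℝ), h u := by
  rw [integral_const_mul, integral_comp_mul_right_Ioi h 0 ht, zero_mul, Complex.real_smul,
    ← mul_assoc]
  have : (t : ℂ) ≠ 0 := by exact_mod_cast ht.ne'
  push_cast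
  rw [mul_inv_cancel₀ this, one_mul]

/-- Since `t ds` is carried to `du` by the dilation `u = s t`, the double integral splits. -/
theorem integral_Ioi_mul_integral_comp_mul {Q h : ℝ → ℂ} (hQ : IntegrableOn Q (Set.Ioi 0))
    (hh : IntegrableOn h (Set.Ioi 0)) (hQm : Measurable Q) (hhm : Measurable h) :
    ∫ s in Set.Ioi (0 : ℝ), ∫ t in Set.Ioi (0 : ℝ), Q t * (t * h (s * t)) =
      (∫ t in Set.Ioi (0 : ℝ), Q t) * ∫ u in Set.Ioi (0 : ℝ), h u := by
  have hnorm : ∀ t ∈ Set.Ioi (0 : ℝ), ∫ s in Set.Ioi (0 : ℝ), ‖Q t * (t * h (s * t))‖ =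
      ‖Q t‖ * ∫ u in Set.Ioi (0 : ℝ), ‖h u‖ := fun t (ht : 0 < t) => by
    simp_rw [norm_mul, Complex.norm_real, Real.norm_of_nonneg ht.le]
    rw [integral_const_mul, integral_const_mul,
      integral_comp_mul_right_Ioi (fun u => ‖h u‖) 0 ht, zero_mul, smul_eq_mul, ← mul_assoc t,
      mul_inv_cancel₀ ht.ne', one_mul]
  rw [integral_integral_swap, ← integral_mul_const]
  · refine setIntegral_congr_fun measurableSet_Ioi fun t ht => ?_
    rw [integral_const_mul, integral_Ioi_mul_comp_mul h ht]
  · refine (integrable_prod_iff' (Measurable.aestronglyMeasurable ?_)).2 ⟨?_, ?_⟩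
    · have : Measurable fun p : ℝ × ℝ => h (p.1 * p.2) := hhm.comp (by fun_prop)
      simp only [Function.uncurry_def]
      fun_prop
    · filter_upwards [ae_restrict_mem measurableSet_Ioi] with t ht
      simp only [Function.uncurry]
      refine Integrable.const_mul (Integrable.const_mul ?_ _) _
      exact (integrableOn_Ioi_comp_mul_right_iff h 0 ht).2 (by simpa using hh)
    · refine (hQ.norm.mul_const (∫ u in Set.Ioi (0 : ℝ), ‖h u‖)).congr ?_
      filter_upwards [ae_restrict_mem measurableSet_Ioi] with t ht
      exact (hnorm t ht).symm

theorem integrable_waveletTransform_powerExp_mul {a : ℝ} (ha : 0 < a) (f g : H2) :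
    Integrable fun z : ℍ => waveletTransform (powerExp 2 two_pos) (powerExp a ha) z *
      inner ℂ f (rep z g) :=
  (integrable_waveletTransform_powerExp ha).mul_bdd (c := ‖f‖ * ‖g‖)
    (stronglyMeasurable_inner_rep f g).aestronglyMeasurable
    (.of_forall fun z => norm_inner_rep_le z f g)

/-- Averaging the orbit of `g` against the wavelet transform of `powerExp a` reproduces a multiple
of `powerExp a`, whatever `g` is: only the scalar `⟪powerExp 1, g⟫` remembers `g`. -/
theorem integral_waveletTransform_powerExp_mul_inner {a : ℝ} (ha : 0 < a) (f g : H2) :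
    ∫ z : ℍ, waveletTransform (powerExp 2 two_pos) (powerExp a ha) z * inner ℂ f (rep z g) =
      2 * Real.pi * inner ℂ (powerExp 1 one_pos) g * inner ℂ f (powerExp a ha) := by
  set A : ℝ → ℂ := fun t => (starRingEnd ℂ) (fourierL2 (f : L2R) t) with hA
  set F : ℝ → ℂ := fourierL2 (g : L2R) with hF
  have hFm : Measurable F := (stronglyMeasurable_fourierL2 g).measurable
  have hAm : Measurable A :=
    Complex.continuous_conj.measurable.comp (stronglyMeasurable_fourierL2 f).measurable
  have hF2 : MemLp F 2 volume := memLp_fourierL2 g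
  have hA2 : MemLp A 2 volume := (memLp_fourierL2 f).star
  set K : ℝ → ℝ → ℂ := fun x s =>
    (((2 * Real.pi)⁻¹ * Real.Gamma (a + 2 + 1) * s ^ ((1 : ℝ) / 2 + 2) : ℝ) : ℂ) *
      (((1 + s : ℝ) : ℂ) - x * Complex.I) ^ (-((a + 2 : ℝ) + 1) : ℂ) with hK
  set N : ℝ → ℝ → ℂ := fun x s => (2 * Real.pi : ℂ)⁻¹ * ∫ t in Set.Ioi (0 : ℝ),
    A t * ((Real.sqrt s : ℂ) * Complex.exp (-(x * t : ℝ) * Complex.I) * F (s * t)) with hN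
  have hKN : (fun z : ℍ => waveletTransform (powerExp 2 two_pos) (powerExp a ha) z *
      inner ℂ f (rep z g)) = fun z : ℍ => K z.re z.im * N z.re z.im := by
    ext z
    rw [waveletTransform_powerExp, inner_rep_right]
  have hint := integrable_waveletTransform_powerExp_mul ha f g
  rw [hKN] at hint ⊢
  have hint' := (integrable_coords_iff fun x s => K x s * N x s).1 hint
  refine (integral_coords fun x s => K x s * N x s).trans ?_
  rw [integral_prod_symm _ hint']
  set Q : ℝ → ℂ := fun t => A t * ((t ^ a * Real.exp (-t) : ℝ) : ℂ) with hQ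
  set h : ℝ → ℂ := fun u => ((u ^ (1 : ℝ) * Real.exp (-u) : ℝ) : ℂ) * F u with hh
  -- the integral over a horizontal line, by Fubini and Fourier inversion in `x`
  have key : ∀ s ∈ Set.Ioi (0 : ℝ), ∫ x, ((s ^ 2)⁻¹ : ℝ) • (K x s * N x s) =
      (2 * Real.pi : ℂ)⁻¹ * ∫ t in Set.Ioi (0 : ℝ), Q t * (t * h (s * t)) := by
    intro s (hs : 0 < s)
    have hΓ : (Real.Gamma (a + 2 + 1) : ℂ) ≠ 0 := by
      exact_mod_cast (Real.Gamma_pos_of_pos (by linarith)).ne'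
    have hπ : (Real.pi : ℂ) ≠ 0 := by exact_mod_cast Real.pi_ne_zero
    have hFs : MemLp (fun t => F (s * t)) 2 volume := by
      have h3 : MemLp F 2 (Measure.map (fun t : ℝ => s * t) volume) := by
        rw [map_scale hs]; exact hF2.smul_measure ENNReal.ofReal_ne_top
      exact h3.comp_of_map (by fun_prop)
    have hAF : IntegrableOn (fun t => A t * F (s * t)) (Set.Ioi 0) :=
      (hA2.integrable_mul hFs).integrableOn
    have hP := integrable_sub_mul_I_cpow (σ := 1 + s) (c := a + 2) (by linarith) (by linarith)
    have e1 : ∀ x, ((s ^ 2)⁻¹ : ℝ) • (K x s * N x s) =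
        ((((s ^ 2)⁻¹ * ((2 * Real.pi)⁻¹ * Real.Gamma (a + 2 + 1) * s ^ ((1 : ℝ) / 2 + 2)) *
          Real.sqrt s : ℝ) : ℂ) * (2 * Real.pi : ℂ)⁻¹) *
        ((((1 + s : ℝ) : ℂ) - x * Complex.I) ^ (-((a + 2 : ℝ) + 1) : ℂ) *
          ∫ t in Set.Ioi (0 : ℝ), A t * F (s * t) * Complex.exp (-(x * t : ℝ) * Complex.I)) := by
      intro x
      have : ∫ t in Set.Ioi (0 : ℝ),
          A t * ((Real.sqrt s : ℂ) * Complex.exp (-(x * t : ℝ) * Complex.I) * F (s * t)) =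
          Real.sqrt s * ∫ t in Set.Ioi (0 : ℝ),
            A t * F (s * t) * Complex.exp (-(x * t : ℝ) * Complex.I) := by
        rw [← integral_const_mul]; congr 1; ext t; ring
      simp only [hK, hN, this, Complex.real_smul]
      push_cast; ring
    simp_rw [e1]
    rw [integral_const_mul, integral_mul_integral_mul_cexp hP hAF, mul_comm _ (2 * Real.pi : ℂ)⁻¹,
      mul_assoc, ← integral_const_mul]
    congr 1
    refine setIntegral_congr_fun measurableSet_Ioi fun t ht => ?_
    have ht' : 0 < t := ht
    rw [integral_sub_mul_I_cpow_mul_exp (by linarith) (by linarith) ht']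
    have e2 : (s ^ 2)⁻¹ * s ^ ((1 : ℝ) / 2 + 2) * Real.sqrt s = s := by
      rw [Real.rpow_add hs, Real.rpow_two, ← Real.sqrt_eq_rpow]
      field_simp
      rw [Real.sq_sqrt hs.le]
    have e3 : Real.exp (-((1 + s) * t)) = Real.exp (-t) * Real.exp (-(s * t)) := by
      rw [← Real.exp_add]; congr 1; ring
    have e4 : t ^ (a + 2) = t ^ a * t ^ 2 := by rw [Real.rpow_add ht', Real.rpow_two]
    have e2' : ((s : ℂ) ^ 2)⁻¹ * ((s ^ ((1 : ℝ) / 2 + 2) : ℝ) : ℂ) * (Real.sqrt s : ℂ) = s := by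
      exact_mod_cast e2
    simp only [hQ, hh, e3, e4, Real.rpow_one]
    push_cast
    calc _ = (((s : ℂ) ^ 2)⁻¹ * ((s ^ ((1 : ℝ) / 2 + 2) : ℝ) : ℂ) * (Real.sqrt s : ℂ)) *
          ((2 * Real.pi : ℂ)⁻¹ * (2 * Real.pi)) *
          (Real.Gamma (a + 2 + 1) * (Real.Gamma (a + 2 + 1) : ℂ)⁻¹) *
          (A t * F (s * t) * ((t ^ a : ℝ) * t ^ 2 *
            (Complex.exp (-t) * Complex.exp (-(s * t))))) := by ring
      _ = _ := by
        rw [e2', inv_mul_cancel₀ (by simp [hπ]), mul_inv_cancel₀ hΓ]; ring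
  rw [setIntegral_congr_fun measurableSet_Ioi key, integral_const_mul,
    integral_Ioi_mul_integral_comp_mul]
  · have i1 : ∫ u in Set.Ioi (0 : ℝ), h u = 2 * Real.pi * inner ℂ (powerExp 1 one_pos) g := by
      rw [inner_eq_integral, ← mul_assoc, mul_inv_cancel₀ (by simp [Real.pi_ne_zero]), one_mul]
      refine setIntegral_congr_ae measurableSet_Ioi ?_
      filter_upwards [fourierL2_powerExp one_pos] with t h1 ht
      rw [h1 ht, Complex.conj_ofReal]
    have i2 : (2 * Real.pi : ℂ)⁻¹ * ∫ t in Set.Ioi (0 : ℝ), Q t = inner ℂ f (powerExp a ha) := by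
      rw [inner_eq_integral]
      congr 1
      refine setIntegral_congr_ae measurableSet_Ioi ?_
      filter_upwards [fourierL2_powerExp ha] with t h1 ht
      rw [h1 ht]
    rw [i1, ← mul_assoc, i2]; ring
  · have := (hA2.integrable_mul (memLp_monomial ha).ofReal).integrableOn (s := Set.Ioi 0)
    refine this.congr_fun (fun t ht => ?_) measurableSet_Ioi
    simp [Set.indicator_of_mem ht, hQ]
  · have := ((memLp_monomial one_pos).ofReal.integrable_mul hF2).integrableOn (s := Set.Ioi 0)
    refine this.congr_fun (fun t ht => ?_) measurableSet_Ioi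
    simp [Set.indicator_of_mem ht, hh]
  · fun_prop
  · fun_prop

/-! ### The wavelets are test functions for every window -/

theorem admissibilityConst_zero : admissibilityConst 0 = 0 := by
  refine (lintegral_congr_ae ?_).trans lintegral_zero
  filter_upwards [ae_restrict_of_ae fourierL2_zero] with t ht
  have : fourierL2 (0 : L2R) t = 0 := ht
  simp [this]

/-- The convolution of two integrable functions on the affine group is integrable. -/
theorem integrable_integral_mul_comp_affMul {k G : ℍ → ℂ} (hk : Integrable k) (hG : Integrable G)
    (hkm : StronglyMeasurable k) (hGm : StronglyMeasurable G) :
    Integrable fun z : ℍ => ∫ w, k w * G (affMul (affInv w) z) := by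
  have hprod : Integrable (fun p : ℍ × ℍ => k p.1 * G (affMul (affInv p.1) p.2))
      ((volume : Measure ℍ).prod volume) := by
    refine (integrable_prod_iff ?_).2 ⟨.of_forall fun w => ?_, ?_⟩
    · refine StronglyMeasurable.aestronglyMeasurable ?_
      refine (hkm.comp_measurable measurable_fst).mul (hGm.comp_measurable ?_)
      exact measurable_affMul.comp
        ((measurable_affInv.comp measurable_fst).prodMk measurable_snd)
    · have h := (measurePreserving_affMul (affInv w)).integrable_comp_of_integrable hG
      exact h.const_mul (k w)
    · refine (hk.norm.mul_const (∫ z, ‖G z‖)).congr (.of_forall fun w => ?_)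
      have hmp := measurePreserving_affMul (affInv w)
      have h := integral_map (f := fun z => ‖G z‖) (μ := volume) hmp.measurable.aemeasurable
        (by rw [hmp.map_eq]; exact hGm.norm.aestronglyMeasurable)
      rw [hmp.map_eq] at h
      simp only [norm_mul]
      rw [integral_const_mul, h]
  exact hprod.integral_prod_right

/-- Up to a nonzero constant, `W_φ (powerExp a)` is the convolution of the integrable transform of
`powerExp a` with the integrable function `W_φ (π(u) φ)`. -/
theorem powerExp_mem_testSpace {a : ℝ} (ha : 0 < a) {φ : H2} (hφ : IsAdmissible φ)
    (hφ₁ : φ ∈ testSpace φ) : powerExp a ha ∈ testSpace φ := by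
  -- otherwise `φ` is orthogonal to the orbit of `powerExp 1`, hence zero and not admissible
  obtain ⟨u, hu⟩ : ∃ u : ℍ, inner ℂ (powerExp 1 one_pos) (rep u φ) ≠ 0 := by
    by_contra! hu
    have h0 : φ = 0 := eq_zero_of_inner_rep_powerExp one_pos fun w => by
      rw [inner_rep_left]; exact hu _
    have := hφ.1
    rw [h0, admissibilityConst_zero] at this
    exact lt_irrefl _ this
  set c : ℂ := 2 * Real.pi * inner ℂ (powerExp 1 one_pos) (rep u φ) with hc
  have hc0 : c ≠ 0 := mul_ne_zero (by simp [Real.pi_ne_zero]) hu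
  set k := waveletTransform (powerExp 2 two_pos) (powerExp a ha) with hk
  set G := waveletTransform φ (rep u φ) with hG
  have hki : Integrable k := integrable_waveletTransform_powerExp ha
  have hGi : Integrable G := rep_mem_testSpace φ u hφ₁
  have hGm : StronglyMeasurable G := stronglyMeasurable_waveletTransform _ _
  have hkm : StronglyMeasurable k := stronglyMeasurable_waveletTransform _ _
  have hrepr : ∀ z, ∫ w, k w * G (affMul (affInv w) z) =
      c * waveletTransform φ (powerExp a ha) z := fun z => by
    have := integral_waveletTransform_powerExp_mul_inner ha (rep z φ) (rep u φ)
    refine Eq.trans ?_ this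
    refine integral_congr_ae (.of_forall fun w => ?_)
    simp only
    rw [hG, ← waveletTransform_rep]
    rfl
  have := (integrable_integral_mul_comp_affMul hki hGi hkm hGm).const_mul c⁻¹
  refine this.congr (.of_forall fun z => ?_)
  simp only
  rw [hrepr, ← mul_assoc, inv_mul_cancel₀ hc0, one_mul]

theorem wavelet_mem_testSpace (n : ℕ) {α : ℝ} (hα : 0 < α) {φ : H2} (hφ : IsAdmissible φ)
    (hφ₁ : φ ∈ testSpace φ) : wavelet n α hα ∈ testSpace φ := by
  rw [wavelet_eq_sum]
  exact Submodule.sum_mem _ fun k _ => Submodule.smul_mem _ _ (powerExp_mem_testSpace _ hφ hφ₁)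

/-! ### The constants -/

theorem admissibilityConst_wavelet (n : ℕ) {α : ℝ} (hα : 0 < α) :
    admissibilityConst (wavelet n α hα) = ENNReal.ofReal (4 * Real.pi / α) := by
  set c : ℕ → ℝ := fun k => waveletNorm n α * (laguerreCoeff n α k * 2 ^ k) with hc
  set q : ℝ → ℝ := fun t => ∑ j ∈ Finset.range (n + 1), ∑ k ∈ Finset.range (n + 1),
    c j * c k * (t ^ (α + j + k - 1) * Real.exp (-(2 * t))) with hq
  have hqt : ∀ t > 0, waveletHat n α t ^ 2 / t = q t := fun t ht => by
    rw [waveletHat_of_pos n α ht, sq, Finset.sum_mul_sum, Finset.sum_div]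
    refine Finset.sum_congr rfl fun j _ => ?_
    rw [Finset.sum_div]
    refine Finset.sum_congr rfl fun k _ => ?_
    rw [show α + j + k - 1 = (α / 2 + j) + (α / 2 + k) - 1 by ring, Real.rpow_sub ht,
      Real.rpow_one, Real.rpow_add ht (α / 2 + j),
      show -(2 * t) = -t + -t by ring, Real.exp_add]
    ring
  have hterm : ∀ j k : ℕ, IntegrableOn (fun t : ℝ => c j * c k *
      (t ^ (α + j + k - 1) * Real.exp (-(2 * t)))) (Set.Ioi 0) := fun j k => by
    refine Integrable.const_mul (integrableOn_rpow_mul_exp ?_ two_pos) _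
    have := Nat.cast_nonneg (α := ℝ) j
    have := Nat.cast_nonneg (α := ℝ) k
    linarith
  have hqi : IntegrableOn q (Set.Ioi 0) :=
    integrable_finsetSum _ fun j _ => integrable_finsetSum _ fun k _ => hterm j k
  have h1 : admissibilityConst (wavelet n α hα) =
      ∫⁻ t in Set.Ioi (0 : ℝ), ENNReal.ofReal (q t) := by
    refine setLIntegral_congr_fun_ae measurableSet_Ioi ?_
    filter_upwards [fourierL2_waveletL2 n α hα] with t ht ht0
    have ht0' : 0 < t := ht0
    have : fourierL2 (wavelet n α hα : L2R) t = (waveletHat n α t : ℂ) := ht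
    rw [this, ← hqt t ht0', ENNReal.ofReal_div_of_pos ht0', ← sq_abs,
      ENNReal.ofReal_pow (abs_nonneg _), ← ofReal_norm, Complex.norm_real, Real.norm_eq_abs]
  rw [h1, ← ofReal_integral_eq_lintegral_ofReal hqi]
  · congr 1
    rw [integral_finsetSum _ fun j _ => integrable_finsetSum _ fun k _ => hterm j k]
    have h2 : ∀ j k : ℕ, ∫ t in Set.Ioi (0 : ℝ), c j * c k *
        (t ^ (α + j + k - 1) * Real.exp (-(2 * t))) =
        waveletNorm n α ^ 2 * (2 ^ α)⁻¹ *
          (laguerreCoeff n α j * laguerreCoeff n α k * Real.Gamma (α + j + k)) := fun j k => by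
      rw [integral_const_mul, Real.integral_rpow_mul_exp_neg_mul_Ioi (by positivity) two_pos,
        Real.rpow_add_natCast (by norm_num), Real.rpow_add_natCast (by norm_num),
        Real.div_rpow zero_le_one zero_le_two, Real.one_rpow, hc]
      simp only [one_div, inv_pow]
      field_simp
    simp_rw [integral_finsetSum _ fun k _ => hterm _ k, h2, ← Finset.mul_sum]
    rw [sum_sum_laguerreCoeff_mul_Gamma n hα, waveletNorm_sq n hα, Real.rpow_add two_pos]
    have : Real.Gamma (n + α + 1) ≠ 0 := (Real.Gamma_pos_of_pos (by positivity)).ne'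
    have : (2 : ℝ) ^ α ≠ 0 := by positivity
    have : (n.factorial : ℝ) ≠ 0 := by positivity
    field_simp
    norm_num
  · filter_upwards [ae_restrict_mem measurableSet_Ioi] with t ht
    have ht' : 0 < t := ht
    rw [← hqt t ht']; positivity

theorem reproducingKernel_wavelet (n : ℕ) {α : ℝ} (hα : 0 < α) (z w : ℍ) :
    reproducingKernel (wavelet n α hα) z w =
      ((α / (4 * Real.pi) : ℝ) : ℂ) *
        inner ℂ (rep z (wavelet n α hα)) (rep w (wavelet n α hα)) := by
  rw [reproducingKernel, admissibilityConst_wavelet, ENNReal.toReal_ofReal (by positivity), inv_div]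

theorem localConst_pos (n : ℕ) {α R : ℝ} (hα : 0 < α) (hR₀ : 0 < R) (hR₁ : R < 1) :
    0 < localConst n α R := by
  refine mul_pos (by positivity) ?_
  have hR : R ^ 2 < 1 := by nlinarith
  have hcont : ContinuousOn (fun r : ℝ => (1 - r) ^ (α - 1) * jacobi n 0 α (1 - 2 * r) ^ 2)
      (Set.Icc 0 (R ^ 2)) := by
    refine ContinuousOn.mul (ContinuousOn.rpow_const (by fun_prop) fun r hr => Or.inl ?_) ?_
    · have := hr.2; linarith
    · unfold jacobi; fun_prop
  refine intervalIntegral.integral_pos (by positivity) hcont (fun r hr => ?_)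
    ⟨0, ⟨le_rfl, by positivity⟩, ?_⟩
  · have : 0 < 1 - r := by have := hr.2; linarith
    positivity
  -- the integrand does not vanish at `r = 0`
  · have : jacobi n 0 α (1 - 2 * 0) = 1 := by
      rw [jacobi_zero_left n (by linarith), Finset.sum_range_succ', Finset.sum_eq_zero]
      · have : Real.Gamma (n + α + 1) ≠ 0 := (Real.Gamma_pos_of_pos (by positivity)).ne'
        simp [this]
      · intro k _; simp
    rw [this]; simp

/-! ### The test space as a space of integrable functions -/

theorem integrable_of_testSpace {φ : H2} (h : testSpace φ) :
    Integrable (waveletTransform φ (h : H2)) := h.2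

/-- The wavelet transform as a linear map from the test space to `L¹(ℂ⁺)`; it is an isometry for
the norm of the test space. -/
noncomputable def testToL1 (φ : H2) : testSpace φ →ₗ[ℂ] Lp ℂ 1 (volume : Measure ℍ) where
  toFun h := Integrable.toL1 (waveletTransform φ (h : H2)) (integrable_of_testSpace h)
  map_add' f g := by
    rw [← Integrable.toL1_add]
    congr 1
    ext z; exact inner_add_right (rep z φ) (f : H2) (g : H2)
  map_smul' c f := by
    rw [RingHom.id_apply, ← Integrable.toL1_smul]
    congr 1
    ext z; exact H2_inner_smul_right (rep z φ) (f : H2) c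

theorem coeFn_testToL1 {φ : H2} (h : testSpace φ) :
    testToL1 φ h =ᵐ[volume] waveletTransform φ (h : H2) :=
  Integrable.coeFn_toL1 (integrable_of_testSpace h)

theorem norm_testToL1 {φ : H2} (h : testSpace φ) :
    ‖testToL1 φ h‖ = ∫ z : ℍ, ‖waveletTransform φ (h : H2) z‖ := by
  rw [L1.norm_eq_integral_norm]
  refine integral_congr_ae ?_
  filter_upwards [coeFn_testToL1 h] with z hz
  rw [hz]

/-- By the Hahn–Banach theorem, every continuous antilinear functional on the test space is
induced by a continuous linear functional on `L¹(ℂ⁺)`. -/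
theorem exists_dual_L1 {φ : H2} {f : testSpace φ →ₗ⋆[ℂ] ℂ} (hf : f ∈ antiDual φ) :
    ∃ G : Lp ℂ 1 (volume : Measure ℍ) →L[ℂ] ℂ,
      ∀ h, f h = (starRingEnd ℂ) (G (testToL1 φ h)) := by
  obtain ⟨C, hC⟩ := hf
  set J := testToL1 φ
  let g : testSpace φ →ₗ[ℂ] ℂ :=
    { toFun h := (starRingEnd ℂ) (f h)
      map_add' h k := by simp
      map_smul' c h := by simp }
  have hg : ∀ h, ‖g h‖ ≤ C * ‖J h‖ := fun h => by
    have : ‖g h‖ = ‖f h‖ := RCLike.norm_conj _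
    rw [this, norm_testToL1]; exact hC h
  -- the bound makes `g` factor through the range of `J`
  have hker : LinearMap.ker J ≤ LinearMap.ker g := fun h hh => by
    have h1 := hg h
    rw [LinearMap.mem_ker.1 hh, norm_zero, mul_zero] at h1
    exact LinearMap.mem_ker.2 (norm_le_zero_iff.1 h1)
  let g' : LinearMap.range J →ₗ[ℂ] ℂ := (LinearMap.ker J).liftQ g hker ∘ₗ
    (J.quotKerEquivRange.symm : LinearMap.range J →ₗ[ℂ] _)
  have hg' : ∀ h, g' ⟨J h, LinearMap.mem_range_self J h⟩ = g h := fun h => by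
    have : J.quotKerEquivRange.symm ⟨J h, LinearMap.mem_range_self J h⟩ =
        (LinearMap.ker J).mkQ h := LinearMap.quotKerEquivRange_symm_apply_image J h _
    simp only [g', LinearMap.comp_apply, LinearEquiv.coe_coe, this]
    rfl
  have hbound : ∀ y : LinearMap.range J, ‖g' y‖ ≤ C * ‖y‖ := by
    rintro ⟨_, h, rfl⟩
    rw [hg']; exact hg h
  obtain ⟨G, hG, -⟩ := exists_extension_norm_eq (LinearMap.range J) (g'.mkContinuous C hbound)
  refine ⟨G, fun h => ?_⟩
  have h1 := hG ⟨J h, LinearMap.mem_range_self J h⟩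
  have h2 : G (J h) = (starRingEnd ℂ) (f h) := h1.trans (hg' h)
  rw [h2, Complex.conj_conj]

theorem testToL1_testRep {φ : H2} (h : testSpace φ) (z : ℍ) :
    testToL1 φ (testRep φ z h) =
      Lp.compMeasurePreserving (affMul (affInv z)) (measurePreserving_affMul _)
        (testToL1 φ h) := by
  refine Lp.ext ?_
  filter_upwards [coeFn_testToL1 (testRep φ z h),
    Lp.coeFn_compMeasurePreserving (testToL1 φ h) (measurePreserving_affMul (affInv z)),
    (measurePreserving_affMul (affInv z)).quasiMeasurePreserving.ae (coeFn_testToL1 h)]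
    with w h1 h2 h3
  rw [h1, h2, Function.comp_apply, h3]
  exact waveletTransform_rep φ h z w

theorem norm_testToL1_testRep {φ : H2} (h : testSpace φ) (z : ℍ) :
    ‖testToL1 φ (testRep φ z h)‖ = ‖testToL1 φ h‖ := by
  rw [testToL1_testRep]; exact Lp.norm_compMeasurePreserving _ _

/-- The orbit maps are continuous in `L¹(ℂ⁺)`, because translation acts continuously there. -/
theorem continuous_testToL1_testRep {φ : H2} (h : testSpace φ) :
    Continuous fun z : ℍ => testToL1 φ (testRep φ z h) := by
  simp_rw [testToL1_testRep]
  let A : ℍ → C(ℍ, ℍ) := fun z => ⟨affMul (affInv z),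
    continuous_affMul.comp (continuous_const.prodMk continuous_id)⟩
  have hA : Continuous A := ContinuousMap.continuous_of_continuous_uncurry _
    (continuous_affMul.comp ((continuous_affInv.comp continuous_fst).prodMk continuous_snd))
  exact Continuous.compMeasurePreservingLp (g := A) continuous_const hA
    (fun z => measurePreserving_affMul (affInv z)) ENNReal.one_ne_top

/-! ### The local reproducing formula -/

theorem integrableOn_smul_testToL1 {φ ψ : H2} (hψ : ψ ∈ testSpace φ) {R : ℝ} (hR₁ : R < 1)
    (z : ℍ) : IntegrableOn (fun w : ℍ => waveletTransform ψ ψ w •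
      testToL1 φ (testRep φ (affMul z w) ⟨ψ, hψ⟩)) (pseudoDisk R UpperHalfPlane.I) := by
  refine Measure.integrableOn_of_bounded (M := ‖ψ‖ * ‖ψ‖ * ‖testToL1 φ ⟨ψ, hψ⟩‖)
    (volume_pseudoDisk_I_lt_top hR₁).ne ?_ (.of_forall fun w => ?_)
  · refine AEStronglyMeasurable.smul
      (stronglyMeasurable_waveletTransform ψ ψ).aestronglyMeasurable ?_
    exact ((continuous_testToL1_testRep ⟨ψ, hψ⟩).comp (continuous_affMul.comp
      (continuous_const.prodMk continuous_id))).aestronglyMeasurable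
  · rw [norm_smul, norm_testToL1_testRep]
    gcongr
    exact norm_waveletTransform_le w ψ ψ

/-- The weak local reproducing identity, transported to `z` and read off in `L¹(ℂ⁺)` instead of
in `H²(ℂ⁺)`. Both sides are identified through their integrals over sets of finite measure. -/
theorem setIntegral_smul_testToL1 {φ ψ : H2} (hψ : ψ ∈ testSpace φ) {R : ℝ} (hR₁ : R < 1) {C : ℂ}
    (hC : ∀ h : H2, ∫ w in pseudoDisk R UpperHalfPlane.I,
      waveletTransform ψ ψ w * inner ℂ h (rep w ψ) = C * inner ℂ h ψ) (z : ℍ) :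
    ∫ w in pseudoDisk R UpperHalfPlane.I, waveletTransform ψ ψ w •
      testToL1 φ (testRep φ (affMul z w) ⟨ψ, hψ⟩) = C • testToL1 φ (testRep φ z ⟨ψ, hψ⟩) := by
  set D := pseudoDisk R UpperHalfPlane.I
  have hint := integrableOn_smul_testToL1 hψ hR₁ z
  have hD : volume D < ⊤ := volume_pseudoDisk_I_lt_top hR₁
  refine Lp.ext ?_
  refine ae_eq_of_forall_setIntegral_eq_of_sigmaFinite
    (fun A _ _ => (L1.integrable_coeFn _).integrableOn)
    (fun A _ _ => (L1.integrable_coeFn _).integrableOn) fun A hA hAfin => ?_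
  let L : Lp ℂ 1 (volume : Measure ℍ) →L[ℂ] ℂ :=
    { toFun := fun h => ∫ v in A, h v
      map_add' := fun h k => by
        rw [← integral_add (L1.integrable_coeFn h).integrableOn
          (L1.integrable_coeFn k).integrableOn]
        exact integral_congr_ae (ae_restrict_of_ae (Lp.coeFn_add h k))
      map_smul' := fun c h => by
        rw [RingHom.id_apply, ← integral_smul]
        exact integral_congr_ae (ae_restrict_of_ae (Lp.coeFn_smul c h))
      cont := continuous_setIntegral A }
  have hL : ∀ h : testSpace φ, L (testToL1 φ h) = ∫ v in A, waveletTransform φ (h : H2) v :=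
    fun h => integral_congr_ae (ae_restrict_of_ae (coeFn_testToL1 h))
  change L _ = L _
  rw [← L.integral_comp_comm hint, map_smul, hL, smul_eq_mul]
  simp_rw [map_smul, hL, smul_eq_mul, ← integral_const_mul]
  have hG : ∀ v w : ℍ, waveletTransform φ (rep (affMul z w) ψ) v =
      inner ℂ (rep (affInv z) (rep v φ)) (rep w ψ) := fun v w => by
    rw [inner_rep_left, affInv_affInv, ← rep_affMul]; rfl
  change ∫ w in D, ∫ v in A, waveletTransform ψ ψ w *
    waveletTransform φ (rep (affMul z w) ψ) v =
      ∫ v in A, C * waveletTransform φ (rep z ψ) v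
  rw [integral_integral_swap]
  · refine integral_congr_ae (.of_forall fun v => ?_)
    simp only [hG]
    rw [hC, inner_rep_left, affInv_affInv]; rfl
  · have : IsFiniteMeasure (volume.restrict D) := isFiniteMeasure_restrict.2 hD.ne
    have : IsFiniteMeasure (volume.restrict A) := isFiniteMeasure_restrict.2 hAfin.ne
    refine Integrable.of_bound (C := ‖ψ‖ * ‖ψ‖ * (‖φ‖ * ‖ψ‖)) ?_ (.of_forall fun p => ?_)
    · refine StronglyMeasurable.aestronglyMeasurable ?_
      refine ((stronglyMeasurable_waveletTransform ψ ψ).comp_measurable measurable_fst).mul ?_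
      simp_rw [waveletTransform_rep]
      refine (stronglyMeasurable_waveletTransform φ ψ).comp_measurable ?_
      refine measurable_affMul.comp (Measurable.prodMk ?_ measurable_snd)
      exact measurable_affInv.comp (measurable_affMul.comp
        (measurable_const.prodMk measurable_fst))
    · simp only [Function.uncurry, norm_mul]
      gcongr
      · exact norm_waveletTransform_le _ ψ ψ
      · refine (norm_waveletTransform_le _ φ _).trans ?_
        rw [norm_rep]

/-- Left translation by `z` in the affine group, as a measurable equivalence. -/
noncomputable def affMulEquiv (z : ℍ) : ℍ ≃ᵐ ℍ where
  toFun := affMul z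
  invFun := affMul (affInv z)
  left_inv := affInv_affMul_cancel z
  right_inv := affMul_affInv_cancel z
  measurable_toFun := (measurePreserving_affMul z).measurable
  measurable_invFun := (measurePreserving_affMul (affInv z)).measurable

theorem measurableEmbedding_affMul (z : ℍ) : MeasurableEmbedding (affMul z) :=
  (affMulEquiv z).measurableEmbedding

/-- The pseudohyperbolic metric is invariant under the affine group. -/
theorem affMul_preimage_pseudoDisk (R : ℝ) (z : ℍ) :
    affMul z ⁻¹' pseudoDisk R z = pseudoDisk R UpperHalfPlane.I := by
  ext w
  have hz : (z.im : ℂ) ≠ 0 := by exact_mod_cast z.im_ne_zero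
  have h1 : (z : ℂ) - (affMul z w : ℍ) = z.im * ((UpperHalfPlane.I : ℂ) - w) := by
    apply Complex.ext <;> simp [affMul]; ring
  have h2 : (z : ℂ) - (starRingEnd ℂ) (affMul z w : ℍ) =
      z.im * ((UpperHalfPlane.I : ℂ) - (starRingEnd ℂ) (w : ℂ)) := by
    apply Complex.ext <;> simp [affMul]; ring
  simp only [pseudoDisk, Set.mem_preimage, Set.mem_ofPred_eq, h1, h2]
  rw [mul_div_mul_left _ _ hz]

/-- A window satisfying the weak local reproducing identity at `i` with constant `C` satisfies the
local reproducing formula, at every point, for every continuous antilinear functional on the test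
space. -/
theorem functionalTransform_local_reproducing {φ ψ : H2} (hψ : ψ ∈ testSpace φ) {R : ℝ}
    (hR₁ : R < 1) {C : ℝ}
    (hC : ∀ h : H2, ∫ w in pseudoDisk R UpperHalfPlane.I,
      waveletTransform ψ ψ w * inner ℂ h (rep w ψ) = (C : ℂ) * inner ℂ h ψ)
    {f : testSpace φ →ₗ⋆[ℂ] ℂ} (hf : f ∈ antiDual φ) (z : ℍ) :
    IntegrableOn (fun w : ℍ => functionalTransform ⟨ψ, hψ⟩ f w *
      inner ℂ (rep z ψ) (rep w ψ)) (pseudoDisk R z) ∧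
    ∫ w in pseudoDisk R z, functionalTransform ⟨ψ, hψ⟩ f w * inner ℂ (rep z ψ) (rep w ψ) =
      C * functionalTransform ⟨ψ, hψ⟩ f z := by
  obtain ⟨G, hG⟩ := exists_dual_L1 hf
  set D := pseudoDisk R UpperHalfPlane.I
  have hint := integrableOn_smul_testToL1 hψ hR₁ z
  have hGi := G.integrable_comp hint
  have hF : ∀ w, functionalTransform ⟨ψ, hψ⟩ f (affMul z w) *
      inner ℂ (rep z ψ) (rep (affMul z w) ψ) = (starRingEnd ℂ) (G (waveletTransform ψ ψ w •
        testToL1 φ (testRep φ (affMul z w) ⟨ψ, hψ⟩))) := fun w => by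
    rw [rep_affMul, inner_rep_rep, map_smul, smul_eq_mul, map_mul, ← hG, mul_comm]
    congr 1
    exact (H2_inner_conj_symm (rep w ψ) ψ).symm
  constructor
  · rw [← (measurePreserving_affMul z).integrableOn_comp_preimage (measurableEmbedding_affMul z),
      affMul_preimage_pseudoDisk]
    refine (Complex.conjCLE.toContinuousLinearMap.integrable_comp hGi).congr
      (.of_forall fun w => ?_)
    exact (hF w).symm
  · rw [← (measurePreserving_affMul z).setIntegral_preimage_emb (measurableEmbedding_affMul z),
      affMul_preimage_pseudoDisk]
    simp_rw [hF]
    rw [integral_conj, G.integral_comp_comm hint, setIntegral_smul_testToL1 hψ hR₁ hC, map_smul,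
      smul_eq_mul, map_mul, Complex.conj_ofReal, ← hG]
    rfl

end HardyWavelet

theorem mainTheorem2 (n : ℕ) (α : ℝ) (hα : 1 < α) (R : ℝ) (hR₀ : 0 < R) (hR₁ : R < 1)
    (ψ : H2) (hψ : ψ = wavelet n α (zero_lt_one.trans hα)) :
    -- the weak identity, tested against every `h` in `H²`
    (∀ h : H2,
      IntegrableOn (fun z : ℍ => waveletTransform ψ ψ z * inner ℂ h (rep z ψ))
        (pseudoDisk R UpperHalfPlane.I) ∧
      ∫ z in pseudoDisk R UpperHalfPlane.I, waveletTransform ψ ψ z * inner ℂ h (rep z ψ) =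
        (localConst n α R : ℂ) * inner ℂ h ψ) ∧
    -- the local reproducing formula on `Co L^∞`, for every admissible integrable window `φ`
    ∀ (φ : H2) (_ : IsAdmissible φ) (hφ : φ ∈ testSpace φ),
      ∃ hψ₁ : ψ ∈ testSpace φ, ∀ f ∈ coorbitLinfty φ hφ, ∀ z : ℍ,
        IntegrableOn
          (fun w : ℍ => functionalTransform ⟨ψ, hψ₁⟩ f w * reproducingKernel ψ z w)
          (pseudoDisk R z) ∧
        functionalTransform ⟨ψ, hψ₁⟩ f z =
          ((4 * Real.pi / (α * localConst n α R) : ℝ) : ℂ) *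
            ∫ w in pseudoDisk R z,
              functionalTransform ⟨ψ, hψ₁⟩ f w * reproducingKernel ψ z w := by
  subst hψ
  have hα₀ : 0 < α := zero_lt_one.trans hα
  have hC := setIntegral_waveletTransform_mul_inner n hα₀ hR₀ hR₁
  refine ⟨fun h => ⟨integrableOn_waveletTransform_mul_inner _ h hR₁, hC h⟩, fun φ hφ hφ₁ => ?_⟩
  have hψ₁ := wavelet_mem_testSpace n hα₀ hφ hφ₁
  refine ⟨hψ₁, fun f hf z => ?_⟩
  obtain ⟨hint, heq⟩ := functionalTransform_local_reproducing hψ₁ hR₁ hC hf.1 z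
  simp_rw [reproducingKernel_wavelet, mul_left_comm _ ((α / (4 * Real.pi) : ℝ) : ℂ)]
  refine ⟨hint.const_mul _, ?_⟩
  rw [integral_const_mul, heq, ← mul_assoc, ← mul_assoc, ← Complex.ofReal_mul,
    ← Complex.ofReal_mul]
  have hC₀ := (localConst_pos n hα₀ hR₀ hR₁).ne'
  have : 4 * Real.pi / (α * localConst n α R) * (α / (4 * Real.pi)) * localConst n α R = 1 := by
    field_simp
  rw [this, Complex.ofReal_one, one_mul]
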